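/- **Setting.** Let $N\ge 1$ and let $E$ be a real $N\times N$ matrix in real Jordan canonical form $E=\operatorname{diag}(J_1,\dots,J_p)$, where each $J_k$ is either a Jordan cell with a real number $\lambda$ on the diagonal and $1$'s just below it, or a real Jordan block with $2\times2$ blocks $\Lambda=\begin{pmatrix}a&-b\\ b&a\end{pmatrix}$, $b\neq0$, on the block diagonal and $I_2$'s just below it. Let $a_k$ be the real part of the eigenvalue(s) of $J_k$ ($a_k=\lambda$, respectively $a_k=a$), and suppose $1<a_1\le a_2\le\dots\le a_p$. Put $Q=\operatorname{trace}(E)$ and $c^E=\sum_{n\ge0}(\ln c)^nE^n/n!$ for $c>0$; write $E'$ for the transpose of $E$. Let $\|\cdot\|_E$ be any norm on $\mathbb R^N$ such that, with $S_E=\{x:\|x\|_E=1\}$, the map $(r,\theta)\mapsto r^E\theta$ is a homeomorphism from $(0,\infty)\times S_E$ onto $\mathbb R^N\setminus\{0\}$. For $x\ne0$ let $\tau_E(x)>0$ be the unique number with $x=\tau_E(x)^E\theta$ for some $\theta\in S_E$, let $\tau_E(0)=0$, and let $B_E(r)=\{x\in\mathbb R^N:\tau_E(x)\le r\}$. Let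 $\psi:\mathbb R^N\to[0,\infty)$ be continuous and symmetric ($\psi(-x)=\psi(x)$), with $\psi(x)>0$ and $\psi(r^{E'}x)=r\psi(x)$ for all $r>0$ and $x\ne0$. Let $\widetilde{\mathcal M}$ be a centered complex-valued Gaussian random measure on $\mathbb R^N$, that is, a centered complex-valued process indexed by the Borel sets of finite Lebesgue measure $m_N$ whose real and imaginary parts are jointly Gaussian, with $\mathbb E\big(\widetilde{\mathcal M}(A)\overline{\widetilde{\mathcal M}(B)}\big)=m_N(A\cap B)$ and $\widetilde{\mathcal M}(-A)=\overline{\widetilde{\mathcal M}(A)}$ a.s. Let $X=\{X(t),t\in\mathbb R^N\}$ be a separable version of the Gaussian random field $$X(t)=\operatorname{Re}\int_{\mathbb R^N}\big(e^{i\langle t,\xi\rangle}-1\big)\,\frac{\widetilde{\mathcal M}(d\xi)}{\psi(\xi)^{1+Q/2}},\qquad t\in\mathbb R^N,$$ the integral being the Wiener integral (the $L^2$-limit of integrals of simple functions). Separable means that there are a countable set $D\subset\mathbb R^N$ and a null event off which, for every $t$, $X(t)$ is the limit of $X(d_n)$ for some sequence $d_n\to t$ in $D$; every version with almost surely continuous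 paths is separable. For $x>0$ write $\log\log x=\ln\big((\ln x)\vee e\big)$. **Theorem.** There is a positive and finite constant $C_9$ such that for every $t_0\in\mathbb R^N$, almost surely, $$\lim_{r\to0+}\ \sup_{s\ne t_0,\ s-t_0\in B_E(r)}\frac{|X(s)-X(t_0)|}{\tau_E(s-t_0)\sqrt{\log\log\big(1+\tau_E(s-t_0)^{-1}\big)}}=C_9 .$$ -/

import Mathlib

open Filter Topology MeasureTheory ProbabilityTheory
open scoped ENNReal Pointwise

namespace OSGauss

/-! ### Real Jordan form -/

/-- The `l × l` Jordan cell with `lam` on the diagonal and `1` just below the diagonal. -/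
def realCell (l : ℕ) (lam : ℝ) : Matrix (Fin l) (Fin l) ℝ :=
  Matrix.of fun i j => if i = j then lam else if (i : ℕ) = (j : ℕ) + 1 then 1 else 0

/-- The `2l × 2l` real Jordan block of the conjugate pair `a ± ib`: an `l × l` array of
`2 × 2` blocks with `(a, -b; b, a)` on the block diagonal and `I₂` just below it.
(`finProdFinEquiv` sends `(i, u)` to `2 i + u`.) -/
def complexCell (l : ℕ) (a b : ℝ) : Matrix (Fin (l * 2)) (Fin (l * 2)) ℝ :=
  Matrix.reindex finProdFinEquiv finProdFinEquiv
    (Matrix.of fun x y : Fin l × Fin 2 =>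
      if x.1 = y.1 then (!![a, -b; b, a] : Matrix (Fin 2) (Fin 2) ℝ) x.2 y.2
      else if (x.1 : ℕ) = (y.1 : ℕ) + 1 then (1 : Matrix (Fin 2) (Fin 2) ℝ) x.2 y.2
      else 0)

/-- The data of a real Jordan block. -/
inductive JordanBlock where
  /-- a Jordan cell of size `l` for the real eigenvalue `lam` -/
  | real (l : ℕ) (hl : 0 < l) (lam : ℝ) : JordanBlock
  /-- a block of size `2l` for the non-real eigenvalues `a ± ib` -/
  | complex (l : ℕ) (hl : 0 < l) (a b : ℝ) (hb : b ≠ 0) : JordanBlock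

namespace JordanBlock

/-- The size of the block. -/
def size : JordanBlock → ℕ
  | real l _ _ => l
  | complex l _ _ _ _ => l * 2

/-- The real part of the eigenvalue(s) of the block. -/
def realPart : JordanBlock → ℝ
  | real _ _ lam => lam
  | complex _ _ a _ _ => a

/-- The block as a matrix. -/
def mat : (J : JordanBlock) → Matrix (Fin J.size) (Fin J.size) ℝ
  | real l _ lam => realCell l lam
  | complex l _ a b _ => complexCell l a b

end JordanBlock

/-- `E` is a real Jordan canonical form `diag(J₁, …, J_p)` whose blocks have eigenvalues with
real parts `1 < a₁ ≤ a₂ ≤ … ≤ a_p`. -/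
def IsAdmissibleJordanForm {N : ℕ} (E : Matrix (Fin N) (Fin N) ℝ) : Prop :=
  ∃ (p : ℕ) (J : Fin p → JordanBlock) (hN : ∑ j, (J j).size = N),
    Monotone (fun j => (J j).realPart) ∧ (∀ j, 1 < (J j).realPart) ∧
    E = Matrix.reindex (finSigmaFinEquiv.trans (finCongr hN))
      (finSigmaFinEquiv.trans (finCongr hN)) (Matrix.blockDiagonal' fun j => (J j).mat)

/-! ### Polar coordinates associated with a matrix -/

/-- The linear operator `c ^ E = ∑ (ln c)ⁿ Eⁿ / n!` on `ℝ^N`, for `c > 0`. -/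
noncomputable def opPow {N : ℕ} (E : Matrix (Fin N) (Fin N) ℝ) (c : ℝ) :
    EuclideanSpace ℝ (Fin N) →ₗ[ℝ] EuclideanSpace ℝ (Fin N) :=
  Matrix.toEuclideanLin (NormedSpace.exp (Real.log c • E))

/-- The map `Ψ(r, θ) = r ^ E θ` on `(0, ∞) × S`, where `S` is the unit sphere of `ν`. -/
noncomputable def polarMap {N : ℕ} (E : Matrix (Fin N) (Fin N) ℝ)
    (ν : Seminorm ℝ (EuclideanSpace ℝ (Fin N))) :
    Set.Ioi (0 : ℝ) × {θ : EuclideanSpace ℝ (Fin N) // ν θ = 1} → EuclideanSpace ℝ (Fin N) :=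
  fun q => opPow E (q.1 : ℝ) (q.2 : EuclideanSpace ℝ (Fin N))

/-- `ν` is a norm adapted to `E`: the map `Ψ(r, θ) = r ^ E θ` is a homeomorphism from
`(0, ∞) × {θ | ν θ = 1}` onto `ℝ^N \ {0}`. -/
structure IsPolarNorm {N : ℕ} (E : Matrix (Fin N) (Fin N) ℝ)
    (ν : Seminorm ℝ (EuclideanSpace ℝ (Fin N))) : Prop where
  /-- the seminorm is a norm -/
  eq_zero : ∀ x, ν x = 0 → x = 0
  /-- `Ψ` is a homeomorphism onto its image -/
  isEmbedding : IsEmbedding (polarMap E ν)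
  /-- the image of `Ψ` is `ℝ^N \ {0}` -/
  range_eq : Set.range (polarMap E ν) = {0}ᶜ

open Classical in
/-- The radial part of `x`: for `x ≠ 0`, the `r > 0` such that `x = r ^ E θ` for some `θ` with
`ν θ = 1`, and `0` for `x = 0`. -/
noncomputable def radial {N : ℕ} (E : Matrix (Fin N) (Fin N) ℝ)
    (ν : Seminorm ℝ (EuclideanSpace ℝ (Fin N))) (x : EuclideanSpace ℝ (Fin N)) : ℝ :=
  if h : x ≠ 0 ∧ ∃ r : ℝ, 0 < r ∧ ∃ θ, ν θ = 1 ∧ x = opPow E r θ then h.2.choose else 0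

/-! ### Homogeneous functions -/

/-- `ψ : ℝ^N → [0, ∞)` is continuous, symmetric, positive off the origin, and satisfies
`ψ (r ^ A x) = r ψ x` for `r > 0` and `x ≠ 0`. -/
structure IsSymmHomogeneous {N : ℕ} (A : Matrix (Fin N) (Fin N) ℝ)
    (ψ : EuclideanSpace ℝ (Fin N) → ℝ) : Prop where
  continuous : Continuous ψ
  nonneg : ∀ x, 0 ≤ ψ x
  pos : ∀ x, x ≠ 0 → 0 < ψ x
  homogeneous : ∀ r : ℝ, 0 < r → ∀ x, x ≠ 0 → ψ (opPow A r x) = r * ψ x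
  symm : ∀ x, ψ (-x) = ψ x

/-! ### Complex Gaussian random measures and Wiener integrals -/

/-- The sets on which a random measure with Lebesgue control measure is defined. -/
def FiniteVolumeSet (N : ℕ) : Type :=
  {A : Set (EuclideanSpace ℝ (Fin N)) // MeasurableSet A ∧ volume A < ∞}

/-- `M` is a centered complex-valued Gaussian random measure on `ℝ^N` with Lebesgue control
measure and `M (-A) = conj (M A)`. Only the values of `M` on measurable sets of finite volume
matter. -/
structure IsGaussianRandomMeasure {N : ℕ} {Ω : Type*} [MeasurableSpace Ω] (P : Measure Ω)
    (M : Set (EuclideanSpace ℝ (Fin N)) → Ω → ℂ) : Prop where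
  isGaussianProcess : IsGaussianProcess (fun A : FiniteVolumeSet N => M A.1) P
  centered : ∀ A, MeasurableSet A → volume A < ∞ → ∫ ω, M A ω ∂P = 0
  covariance : ∀ A B, MeasurableSet A → volume A < ∞ → MeasurableSet B → volume B < ∞ →
    ∫ ω, M A ω * (starRingEnd ℂ) (M B ω) ∂P = ((volume (A ∩ B)).toReal : ℂ)
  neg : ∀ A, MeasurableSet A → volume A < ∞ →
    ∀ᵐ ω ∂P, M (-A) ω = (starRingEnd ℂ) (M A ω)

/-- The integral of a simple function `φ` against `M`: the sum of `c * M (φ = c)` over the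
nonzero values `c` of `φ`. -/
noncomputable def simpleIntegral {N : ℕ} {Ω : Type*}
    (M : Set (EuclideanSpace ℝ (Fin N)) → Ω → ℂ)
    (φ : SimpleFunc (EuclideanSpace ℝ (Fin N)) ℂ) (ω : Ω) : ℂ :=
  ∑ c ∈ φ.range with c ≠ 0, c * M (φ ⁻¹' {c}) ω

/-- `Y` is (a version of) the Wiener integral `∫ f dM`: there are square-integrable simple
functions converging to `f` in `L²(ℝ^N)` whose integrals converge to `Y` in `L²(P)`. -/
def IsWienerIntegral {N : ℕ} {Ω : Type*} [MeasurableSpace Ω] (P : Measure Ω)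
    (M : Set (EuclideanSpace ℝ (Fin N)) → Ω → ℂ) (f : EuclideanSpace ℝ (Fin N) → ℂ)
    (Y : Ω → ℂ) : Prop :=
  AEStronglyMeasurable f volume ∧ AEStronglyMeasurable Y P ∧
  ∃ φ : ℕ → SimpleFunc (EuclideanSpace ℝ (Fin N)) ℂ,
    (∀ n, MemLp (φ n) 2 volume) ∧
    Tendsto (fun n => eLpNorm (fun ξ => φ n ξ - f ξ) 2 volume) atTop (𝓝 0) ∧
    Tendsto (fun n => eLpNorm (fun ω => simpleIntegral M (φ n) ω - Y ω) 2 P) atTop (𝓝 0)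

/-! ### The random field -/

/-- The harmonizable kernel `ξ ↦ (e^{i⟨t, ξ⟩} - 1) / ψ(ξ)^{1 + Q/2}` with `Q = trace E`. -/
noncomputable def harmonizableKernel {N : ℕ} (E : Matrix (Fin N) (Fin N) ℝ)
    (ψ : EuclideanSpace ℝ (Fin N) → ℝ) (t ξ : EuclideanSpace ℝ (Fin N)) : ℂ :=
  (Complex.exp (Complex.I * ((inner ℝ t ξ : ℝ) : ℂ)) - 1) /
    ((ψ ξ ^ (1 + E.trace / 2) : ℝ) : ℂ)

/-- `X` is a version of the field
`X(t) = Re ∫ (e^{i⟨t, ξ⟩} - 1) ψ(ξ)^{-1-Q/2} M(dξ)`, `t ∈ ℝ^N`, for some complex Gaussian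
random measure `M`. -/
def IsHarmonizableField {N : ℕ} {Ω : Type*} [MeasurableSpace Ω] (P : Measure Ω)
    (E : Matrix (Fin N) (Fin N) ℝ) (ψ : EuclideanSpace ℝ (Fin N) → ℝ)
    (X : EuclideanSpace ℝ (Fin N) → Ω → ℝ) : Prop :=
  ∃ M : Set (EuclideanSpace ℝ (Fin N)) → Ω → ℂ, IsGaussianRandomMeasure P M ∧
    ∀ t, ∃ Y : Ω → ℂ, IsWienerIntegral P M (harmonizableKernel E ψ t) Y ∧
      ∀ᵐ ω ∂P, X t ω = (Y ω).re

/-- Separability in the sense of Doob: there are a countable set `D` and a null event off which,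
for every `t`, the value `X t` is a limit of values `X d` as `d → t` in `D`. Every field with
almost surely continuous sample paths is separable. -/
def IsSeparableField {N : ℕ} {Ω : Type*} [MeasurableSpace Ω] (P : Measure Ω)
    (X : EuclideanSpace ℝ (Fin N) → Ω → ℝ) : Prop :=
  ∃ D : Set (EuclideanSpace ℝ (Fin N)), D.Countable ∧
    ∀ᵐ ω ∂P, ∀ t, MapClusterPt (X t ω) (𝓝[D] t) (fun d => X d ω)

/-! ### The local modulus of continuity -/

/-- `log log x = ln ((ln x) ∨ e)`. -/
noncomputable def loglog (x : ℝ) : ℝ := Real.log (max (Real.log x) (Real.exp 1))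

/-- The supremum of `|x s - x t₀| / (τ(s - t₀) √(log log (1 + τ(s - t₀)⁻¹)))` over the points
`s ≠ t₀` with `τ(s - t₀) ≤ r`, as an element of `[0, ∞]`. -/
noncomputable def localModulus {N : ℕ} (τ : EuclideanSpace ℝ (Fin N) → ℝ)
    (x : EuclideanSpace ℝ (Fin N) → ℝ) (t₀ : EuclideanSpace ℝ (Fin N)) (r : ℝ) : ℝ≥0∞ :=
  ⨆ s ∈ {s : EuclideanSpace ℝ (Fin N) | s ≠ t₀ ∧ τ (s - t₀) ≤ r},
    ENNReal.ofReal (|x s - x t₀| /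
      (τ (s - t₀) * Real.sqrt (loglog (1 + (τ (s - t₀))⁻¹))))

end OSGauss

/-!
The real parts of the Wiener integrals against the random measure form an isonormal Gaussian process
on the Hermitian functions of `L²(ℝ^N)` (`exists_isIsonormal`). Hence `X` is a centered Gaussian
field with stationary increments, whose standard deviation function `σ` (`fieldStd`) is the `L²`
norm of the kernel, and the homogeneity of `ψ` gives `σ (c ^ E t) = c σ t`. The function `σ` is
subadditive, so by Baire's theorem and this scaling it is locally Hölder continuous, and it is
comparable with the radial part (`exists_fieldStd_comparable`). Only the existence of the Wiener
integrals, that is the square-integrability of the kernels, and the group law, the determinant and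
the polynomial growth of the operators `c ^ E` enter.

A chaining argument (`exists_chaining_tail`) bounds the Hölder constant of a Gaussian field with
standard deviation `σ` on a cube, with Gaussian tails. Together with separability it yields
continuous paths. Applied to the rescaled fields `2 ^ n X ((2 ^ {-n}) ^ E t)`, which all have the
standard deviation function `σ`, it yields the upper bound of order `τ √(log log (1 / τ))` at the
origin (`exists_localModulus_le`). For the lower bound (`exists_le_localModulus`), the values of `X`
along a geometric sequence `(ρ ^ n) ^ E θ` are split by frequency: a ring of frequencies around
`ρ ^ {-n}` carries most of the variance, the contributions of disjoint rings are independent, so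
they exceed `√(log n)` standard deviations infinitely often, and the remainders are too small to
compensate this.

For continuous paths the local modulus at `t₀` converges, as `r → 0`, to a measurable functional of
the increments `X (t₀ + d k) - X t₀` along a dense sequence (`tendsto_localModulus`). Perturbations
of the increments of size `O(τ)` do not change this functional, because `log log (1 / τ) → ∞`. A
zero-one law (`measure_eq_zero_or_one_of_invariant`) therefore makes it almost surely constant: an
event invariant under translations dominated by the standard deviations does not change when the
regression on a finite linear combination of the variables is subtracted, so it is independent of
all these combinations, hence of itself. The law of the increments does not depend on `t₀`, hence
neither does the constant, and the two bounds at the origin show that it is positive and finite.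
-/

namespace OSGauss

/-! ### Gaussian variables in `L²` -/

section GaussianLimits

variable {Ω : Type*} [MeasurableSpace Ω] {P : Measure Ω}

/-- An element of `L²(P)` whose law is the centered Gaussian law with its own second moment. -/
def IsCenteredGaussian (P : Measure Ω) (y : Lp ℝ 2 P) : Prop :=
  P.map y = gaussianReal 0 (‖y‖ ^ 2).toNNReal

lemma norm_sq_eq_integral_sq (y : Lp ℝ 2 P) : ‖y‖ ^ 2 = ∫ ω, y ω ^ 2 ∂P := by
  rw [← real_inner_self_eq_norm_sq, L2.inner_def]
  refine integral_congr_ae (ae_of_all _ fun ω => ?_)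
  simp [sq]

lemma isCenteredGaussian_toLp {Y : Ω → ℝ} (hY : HasGaussianLaw Y P) (h0 : ∫ ω, Y ω ∂P = 0) :
    IsCenteredGaussian P (hY.memLp_two.toLp Y) := by
  have := hY.isProbabilityMeasure
  have h := hY.memLp_two.coeFn_toLp
  rw [IsCenteredGaussian, Measure.map_congr h, hY.map_eq_gaussianReal, h0, norm_sq_eq_integral_sq,
    variance_of_integral_eq_zero hY.aemeasurable h0]
  congr 2
  exact integral_congr_ae (h.mono fun ω hω => by simp [hω])

lemma isCenteredGaussian_iff_charFun [IsProbabilityMeasure P] (y : Lp ℝ 2 P) :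
    IsCenteredGaussian P y ↔
      ∀ t : ℝ, ∫ ω, Complex.exp (t * y ω * Complex.I) ∂P =
        Complex.exp (-((‖y‖ ^ 2 * t ^ 2 / 2 : ℝ) : ℂ)) := by
  have hy : AEMeasurable y P := (Lp.aestronglyMeasurable y).aemeasurable
  have : IsProbabilityMeasure (P.map y) := Measure.isProbabilityMeasure_map hy
  have key : ∀ t : ℝ, charFun (P.map y) t = ∫ ω, Complex.exp (t * y ω * Complex.I) ∂P := by
    intro t
    rw [charFun_apply_real, integral_map hy (by fun_prop)]
  have key2 : ∀ t : ℝ, charFun (gaussianReal 0 (‖y‖ ^ 2).toNNReal) t =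
      Complex.exp (-((‖y‖ ^ 2 * t ^ 2 / 2 : ℝ) : ℂ)) := by
    intro t
    rw [charFun_gaussianReal, Real.coe_toNNReal _ (by positivity)]
    congr 1
    push_cast
    ring
  constructor
  · intro h t
    rw [← key, ← key2, h]
  · intro h
    refine Measure.ext_of_charFun (funext fun t => ?_)
    rw [key, key2, h]

/-- Centered Gaussian laws are preserved under `L²` limits. -/
lemma isClosed_setOf_isCenteredGaussian [IsProbabilityMeasure P] :
    IsClosed {y : Lp ℝ 2 P | IsCenteredGaussian P y} := by
  simp_rw [isCenteredGaussian_iff_charFun, Set.ofPred_forall]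
  refine isClosed_iInter fun t => isClosed_eq ?_ (by fun_prop)
  have hint : ∀ y : Lp ℝ 2 P, Integrable (fun ω => Complex.exp (t * y ω * Complex.I)) P := by
    intro y
    have hy := Lp.aestronglyMeasurable y
    refine Integrable.of_bound (C := 1) (by fun_prop) (ae_of_all _ fun ω => ?_)
    rw [show (t * y ω * Complex.I : ℂ) = ((t * y ω : ℝ) : ℂ) * Complex.I by push_cast; ring,
      Complex.norm_exp_ofReal_mul_I]
  refine (LipschitzWith.of_dist_le_mul (K := ‖t‖₊) fun y z => ?_).continuous
  have hyz : Integrable (fun ω => y ω - z ω) P :=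
    ((Lp.memLp y).sub (Lp.memLp z)).integrable one_le_two
  rw [dist_eq_norm, ← integral_sub (hint y) (hint z)]
  calc ‖∫ ω, Complex.exp (t * y ω * Complex.I) - Complex.exp (t * z ω * Complex.I) ∂P‖
      ≤ ∫ ω, ‖t‖ * ‖y ω - z ω‖ ∂P := by
        refine norm_integral_le_of_norm_le (hyz.norm.const_mul _) (ae_of_all _ fun ω => ?_)
        have h1 : Complex.exp (t * y ω * Complex.I) - Complex.exp (t * z ω * Complex.I) =
            Complex.exp ((t * z ω : ℝ) * Complex.I) *
              (Complex.exp (Complex.I * (t * (y ω - z ω) : ℝ)) - 1) := by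
          rw [mul_sub, ← Complex.exp_add, mul_one]
          congr 2 <;> (push_cast; ring)
        rw [h1, norm_mul, Complex.norm_exp_ofReal_mul_I, one_mul, ← norm_mul]
        exact Real.norm_exp_I_mul_ofReal_sub_one_le
    _ = ‖t‖ * ∫ ω, ‖(y - z : Lp ℝ 2 P) ω‖ ∂P := by
        rw [integral_const_mul]
        congr 1
        refine integral_congr_ae ((Lp.coeFn_sub y z).mono fun ω hω => ?_)
        simp only [hω, Pi.sub_apply]
    _ ≤ ‖t‖ * dist y z := by
        refine mul_le_mul_of_nonneg_left ?_ (norm_nonneg _)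
        rw [dist_eq_norm, Lp.norm_def]
        have hm := Lp.memLp (y - z)
        rw [integral_norm_eq_lintegral_enorm hm.1, ← eLpNorm_one_eq_lintegral_enorm]
        exact ENNReal.toReal_mono hm.2.ne
          (eLpNorm_le_eLpNorm_of_exponent_le one_le_two hm.1)

end GaussianLimits

/-! ### The Wiener integral -/

section WienerGraph

variable {N : ℕ} {Ω : Type*} [MeasurableSpace Ω] {P : Measure Ω}
  {M : Set (EuclideanSpace ℝ (Fin N)) → Ω → ℂ}

/-- The complex Hilbert space `L²(ℝ^N)`. -/
noncomputable abbrev FreqL2 (N : ℕ) := Lp ℂ 2 (volume : Measure (EuclideanSpace ℝ (Fin N)))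

/-- The `L²` limit of square-integrable functions is square-integrable. -/
lemma memLp_of_tendsto_eLpNorm {α : Type*} [MeasurableSpace α] {μ : Measure α}
    {g : α → ℂ} {u : ℕ → α → ℂ} (hg : AEStronglyMeasurable g μ) (hu : ∀ n, MemLp (u n) 2 μ)
    (hlim : Tendsto (fun n => eLpNorm (fun x => u n x - g x) 2 μ) atTop (𝓝 0)) : MemLp g 2 μ := by
  obtain ⟨n, hn⟩ := (hlim.eventually (gt_mem_nhds ENNReal.zero_lt_top)).exists
  have h3 : MemLp (fun x => u n x - g x) 2 μ := ⟨(hu n).1.sub hg, hn⟩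
  convert (hu n).sub h3 using 1
  ext x
  simp

/-- A function with a Wiener integral is square-integrable. -/
lemma IsWienerIntegral.memLp {f : EuclideanSpace ℝ (Fin N) → ℂ} {Y : Ω → ℂ}
    (h : IsWienerIntegral P M f Y) : MemLp f 2 volume := by
  obtain ⟨hfm, hYm, φ, hφ, h1, h2⟩ := h
  exact memLp_of_tendsto_eLpNorm hfm hφ h1

namespace IsGaussianRandomMeasure

lemma memLp (hM : IsGaussianRandomMeasure P M) {A : Set (EuclideanSpace ℝ (Fin N))}
    (hA : MeasurableSet A) (hv : volume A < ∞) : MemLp (M A) 2 P :=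
  (hM.isGaussianProcess.hasGaussianLaw_eval ⟨A, hA, hv⟩).memLp_two

/-- The pairs `(1_A, M A)`, for `A` of finite volume. -/
def pairs (hM : IsGaussianRandomMeasure P M) : Set (FreqL2 N × Lp ℂ 2 P) :=
  {p | ∃ (A : Set (EuclideanSpace ℝ (Fin N))) (hA : MeasurableSet A) (hv : volume A < ∞),
    p = (indicatorConstLp 2 hA hv.ne 1, (hM.memLp hA hv).toLp (M A))}

/-- The graph of the Wiener integral `f ↦ ∫ f dM`, as a closed subspace of `L²(ℝ^N) × L²(P)`. -/
noncomputable def graph (hM : IsGaussianRandomMeasure P M) : Submodule ℂ (FreqL2 N × Lp ℂ 2 P) :=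
  (Submodule.span ℂ hM.pairs).topologicalClosure

lemma isClosed_graph (hM : IsGaussianRandomMeasure P M) :
    IsClosed (hM.graph : Set (FreqL2 N × Lp ℂ 2 P)) :=
  Submodule.isClosed_topologicalClosure _

lemma inner_pairs (hM : IsGaussianRandomMeasure P M) {p q : FreqL2 N × Lp ℂ 2 P}
    (hp : p ∈ hM.pairs) (hq : q ∈ hM.pairs) : inner ℂ p.1 q.1 = inner ℂ p.2 q.2 := by
  obtain ⟨A, hA, hv, rfl⟩ := hp
  obtain ⟨B, hB, hw, rfl⟩ := hq
  simp only
  rw [L2.inner_indicatorConstLp_one_indicatorConstLp_one, L2.inner_def]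
  have h := hM.covariance B A hB hw hA hv
  rw [Set.inter_comm] at h
  rw [measureReal_def, RCLike.ofReal_eq_complex_ofReal, ← h]
  refine integral_congr_ae ?_
  filter_upwards [(hM.memLp hA hv).coeFn_toLp, (hM.memLp hB hw).coeFn_toLp] with ω h1 h2
  simp [h1, h2]

/-- The Wiener integral preserves inner products. -/
lemma inner_graph (hM : IsGaussianRandomMeasure P M) {p q : FreqL2 N × Lp ℂ 2 P}
    (hp : p ∈ hM.graph) (hq : q ∈ hM.graph) : inner ℂ p.1 q.1 = inner ℂ p.2 q.2 := by
  have h1 : ∀ p ∈ Submodule.span ℂ hM.pairs, ∀ q ∈ Submodule.span ℂ hM.pairs,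
      inner ℂ p.1 q.1 = inner ℂ p.2 q.2 := by
    intro p hp q hq
    induction hp, hq using Submodule.span_induction₂ with
    | mem_mem x y hx hy => exact hM.inner_pairs hx hy
    | zero_left y hy => simp
    | zero_right x hx => simp
    | add_left x y z _ _ _ h1 h2 => simp [inner_add_left, h1, h2]
    | add_right x y z _ _ _ h1 h2 => simp [inner_add_right, h1, h2]
    | smul_left r x y _ _ h => simp [inner_smul_left, h]
    | smul_right r x y _ _ h => simp [inner_smul_right, h]
  have h2 : ∀ q ∈ Submodule.span ℂ hM.pairs, ∀ p ∈ hM.graph,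
      inner ℂ p.1 q.1 = inner ℂ p.2 q.2 := fun q hq p hp =>
    closure_minimal (s := (Submodule.span ℂ hM.pairs : Set (FreqL2 N × Lp ℂ 2 P)))
      (t := {p | inner ℂ p.1 q.1 = inner ℂ p.2 q.2}) (fun p hp => h1 p hp q hq)
      (isClosed_eq (by fun_prop) (by fun_prop)) hp
  exact closure_minimal (s := (Submodule.span ℂ hM.pairs : Set (FreqL2 N × Lp ℂ 2 P)))
      (t := {q | inner ℂ p.1 q.1 = inner ℂ p.2 q.2}) (fun q hq => h2 q hq p hp)
      (isClosed_eq (by fun_prop) (by fun_prop)) hq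

lemma norm_graph (hM : IsGaussianRandomMeasure P M) {p : FreqL2 N × Lp ℂ 2 P}
    (hp : p ∈ hM.graph) : ‖p.1‖ = ‖p.2‖ := by
  have h := hM.inner_graph hp hp
  rw [inner_self_eq_norm_sq_to_K, inner_self_eq_norm_sq_to_K] at h
  have h' : ‖p.1‖ ^ 2 = ‖p.2‖ ^ 2 := by exact_mod_cast h
  exact (sq_eq_sq₀ (norm_nonneg _) (norm_nonneg _)).1 h'

lemma snd_eq_of_mem_graph (hM : IsGaussianRandomMeasure P M) {f : FreqL2 N} {y z : Lp ℂ 2 P}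
    (hy : (f, y) ∈ hM.graph) (hz : (f, z) ∈ hM.graph) : y = z := by
  have h := hM.norm_graph (hM.graph.sub_mem hy hz)
  simp only [Prod.fst_sub, sub_self, norm_zero, Prod.snd_sub] at h
  exact sub_eq_zero.1 (norm_eq_zero.1 h.symm)

lemma indicator_mem_graph (hM : IsGaussianRandomMeasure P M) {A : Set (EuclideanSpace ℝ (Fin N))}
    (hA : MeasurableSet A) (hv : volume A < ∞) (c : ℂ) :
    (indicatorConstLp 2 hA hv.ne c, c • (hM.memLp hA hv).toLp (M A)) ∈
      Submodule.span ℂ hM.pairs := by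
  have h := Submodule.smul_mem _ c (Submodule.subset_span (s := hM.pairs) ⟨A, hA, hv, rfl⟩)
  convert h using 1
  ext1
  · simp only [Prod.smul_mk]
    ext1
    filter_upwards [indicatorConstLp_coeFn (p := 2) (hs := hA) (hμs := hv.ne) (c := c),
      Lp.coeFn_smul c (indicatorConstLp 2 hA hv.ne (1 : ℂ)),
      indicatorConstLp_coeFn (p := 2) (hs := hA) (hμs := hv.ne) (c := (1 : ℂ))] with x h1 h2 h3
    rw [h1, h2, Pi.smul_apply, h3]
    by_cases hx : x ∈ A <;> simp [hx]
  · simp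

/-- Every `f ∈ L²(ℝ^N)` has a Wiener integral: the projection of the graph to `L²(ℝ^N)` is an
isometry, so its range is closed, and it contains the indicators. -/
lemma exists_mem_graph (hM : IsGaussianRandomMeasure P M) (f : FreqL2 N) :
    ∃ y, (f, y) ∈ hM.graph := by
  have hcl : IsClosed {f : FreqL2 N | ∃ y, (f, y) ∈ hM.graph} := by
    have : CompleteSpace hM.graph := hM.isClosed_graph.isComplete.completeSpace_coe
    have hiso : Isometry (fun p : hM.graph => (p : FreqL2 N × Lp ℂ 2 P).1) := by
      refine Isometry.of_dist_eq fun p q => ?_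
      have h := hM.norm_graph (hM.graph.sub_mem p.2 q.2)
      rw [Subtype.dist_eq, Prod.dist_eq, dist_eq_norm, dist_eq_norm]
      rw [Prod.fst_sub, Prod.snd_sub] at h
      rw [← h, max_self]
    convert hiso.isClosedEmbedding.isClosed_range using 1
    ext f
    simp
  refine Lp.induction (p := 2) (by simp) (motive := fun f => ∃ y, (f, y) ∈ hM.graph)
    ?_ ?_ hcl f
  · intro c s hs hμs
    exact ⟨_, Submodule.le_topologicalClosure _ (hM.indicator_mem_graph hs hμs c)⟩
  · rintro f g hf hg - ⟨y, hy⟩ ⟨z, hz⟩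
    exact ⟨y + z, hM.graph.add_mem hy hz⟩

lemma simpleIntegral_mem_graph (hM : IsGaussianRandomMeasure P M)
    {φ : SimpleFunc (EuclideanSpace ℝ (Fin N)) ℂ} (hφ : MemLp φ 2 volume) :
    ∃ h : MemLp (simpleIntegral M φ) 2 P,
      (hφ.toLp φ, h.toLp _) ∈ Submodule.span ℂ hM.pairs := by
  classical
  have hv : ∀ c ∈ φ.range.filter (· ≠ 0), volume (φ ⁻¹' {c}) < ∞ := fun c hc =>
    SimpleFunc.measure_preimage_lt_top_of_memLp two_ne_zero (by simp) φ hφ c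
      (Finset.mem_filter.1 hc).2
  have hm : ∀ c, MeasurableSet (φ ⁻¹' {c}) := fun c => φ.measurableSet_preimage _
  have hmem : ∀ c ∈ φ.range.filter (· ≠ 0), MemLp (fun ω => c * M (φ ⁻¹' {c}) ω) 2 P :=
    fun c hc => (hM.memLp (hm c) (hv c hc)).const_mul c
  have hS : MemLp (simpleIntegral M φ) 2 P := memLp_finsetSum _ hmem
  refine ⟨hS, ?_⟩
  have hsum := Submodule.sum_mem (Submodule.span ℂ hM.pairs)
    (t := (φ.range.filter (· ≠ 0)).attach)
    (fun c _ => hM.indicator_mem_graph (hm c) (hv c.1 c.2) c.1)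
  convert hsum using 1
  ext1
  · rw [Prod.fst_sum]
    ext1
    have h1 : ∀ᵐ x ∂(volume : Measure (EuclideanSpace ℝ (Fin N))),
        ∀ c : {c // c ∈ φ.range.filter (· ≠ 0)},
        indicatorConstLp 2 (hm c) (hv c.1 c.2).ne c.1 x
          = (φ ⁻¹' {c.1}).indicator (fun _ => c.1) x :=
      ae_all_iff.2 fun c => indicatorConstLp_coeFn
    filter_upwards [hφ.coeFn_toLp, h1, Lp.coeFn_finsetSum (φ.range.filter (· ≠ 0)).attach
      (fun c => indicatorConstLp 2 (hm c) (hv c.1 c.2).ne c.1)] with x hx1 hx2 hx3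
    rw [hx1, hx3, Finset.sum_apply, Finset.sum_congr rfl fun c _ => hx2 c,
      Finset.sum_attach _ (fun c => (φ ⁻¹' {c}).indicator (fun _ => c) x)]
    by_cases h0 : φ x = 0
    · rw [h0, Finset.sum_eq_zero]
      intro c hc
      have : c ≠ 0 := (Finset.mem_filter.1 hc).2
      simp [h0, this.symm]
    · rw [Finset.sum_eq_single (φ x)]
      · simp
      · intro c _ hc
        simp [hc.symm]
      · intro h
        exact absurd (Finset.mem_filter.2 ⟨φ.mem_range_self x, h0⟩) h
  · rw [Prod.snd_sum]
    ext1
    have h1 : ∀ᵐ ω ∂P, ∀ c : {c // c ∈ φ.range.filter (· ≠ 0)},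
        (c.1 • (hM.memLp (hm c.1) (hv c.1 c.2)).toLp (M (φ ⁻¹' {c.1})) : Lp ℂ 2 P) ω
          = c.1 * M (φ ⁻¹' {c.1}) ω :=
      ae_all_iff.2 fun c => by
        filter_upwards [Lp.coeFn_smul c.1 ((hM.memLp (hm c.1) (hv c.1 c.2)).toLp _),
          (hM.memLp (hm c.1) (hv c.1 c.2)).coeFn_toLp] with ω h1 h2
        rw [h1, Pi.smul_apply, h2, smul_eq_mul]
    filter_upwards [hS.coeFn_toLp, h1, Lp.coeFn_finsetSum (φ.range.filter (· ≠ 0)).attach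
      (fun c => c.1 • (hM.memLp (hm c.1) (hv c.1 c.2)).toLp (M (φ ⁻¹' {c.1})))] with ω h2 h3 h4
    rw [h2, h4, Finset.sum_apply, Finset.sum_congr rfl fun c _ => h3 c,
      Finset.sum_attach _ (fun c => c * M (φ ⁻¹' {c}) ω)]
    rfl

/-- The real part of a Wiener integral is a centered Gaussian variable. -/
lemma re_isCenteredGaussian (hM : IsGaussianRandomMeasure P M) {p : FreqL2 N × Lp ℂ 2 P}
    (hp : p ∈ hM.graph) : IsCenteredGaussian P (Complex.reCLM.compLpL 2 P p.2) := by
  have := hM.isGaussianProcess.isProbabilityMeasure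
  have h1 : ∀ p ∈ Submodule.span ℂ hM.pairs,
      IsCenteredGaussian P (Complex.reCLM.compLpL 2 P p.2) := by
    intro p hp
    obtain ⟨n, c, g, rfl⟩ := Submodule.mem_span_set'.1 hp
    choose A hA hv hg using fun i => (g i).2
    classical
    let T : Fin n → FiniteVolumeSet N := fun i => ⟨A i, hA i, hv i⟩
    have hG : HasGaussianLaw (fun ω => ∑ i, (c i * M (A i) ω).re) P := by
      have h2 : IsGaussianProcess (fun (i : Fin n) ω => (c i * M (A i) ω).re) P :=
        (hM.isGaussianProcess.comp_right T).comp_left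
          (fun i => Complex.reCLM.comp (ContinuousLinearMap.mul ℝ ℂ (c i)))
      exact h2.hasGaussianLaw_fun_sum (I := Finset.univ)
    have hint : ∀ i, Integrable (fun ω => c i * M (A i) ω) P := fun i =>
      ((hM.memLp (hA i) (hv i)).integrable one_le_two).const_mul _
    have h0 : ∫ ω, ∑ i, (c i * M (A i) ω).re ∂P = 0 := by
      have hint' : ∀ i, Integrable (fun ω => (c i * M (A i) ω).re) P := fun i =>
        Complex.reCLM.integrable_comp (hint i)
      rw [integral_finsetSum _ fun i _ => hint' i]
      refine Finset.sum_eq_zero fun i _ => ?_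
      refine (Complex.reCLM.integral_comp_comm (hint i)).trans ?_
      rw [integral_const_mul, hM.centered _ (hA i) (hv i)]
      simp
    convert isCenteredGaussian_toLp hG h0 using 1
    ext1
    have h3 : ∀ᵐ ω ∂P, ∀ i, (c i • (g i : FreqL2 N × Lp ℂ 2 P)).2 ω = c i * M (A i) ω :=
      ae_all_iff.2 fun i => by
        rw [hg i, Prod.smul_mk]
        filter_upwards [Lp.coeFn_smul (c i) ((hM.memLp (hA i) (hv i)).toLp _),
          (hM.memLp (hA i) (hv i)).coeFn_toLp] with ω h1 h2
        rw [h1, Pi.smul_apply, h2, smul_eq_mul]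
    rw [Prod.snd_sum]
    filter_upwards [h3, Complex.reCLM.coeFn_compLpL
      (∑ i, (c i • (g i : FreqL2 N × Lp ℂ 2 P)).2), hG.memLp_two.coeFn_toLp,
      Lp.coeFn_finsetSum Finset.univ (fun i => (c i • (g i : FreqL2 N × Lp ℂ 2 P)).2)]
      with ω e1 e2 e3 e4
    rw [e2, e3, e4, Finset.sum_apply, Finset.sum_congr rfl fun c _ => e1 c]
    simp
  exact closure_minimal (s := (Submodule.span ℂ hM.pairs : Set (FreqL2 N × Lp ℂ 2 P)))
      (t := {p | IsCenteredGaussian P (Complex.reCLM.compLpL 2 P p.2)}) h1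
      (isClosed_setOf_isCenteredGaussian.preimage (by fun_prop)) hp

/-- The involution `f ↦ conj f(-·)` of `L²(ℝ^N)`. -/
noncomputable def reflectConj (N : ℕ) : FreqL2 N →L[ℝ] FreqL2 N :=
  ((Complex.conjCLE : ℂ →L[ℝ] ℂ).compLpL 2 volume).comp
    (Lp.compMeasurePreservingₗᵢ ℝ (fun x : EuclideanSpace ℝ (Fin N) => -x)
      (Measure.measurePreserving_neg volume)).toContinuousLinearMap

lemma reflectConj_coeFn (f : FreqL2 N) :
    reflectConj N f =ᵐ[volume] fun x => (starRingEnd ℂ) (f (-x)) := by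
  have h1 := (Complex.conjCLE : ℂ →L[ℝ] ℂ).coeFn_compLpL (p := 2)
    (Lp.compMeasurePreservingₗᵢ ℝ (fun x : EuclideanSpace ℝ (Fin N) => -x)
      (Measure.measurePreserving_neg volume) f)
  have h2 := Lp.coeFn_compMeasurePreserving f
    (Measure.measurePreserving_neg (volume : Measure (EuclideanSpace ℝ (Fin N))))
  filter_upwards [h1, h2] with x e1 e2
  refine e1.trans ?_
  refine (congrArg (fun z => (Complex.conjCLE : ℂ →L[ℝ] ℂ) z) e2).trans ?_
  simp

lemma reflectConj_smul (c : ℂ) (f : FreqL2 N) :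
    reflectConj N (c • f) = (starRingEnd ℂ) c • reflectConj N f := by
  ext1
  have hneg := (Measure.measurePreserving_neg
    (volume : Measure (EuclideanSpace ℝ (Fin N)))).quasiMeasurePreserving
  filter_upwards [reflectConj_coeFn (c • f), reflectConj_coeFn f,
    Lp.coeFn_smul ((starRingEnd ℂ) c) (reflectConj N f), hneg.ae (Lp.coeFn_smul c f)]
    with x e1 e2 e3 e4
  rw [e1, e3, Pi.smul_apply, e2, e4]
  simp

lemma conj_compLpL_smul (c : ℂ) (y : Lp ℂ 2 P) :
    (Complex.conjCLE : ℂ →L[ℝ] ℂ).compLpL 2 P (c • y) =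
      (starRingEnd ℂ) c • (Complex.conjCLE : ℂ →L[ℝ] ℂ).compLpL 2 P y := by
  ext1
  filter_upwards [(Complex.conjCLE : ℂ →L[ℝ] ℂ).coeFn_compLpL (c • y),
    (Complex.conjCLE : ℂ →L[ℝ] ℂ).coeFn_compLpL y, Lp.coeFn_smul c y,
    Lp.coeFn_smul ((starRingEnd ℂ) c) ((Complex.conjCLE : ℂ →L[ℝ] ℂ).compLpL 2 P y)]
    with x e1 e2 e3 e4
  rw [e1, e4, Pi.smul_apply, e2, e3]
  simp

/-- The symmetry `M (-A) = conj (M A)` extends to Wiener integrals: the integral of `conj f(-·)` is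
the conjugate of the integral of `f`. -/
lemma conj_mem_graph (hM : IsGaussianRandomMeasure P M) {p : FreqL2 N × Lp ℂ 2 P}
    (hp : p ∈ hM.graph) :
    (reflectConj N p.1, (Complex.conjCLE : ℂ →L[ℝ] ℂ).compLpL 2 P p.2) ∈ hM.graph := by
  have h1 : ∀ p ∈ Submodule.span ℂ hM.pairs,
      (reflectConj N p.1, (Complex.conjCLE : ℂ →L[ℝ] ℂ).compLpL 2 P p.2) ∈
        Submodule.span ℂ hM.pairs := by
    intro p hp
    induction hp using Submodule.span_induction with
    | mem p hp =>
      obtain ⟨A, hA, hv, rfl⟩ := hp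
      have hv' : volume (-A) < ∞ := by rwa [Measure.measure_neg]
      refine Submodule.subset_span ⟨-A, hA.neg, hv', ?_⟩
      ext1
      · simp only
        ext1
        have hneg := (Measure.measurePreserving_neg
          (volume : Measure (EuclideanSpace ℝ (Fin N)))).quasiMeasurePreserving
        filter_upwards [reflectConj_coeFn (indicatorConstLp 2 hA hv.ne (1 : ℂ)),
          hneg.ae (indicatorConstLp_coeFn (p := 2) (hs := hA) (hμs := hv.ne) (c := (1 : ℂ))),
          indicatorConstLp_coeFn (p := 2) (hs := hA.neg) (hμs := hv'.ne) (c := (1 : ℂ))]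
          with x e1 e2 e3
        rw [e1, e2, e3]
        by_cases hx : -x ∈ A <;> simp [hx]
      · simp only
        ext1
        filter_upwards [(Complex.conjCLE : ℂ →L[ℝ] ℂ).coeFn_compLpL ((hM.memLp hA hv).toLp (M A)),
          (hM.memLp hA hv).coeFn_toLp, (hM.memLp hA.neg hv').coeFn_toLp, hM.neg A hA hv]
          with x e1 e2 e3 e4
        rw [e1, e2, e3, e4]
        simp
    | zero =>
      simp only [Prod.fst_zero, Prod.snd_zero, map_zero]
      exact Submodule.zero_mem _
    | add p q _ _ h1 h2 =>
      have := Submodule.add_mem _ h1 h2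
      simpa using this
    | smul c p _ h =>
      have := Submodule.smul_mem _ ((starRingEnd ℂ) c) h
      simpa [reflectConj_smul, conj_compLpL_smul] using this
  have hc : Continuous fun p : FreqL2 N × Lp ℂ 2 P =>
      (reflectConj N p.1, (Complex.conjCLE : ℂ →L[ℝ] ℂ).compLpL 2 P p.2) := by fun_prop
  exact map_mem_closure (s := (Submodule.span ℂ hM.pairs : Set (FreqL2 N × Lp ℂ 2 P)))
    (t := (Submodule.span ℂ hM.pairs : Set (FreqL2 N × Lp ℂ 2 P))) hc hp h1

end IsGaussianRandomMeasure

lemma IsWienerIntegral.mem_graph {f : EuclideanSpace ℝ (Fin N) → ℂ} {Y : Ω → ℂ}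
    (h : IsWienerIntegral P M f Y) (hM : IsGaussianRandomMeasure P M) :
    ∃ (hf : MemLp f 2 volume) (hY : MemLp Y 2 P), (hf.toLp f, hY.toLp Y) ∈ hM.graph := by
  have hf := h.memLp
  obtain ⟨hfm, hYm, φ, hφ, h1, h2⟩ := h
  choose hS hmem using fun n => hM.simpleIntegral_mem_graph (hφ n)
  have hY : MemLp Y 2 P := memLp_of_tendsto_eLpNorm hYm hS h2
  refine ⟨hf, hY, ?_⟩
  have t1 : Tendsto (fun n => (hφ n).toLp (φ n)) atTop (𝓝 (hf.toLp f)) :=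
    (Lp.tendsto_Lp_iff_tendsto_eLpNorm'' (fun n => ⇑(φ n)) hφ f hf).2 h1
  have t2 : Tendsto (fun n => (hS n).toLp (simpleIntegral M (φ n))) atTop (𝓝 (hY.toLp Y)) :=
    (Lp.tendsto_Lp_iff_tendsto_eLpNorm'' (fun n => simpleIntegral M (φ n)) hS Y hY).2 h2
  have t3 := t1.prodMk_nhds t2
  have hc := hM.isClosed_graph
  exact hc.mem_of_tendsto t3
    (Eventually.of_forall fun n => Submodule.le_topologicalClosure _ (hmem n))

/-- A square-integrable Hermitian function: `f(-ξ) = conj f(ξ)`. -/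
structure IsHermitianL2 (f : EuclideanSpace ℝ (Fin N) → ℂ) : Prop where
  memLp : MemLp f 2 volume
  neg : ∀ x, f (-x) = (starRingEnd ℂ) (f x)

/-- `W` is a real centered Gaussian process indexed by functions on `ℝ^N`, which on the Hermitian
functions of `L²(ℝ^N)` has covariance `Re ∫ f conj g`. -/
structure IsIsonormal (P : Measure Ω) (W : (EuclideanSpace ℝ (Fin N) → ℂ) → Ω → ℝ) : Prop where
  isGaussianProcess : IsGaussianProcess W P
  centered : ∀ f, ∫ ω, W f ω ∂P = 0
  covariance : ∀ f g, IsHermitianL2 f → IsHermitianL2 g →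
    ∫ ω, W f ω * W g ω ∂P = ∫ ξ, (f ξ * (starRingEnd ℂ) (g ξ)).re

open IsGaussianRandomMeasure in
/-- The real parts of the Wiener integrals with respect to a Gaussian random measure form an
isonormal process on the Hermitian functions. -/
theorem exists_isIsonormal (hM : IsGaussianRandomMeasure P M) :
    ∃ W : (EuclideanSpace ℝ (Fin N) → ℂ) → Ω → ℝ, IsIsonormal P W ∧
      ∀ f Y, IsWienerIntegral P M f Y → W f =ᵐ[P] fun ω => (Y ω).re := by
  classical
  have := hM.isGaussianProcess.isProbabilityMeasure
  choose I hI using hM.exists_mem_graph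
  let F : (EuclideanSpace ℝ (Fin N) → ℂ) → FreqL2 N := fun f =>
    if h : MemLp f 2 volume then h.toLp f else 0
  have hF : ∀ {f} (h : MemLp f 2 volume), F f = h.toLp f := fun h => dif_pos h
  let R : Lp ℂ 2 P →L[ℝ] Lp ℝ 2 P := Complex.reCLM.compLpL 2 P
  have hRI : ∀ f, R (I (F f)) =ᵐ[P] fun ω => (I (F f) ω).re := fun f =>
    Complex.reCLM.coeFn_compLpL _
  refine ⟨fun f ω => R (I (F f)) ω, ⟨⟨fun s => ⟨?_⟩⟩, fun f => ?_, fun f g hf hg => ?_⟩,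
    fun f Y h => ?_⟩
  · refine isGaussian_of_map_eq_gaussianReal fun L => ?_
    have hm : AEMeasurable (fun ω => s.restrict fun f => R (I (F f)) ω) P :=
      aemeasurable_pi_lambda _ fun f => (Lp.aestronglyMeasurable _).aemeasurable
    let a : s → ℝ := fun f => L fun j => if f = j then 1 else 0
    have hmem : (∑ f : s, ((a f : ℝ) : ℂ) • ((F f, I (F f)) : FreqL2 N × Lp ℂ 2 P))
        ∈ hM.graph := Submodule.sum_mem _ fun f _ => Submodule.smul_mem _ _ (hI _)
    have h := hM.re_isCenteredGaussian hmem
    refine ⟨_, _, Eq.trans ?_ h⟩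
    · rw [AEMeasurable.map_map_of_aemeasurable (by fun_prop) hm]
      refine Measure.map_congr ?_
      have e2 : ∀ᵐ ω ∂P, ∀ f : s, R ((a f : ℝ) • I (F f)) ω =
          a f * R (I (F f)) ω := ae_all_iff.2 fun f => by
        rw [map_smul]
        exact Lp.coeFn_smul _ _
      have e3 : (∑ f : s, ((a f : ℝ) : ℂ) • ((F f, I (F f)) : FreqL2 N × Lp ℂ 2 P)).2
          = ∑ f : s, (a f : ℝ) • I (F f) := by
        rw [Prod.snd_sum]
        refine Finset.sum_congr rfl fun f _ => ?_
        exact Complex.coe_smul _ _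
      rw [e3, map_sum]
      filter_upwards [e2, Lp.coeFn_finsetSum Finset.univ
        (fun f : s => R ((a f : ℝ) • I (F f)))] with ω h2 h4
      refine Eq.trans ?_ h4.symm
      rw [Finset.sum_apply, Finset.sum_congr rfl fun c _ => h2 c, Function.comp_apply]
      refine (LinearMap.pi_apply_eq_sum_univ (L : (s → ℝ) →ₗ[ℝ] ℝ) _).trans ?_
      refine Finset.sum_congr rfl fun f _ => ?_
      rw [smul_eq_mul, mul_comm]
      rfl
  · have h : IsCenteredGaussian P (R (I (F f))) := hM.re_isCenteredGaussian (hI (F f))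
    have h2 : ∫ x, x ∂(P.map (R (I (F f)))) = 0 := by
      rw [h, integral_id_gaussianReal]
    rwa [integral_map (Lp.aestronglyMeasurable _).aemeasurable (by fun_prop)] at h2
  -- the integral of a Hermitian function is real, so the covariance of the real parts is the full
  -- inner product of the integrals
  · have hreal : ∀ f, IsHermitianL2 f → ∀ᵐ ω ∂P, (starRingEnd ℂ) (I (F f) ω) = I (F f) ω := by
      intro f hf
      have h1 : reflectConj N (F f) = F f := by
        ext1
        have hneg := (Measure.measurePreserving_neg
          (volume : Measure (EuclideanSpace ℝ (Fin N)))).quasiMeasurePreserving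
        rw [hF hf.memLp]
        filter_upwards [reflectConj_coeFn (hf.memLp.toLp f), hf.memLp.coeFn_toLp,
          hneg.ae hf.memLp.coeFn_toLp] with x e1 e2 e3
        rw [e1, e3, e2, hf.neg]
        simp
      have h2 := hM.conj_mem_graph (hI (F f))
      simp only [h1] at h2
      have h3 := hM.snd_eq_of_mem_graph h2 (hI (F f))
      have h4 := (Complex.conjCLE : ℂ →L[ℝ] ℂ).coeFn_compLpL (I (F f))
      rw [h3] at h4
      filter_upwards [h4] with ω e
      conv_rhs => rw [e]
      simp
    have h1 := hM.inner_graph (hI (F g)) (hI (F f))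
    simp only at h1
    rw [hF hf.memLp, hF hg.memLp, L2.inner_def, L2.inner_def] at h1
    have h2 : ∫ ω, (((R (I (F f)) ω * R (I (F g)) ω : ℝ)) : ℂ) ∂P =
        ∫ ξ, f ξ * (starRingEnd ℂ) (g ξ) := by
      rw [← hF hf.memLp, ← hF hg.memLp] at h1
      refine Eq.trans ?_ (h1.symm.trans ?_)
      · refine integral_congr_ae ?_
        filter_upwards [hRI f, hRI g, hreal f hf, hreal g hg] with ω e1 e2 e3 e4
        rw [e1, e2, RCLike.inner_apply, e4]
        push_cast
        rw [Complex.conj_eq_iff_re.1 e3, Complex.conj_eq_iff_re.1 e4]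
      · refine integral_congr_ae ?_
        rw [hF hf.memLp, hF hg.memLp]
        filter_upwards [hf.memLp.coeFn_toLp, hg.memLp.coeFn_toLp] with x e1 e2
        rw [e1, e2, RCLike.inner_apply]
    rw [integral_complex_ofReal] at h2
    have h3 : Integrable (fun ξ => f ξ * (starRingEnd ℂ) (g ξ)) volume :=
      hf.memLp.integrable_mul hg.memLp.star
    refine Eq.trans ?_ (Complex.reCLM.integral_comp_comm h3).symm
    rw [← h2]
    rfl
  · obtain ⟨hf, hY, hm⟩ := h.mem_graph hM
    have h1 := hM.snd_eq_of_mem_graph (hI (F f)) (by rw [hF hf]; exact hm)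
    filter_upwards [hRI f, hY.coeFn_toLp] with ω e1 e2
    rw [e1, h1, e2]

end WienerGraph

/-! ### The operators `c ^ E` -/

section MatrixPowers

/-- Jacobi's formula at the identity. -/
lemma hasDerivAt_det_of_eq_one {n : ℕ} {M : ℝ → Matrix (Fin n) (Fin n) ℝ}
    {A : Matrix (Fin n) (Fin n) ℝ} {u : ℝ} (h1 : M u = 1)
    (hM : ∀ i j, HasDerivAt (fun v => M v i j) (A i j) u) :
    HasDerivAt (fun v => (M v).det) A.trace u := by
  simp_rw [Matrix.det_apply']
  have h := HasDerivAt.fun_sum (u := Finset.univ) (x := u)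
    (A := fun (σ : Equiv.Perm (Fin n)) v =>
      ((Equiv.Perm.sign σ : ℤ) : ℝ) * ∏ i, M v (σ i) i)
    (A' := fun σ => ((Equiv.Perm.sign σ : ℤ) : ℝ) *
      ∑ i, (∏ j ∈ Finset.univ.erase i, M u (σ j) j) • A (σ i) i)
    (fun σ _ => (HasDerivAt.fun_finsetProd fun i _ => hM (σ i) i).const_mul _)
  refine h.congr_deriv (Eq.symm ?_)
  rw [Finset.sum_eq_single (1 : Equiv.Perm (Fin n))]
  · simp [h1, Matrix.trace]
  · intro σ _ hσ
    rw [Finset.sum_eq_zero, mul_zero]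
    intro i _
    -- a permutation that fixes every `j ≠ i` is the identity
    obtain ⟨j, hji, hj⟩ : ∃ j, j ≠ i ∧ σ j ≠ j := by
      by_contra! hcon
      refine hσ (Equiv.ext fun k => ?_)
      by_cases hk : k = i
      · subst hk
        by_contra hne
        have h2 := hcon (σ k) hne
        exact hne (σ.injective h2)
      · exact hcon k hk
    rw [Finset.prod_eq_zero (i := j) (by simp [hji])]
    · simp
    · rw [h1, Matrix.one_apply_ne hj]
  · simp

open scoped Matrix.Norms.L2Operator in
/-- The determinant of `exp A` is `exp (tr A)`. -/
lemma det_exp {n : ℕ} (A : Matrix (Fin n) (Fin n) ℝ) :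
    (NormedSpace.exp A).det = Real.exp A.trace := by
  let g : ℝ → ℝ := fun u => (NormedSpace.exp (u • A)).det
  have hentry : ∀ i j, HasDerivAt (fun v : ℝ => NormedSpace.exp (v • A) i j) (A i j) 0 := by
    intro i j
    have h := hasDerivAt_exp_smul_const (𝕂 := ℝ) A 0
    rw [zero_smul, NormedSpace.exp_zero, one_mul] at h
    let L : Matrix (Fin n) (Fin n) ℝ →L[ℝ] ℝ :=
      LinearMap.toContinuousLinearMap (Matrix.entryLinearMap ℝ ℝ i j)
    exact L.hasFDerivAt.comp_hasDerivAt 0 h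
  have h0 : HasDerivAt g A.trace 0 :=
    hasDerivAt_det_of_eq_one (by simp) hentry
  have hadd : ∀ u v, g (u + v) = g u * g v := by
    intro u v
    simp only [g]
    rw [add_smul, Matrix.exp_add_of_commute _ _ ((Commute.refl A).smul_left u |>.smul_right v),
      Matrix.det_mul]
  have hg : ∀ u, HasDerivAt g (g u * A.trace) u := by
    intro u
    have h1 : HasDerivAt (fun v => g u * g (v - u)) (g u * A.trace) u := by
      refine HasDerivAt.const_mul _ ?_
      have := HasDerivAt.comp_sub_const (f := g) (f' := A.trace) u u (by simpa using h0)
      exact this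
    refine h1.congr_of_eventuallyEq (Eventually.of_forall fun v => ?_)
    simp only
    rw [← hadd, add_sub_cancel]
  have hconst : ∀ u, g u * Real.exp (-(u * A.trace)) = 1 := by
    have hd : ∀ u, HasDerivAt (fun u => g u * Real.exp (-(u * A.trace))) 0 u := by
      intro u
      have h2 : HasDerivAt (fun u => Real.exp (-(u * A.trace)))
          (Real.exp (-(u * A.trace)) * (-(1 * A.trace))) u :=
        (((hasDerivAt_id u).mul_const A.trace).neg).exp
      refine ((hg u).mul h2).congr_deriv ?_
      ring
    intro u
    have := is_const_of_deriv_eq_zero (fun u => (hd u).differentiableAt)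
      (fun u => (hd u).deriv) u 0
    simpa [g] using this
  have h1 := hconst 1
  rw [one_mul, Real.exp_neg] at h1
  have h2 : g 1 = Real.exp A.trace := by
    field_simp at h1
    exact h1
  simpa [g] using h2

variable {N : ℕ} (E : Matrix (Fin N) (Fin N) ℝ)

@[simp] lemma opPow_one (x : EuclideanSpace ℝ (Fin N)) : opPow E 1 x = x := by
  simp [opPow]

lemma opPow_mul {a b : ℝ} (ha : 0 < a) (hb : 0 < b) (x : EuclideanSpace ℝ (Fin N)) :
    opPow E (a * b) x = opPow E a (opPow E b x) := by
  rw [opPow, Real.log_mul ha.ne' hb.ne', add_smul, Matrix.exp_add_of_commute _ _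
    ((Commute.refl E).smul_left _ |>.smul_right _)]
  simp [opPow, Matrix.toLpLin_apply, Matrix.mulVec_mulVec]

lemma opPow_inv_opPow {c : ℝ} (hc : 0 < c) (x : EuclideanSpace ℝ (Fin N)) :
    opPow E c⁻¹ (opPow E c x) = x := by
  rw [← opPow_mul E (inv_pos.2 hc) hc, inv_mul_cancel₀ hc.ne', opPow_one]

lemma opPow_opPow_inv {c : ℝ} (hc : 0 < c) (x : EuclideanSpace ℝ (Fin N)) :
    opPow E c (opPow E c⁻¹ x) = x := by
  rw [← opPow_mul E hc (inv_pos.2 hc), mul_inv_cancel₀ hc.ne', opPow_one]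

lemma opPow_ne_zero {c : ℝ} (hc : 0 < c) {x : EuclideanSpace ℝ (Fin N)} (hx : x ≠ 0) :
    opPow E c x ≠ 0 := by
  intro h
  have := opPow_inv_opPow E hc x
  rw [h, map_zero] at this
  exact hx this.symm

lemma continuous_opPow (c : ℝ) : Continuous (opPow E c) :=
  LinearMap.continuous_of_finiteDimensional _

lemma inner_opPow (c : ℝ) (x y : EuclideanSpace ℝ (Fin N)) :
    inner ℝ (opPow E c x) y = inner ℝ x (opPow E.transpose c y) := by
  have h : opPow E.transpose c = LinearMap.adjoint (opPow E c) := by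
    rw [opPow, opPow, ← Matrix.toEuclideanLin_conjTranspose_eq_adjoint, ← Matrix.transpose_smul,
      Matrix.exp_transpose, Matrix.conjTranspose_eq_transpose_of_trivial]
  rw [h, LinearMap.adjoint_inner_right]

lemma det_opPow {c : ℝ} (hc : 0 < c) : LinearMap.det (opPow E c) = c ^ E.trace := by
  rw [opPow, Matrix.toEuclideanLin, Matrix.toLpLin_eq_toLin, LinearMap.det_toLin, det_exp,
    Matrix.trace_smul, smul_eq_mul, Real.rpow_def_of_pos hc]

open scoped Matrix.Norms.L2Operator in
/-- The operators `c ^ E` with `c ≥ 1` have at most polynomial growth in `c`. -/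
lemma exists_norm_opPow_le : ∃ K : ℝ, 1 ≤ K ∧ ∀ c : ℝ, 1 ≤ c → ∀ x : EuclideanSpace ℝ (Fin N),
    ‖opPow E c x‖ ≤ c ^ K * ‖x‖ := by
  refine ⟨1 + ‖Matrix.toEuclideanCLM (n := Fin N) (𝕜 := ℝ) E‖, by simp, fun c hc x => ?_⟩
  set A := Matrix.toEuclideanCLM (n := Fin N) (𝕜 := ℝ) E with hA
  have hexp : Matrix.toEuclideanCLM (n := Fin N) (𝕜 := ℝ) (NormedSpace.exp (Real.log c • E)) =
      NormedSpace.exp (Real.log c • A) := by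
    have hcont : Continuous (Matrix.toEuclideanCLM (n := Fin N) (𝕜 := ℝ)) :=
      LinearMap.continuous_of_finiteDimensional
        ((Matrix.toEuclideanCLM (n := Fin N) (𝕜 := ℝ)).toAlgEquiv.toLinearMap)
    rw [← map_smul]
    exact NormedSpace.map_exp_of_mem_ball (𝕂 := ℝ) (𝔸 := Matrix (Fin N) (Fin N) ℝ) _ hcont
      (Real.log c • E) ((NormedSpace.expSeries_radius_eq_top ℝ
        (Matrix (Fin N) (Fin N) ℝ)).symm ▸ edist_lt_top _ _)
  have h1 : opPow E c x = NormedSpace.exp (Real.log c • A) x := by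
    rw [← hexp]
    rfl
  have hlog : 0 ≤ Real.log c := Real.log_nonneg hc
  have hnorm : ‖NormedSpace.exp (Real.log c • A)‖ ≤ Real.exp (Real.log c * (1 + ‖A‖)) := by
    have hs := NormedSpace.norm_expSeries_summable' (𝕂 := ℝ) (Real.log c • A)
    have hb : ∀ n : ℕ, ‖(n.factorial⁻¹ : ℝ) • (Real.log c • A) ^ n‖ ≤
        (n.factorial⁻¹ : ℝ) • (Real.log c * (1 + ‖A‖)) ^ n := by
      intro n
      rw [norm_smul, smul_eq_mul, norm_inv, Real.norm_natCast]
      refine mul_le_mul_of_nonneg_left ?_ (by positivity)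
      rcases Nat.eq_zero_or_pos n with rfl | hn
      · simp only [pow_zero]
        exact ContinuousLinearMap.norm_id_le
      refine (norm_pow_le' _ hn).trans (pow_le_pow_left₀ (norm_nonneg _) ?_ _)
      rw [norm_smul, Real.norm_of_nonneg hlog]
      exact mul_le_mul_of_nonneg_left (by linarith) hlog
    have hs2 := NormedSpace.expSeries_summable' (𝕂 := ℝ) (𝔸 := ℝ) (Real.log c * (1 + ‖A‖))
    rw [Real.exp_eq_exp_ℝ, NormedSpace.exp_eq_tsum ℝ, NormedSpace.exp_eq_tsum ℝ]
    exact (norm_tsum_le_tsum_norm hs).trans (hs.tsum_le_tsum hb hs2)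
  rw [h1]
  refine (ContinuousLinearMap.le_opNorm _ _).trans ?_
  refine mul_le_mul_of_nonneg_right (hnorm.trans_eq ?_) (norm_nonneg _)
  rw [Real.rpow_def_of_pos (by linarith)]

/-- The operator `c ^ E` multiplies Lebesgue measure by `c ^ tr E`. -/
lemma map_opPow_volume {c : ℝ} (hc : 0 < c) :
    Measure.map (opPow E c) volume = ENNReal.ofReal (c ^ (-E.trace)) • volume := by
  have hdet := det_opPow E hc
  have hpos : 0 < c ^ E.trace := Real.rpow_pos_of_pos hc _
  rw [Measure.map_linearMap_addHaar_eq_smul_addHaar volume (by rw [hdet]; exact hpos.ne'), hdet,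
    abs_of_pos (inv_pos.2 hpos), Real.rpow_neg hc.le]

end MatrixPowers

/-! ### The standard deviation of the field -/

section FieldStd

variable {N : ℕ} {E : Matrix (Fin N) (Fin N) ℝ} {ψ : EuclideanSpace ℝ (Fin N) → ℝ}

/-- The character `ξ ↦ e^{i⟨t, ξ⟩}`. -/
noncomputable def character (t ξ : EuclideanSpace ℝ (Fin N)) : ℂ :=
  Complex.exp (Complex.I * ((inner ℝ t ξ : ℝ) : ℂ))

lemma norm_character (t ξ : EuclideanSpace ℝ (Fin N)) : ‖character t ξ‖ = 1 := by
  rw [character, mul_comm, Complex.norm_exp_ofReal_mul_I]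

lemma character_add (s t ξ : EuclideanSpace ℝ (Fin N)) :
    character (s + t) ξ = character s ξ * character t ξ := by
  rw [character, character, character, ← Complex.exp_add, inner_add_left]
  congr 1
  push_cast
  ring

lemma character_neg_right (t ξ : EuclideanSpace ℝ (Fin N)) :
    character t (-ξ) = (starRingEnd ℂ) (character t ξ) := by
  rw [character, character, ← Complex.exp_conj, inner_neg_right]
  simp

lemma continuous_character_right (t : EuclideanSpace ℝ (Fin N)) :
    Continuous (character t) := by
  unfold character
  fun_prop

lemma continuous_character_left (ξ : EuclideanSpace ℝ (Fin N)) :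
    Continuous fun t => character t ξ := by
  unfold character
  fun_prop

lemma kernel_eq (t ξ : EuclideanSpace ℝ (Fin N)) :
    harmonizableKernel E ψ t ξ =
      (character t ξ - 1) / ((ψ ξ ^ (1 + E.trace / 2) : ℝ) : ℂ) := rfl

lemma kernel_add (s t ξ : EuclideanSpace ℝ (Fin N)) :
    harmonizableKernel E ψ (s + t) ξ =
      character t ξ * harmonizableKernel E ψ s ξ + harmonizableKernel E ψ t ξ := by
  rw [kernel_eq, kernel_eq, kernel_eq, character_add]
  ring

/-- The kernel of an increment `X s - X t` is the kernel of `X (s - t)` up to a unimodular factor,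
so that the increments are stationary. -/
lemma kernel_sub_kernel (s t ξ : EuclideanSpace ℝ (Fin N)) :
    harmonizableKernel E ψ s ξ - harmonizableKernel E ψ t ξ =
      character t ξ * harmonizableKernel E ψ (s - t) ξ := by
  have h := kernel_add (E := E) (ψ := ψ) (s - t) t ξ
  rw [sub_add_cancel] at h
  rw [h, add_sub_cancel_right]

lemma kernel_zero (ξ : EuclideanSpace ℝ (Fin N)) : harmonizableKernel E ψ 0 ξ = 0 := by
  simp [harmonizableKernel]

lemma kernel_neg_right (hψ : ∀ x, ψ (-x) = ψ x) (t ξ : EuclideanSpace ℝ (Fin N)) :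
    harmonizableKernel E ψ t (-ξ) = (starRingEnd ℂ) (harmonizableKernel E ψ t ξ) := by
  rw [kernel_eq, kernel_eq, character_neg_right, hψ, map_div₀, Complex.conj_ofReal]
  simp

lemma aestronglyMeasurable_kernel (hψ : Continuous ψ) (t : EuclideanSpace ℝ (Fin N)) :
    AEStronglyMeasurable (harmonizableKernel E ψ t) volume := by
  have h1 : Measurable (character t) := (continuous_character_right t).measurable
  have h2 : Measurable ψ := hψ.measurable
  have : Measurable (harmonizableKernel E ψ t) :=
    (h1.sub_const 1).div (Complex.measurable_ofReal.comp (h2.pow_const _))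
  exact this.aestronglyMeasurable

/-- The kernel is homogeneous: dilating `t` amounts to dilating the frequency. -/
lemma kernel_opPow (hψ : IsSymmHomogeneous E.transpose ψ) {c : ℝ} (hc : 0 < c)
    (t ξ : EuclideanSpace ℝ (Fin N)) :
    harmonizableKernel E ψ (opPow E c t) ξ =
      ((c ^ (1 + E.trace / 2) : ℝ) : ℂ) *
        harmonizableKernel E ψ t (opPow E.transpose c ξ) := by
  have hch : character (opPow E c t) ξ = character t (opPow E.transpose c ξ) := by
    rw [character, character, inner_opPow]
  rcases eq_or_ne ξ 0 with rfl | hξ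
  · simp [harmonizableKernel]
  rw [kernel_eq, kernel_eq, hch, hψ.homogeneous c hc ξ hξ, Real.mul_rpow hc.le (hψ.nonneg ξ)]
  have h1 : ((c ^ (1 + E.trace / 2) : ℝ) : ℂ) ≠ 0 := by
    exact_mod_cast (Real.rpow_pos_of_pos hc _).ne'
  have h2 : ((ψ ξ ^ (1 + E.trace / 2) : ℝ) : ℂ) ≠ 0 := by
    exact_mod_cast (Real.rpow_pos_of_pos (hψ.pos ξ hξ) _).ne'
  rw [Complex.ofReal_mul, mul_div_assoc', mul_div_mul_left _ _ h1]

/-- The standard deviation of `X(t)`: the `L²` norm of the kernel. -/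
noncomputable def fieldStd (E : Matrix (Fin N) (Fin N) ℝ) (ψ : EuclideanSpace ℝ (Fin N) → ℝ)
    (t : EuclideanSpace ℝ (Fin N)) : ℝ :=
  (eLpNorm (harmonizableKernel E ψ t) 2 volume).toReal

lemma fieldStd_nonneg (t : EuclideanSpace ℝ (Fin N)) : 0 ≤ fieldStd E ψ t :=
  ENNReal.toReal_nonneg

lemma fieldStd_zero : fieldStd E ψ 0 = 0 := by
  have : harmonizableKernel E ψ 0 = 0 := funext kernel_zero
  simp [fieldStd, this]

lemma eLpNorm_two_toReal_sq {f : EuclideanSpace ℝ (Fin N) → ℂ} (hf : MemLp f 2 volume) :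
    (eLpNorm f 2 volume).toReal ^ 2 = ∫ ξ, ‖f ξ‖ ^ 2 := by
  rw [hf.eLpNorm_eq_integral_rpow_norm two_ne_zero (by simp), ENNReal.toReal_ofReal (by positivity)]
  have h0 : 0 ≤ ∫ ξ, ‖f ξ‖ ^ (2 : ℝ) := integral_nonneg fun _ => by positivity
  simp only [ENNReal.toReal_ofNat]
  rw [← Real.rpow_natCast, ← Real.rpow_mul h0]
  norm_num

lemma fieldStd_sq {t : EuclideanSpace ℝ (Fin N)} (hk : MemLp (harmonizableKernel E ψ t) 2 volume) :
    fieldStd E ψ t ^ 2 = ∫ ξ, ‖harmonizableKernel E ψ t ξ‖ ^ 2 :=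
  eLpNorm_two_toReal_sq hk

lemma eLpNorm_character_mul_kernel (s t : EuclideanSpace ℝ (Fin N)) :
    eLpNorm (fun ξ => character t ξ * harmonizableKernel E ψ s ξ) 2 volume =
      eLpNorm (harmonizableKernel E ψ s) 2 volume :=
  eLpNorm_congr_norm_ae (ae_of_all _ fun ξ => by rw [norm_mul, norm_character, one_mul])

lemma fieldStd_neg (t : EuclideanSpace ℝ (Fin N)) : fieldStd E ψ (-t) = fieldStd E ψ t := by
  unfold fieldStd
  congr 1
  rw [← eLpNorm_character_mul_kernel (-t) t]
  refine eLpNorm_congr_norm_ae (ae_of_all _ fun ξ => ?_)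
  have h := kernel_add (E := E) (ψ := ψ) (-t) t ξ
  rw [neg_add_cancel, kernel_zero] at h
  rw [← norm_neg (harmonizableKernel E ψ t ξ), ← eq_neg_of_add_eq_zero_left h.symm]

lemma fieldStd_add_le (hk : ∀ t, MemLp (harmonizableKernel E ψ t) 2 volume)
    (s t : EuclideanSpace ℝ (Fin N)) :
    fieldStd E ψ (s + t) ≤ fieldStd E ψ s + fieldStd E ψ t := by
  unfold fieldStd
  rw [← ENNReal.toReal_add (hk s).2.ne (hk t).2.ne]
  refine ENNReal.toReal_mono (ENNReal.add_ne_top.2 ⟨(hk s).2.ne, (hk t).2.ne⟩) ?_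
  have h : harmonizableKernel E ψ (s + t) =
      (fun ξ => character t ξ * harmonizableKernel E ψ s ξ) + harmonizableKernel E ψ t :=
    funext fun ξ => kernel_add s t ξ
  rw [h]
  refine (eLpNorm_add_le ?_ (hk t).1 one_le_two).trans_eq ?_
  · exact (continuous_character_right t).aestronglyMeasurable.mul (hk s).1
  · rw [eLpNorm_character_mul_kernel]

/-- The weight `c ^ (1 + Q / 2)` in the scaling relation of the kernels turns the change of
variables `ξ ↦ c ^ E' ξ` into multiplication of the `L²` norm by `c`. -/
lemma eLpNorm_const_mul_comp_opPow {g : EuclideanSpace ℝ (Fin N) → ℂ}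
    (hg : AEStronglyMeasurable g volume) {c : ℝ} (hc : 0 < c) :
    (eLpNorm (fun ξ => ((c ^ (1 + E.trace / 2) : ℝ) : ℂ) * g (opPow E.transpose c ξ)) 2
      volume).toReal = c * (eLpNorm g 2 volume).toReal := by
  have h : (fun ξ => ((c ^ (1 + E.trace / 2) : ℝ) : ℂ) * g (opPow E.transpose c ξ)) =
      ((c ^ (1 + E.trace / 2) : ℝ) : ℂ) • (g ∘ opPow E.transpose c) := rfl
  have hm := map_opPow_volume E.transpose hc
  have hfin : ENNReal.ofReal (c ^ (-E.transpose.trace)) ≠ 0 := by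
    simpa using Real.rpow_pos_of_pos hc _
  have hmeas : AEStronglyMeasurable g (Measure.map (opPow E.transpose c) volume) := by
    rw [hm]
    exact hg.smul_measure _
  have hcomp : eLpNorm (g ∘ opPow E.transpose c) 2 volume =
      ENNReal.ofReal (c ^ (-E.trace / 2)) * eLpNorm g 2 volume := by
    rw [← eLpNorm_map_measure hmeas (continuous_opPow _ c).measurable.aemeasurable, hm,
      eLpNorm_smul_measure_of_ne_zero hfin, smul_eq_mul, Matrix.trace_transpose,
      ENNReal.ofReal_rpow_of_pos (Real.rpow_pos_of_pos hc _), ← Real.rpow_mul hc.le]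
    congr 3
    simp
    ring
  rw [h, eLpNorm_const_smul, hcomp, ENNReal.toReal_mul, ENNReal.toReal_mul,
    ENNReal.toReal_ofReal (by positivity), ← mul_assoc]
  congr 1
  have h2 : ‖((c ^ (1 + E.trace / 2) : ℝ) : ℂ)‖ₑ.toReal = c ^ (1 + E.trace / 2) := by
    rw [toReal_enorm, Complex.norm_real, Real.norm_of_nonneg (by positivity)]
  rw [h2, ← Real.rpow_add hc]
  ring_nf
  simp

lemma fieldStd_opPow (hψ : IsSymmHomogeneous E.transpose ψ) {c : ℝ} (hc : 0 < c)
    (t : EuclideanSpace ℝ (Fin N)) :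
    fieldStd E ψ (opPow E c t) = c * fieldStd E ψ t := by
  unfold fieldStd
  rw [← eLpNorm_const_mul_comp_opPow (aestronglyMeasurable_kernel hψ.continuous t) hc]
  congr 2
  exact funext fun ξ => kernel_opPow hψ hc t ξ

lemma fieldStd_pos (hψ : IsSymmHomogeneous E.transpose ψ)
    {t : EuclideanSpace ℝ (Fin N)} (hk : MemLp (harmonizableKernel E ψ t) 2 volume)
    (ht : t ≠ 0) : 0 < fieldStd E ψ t := by
  refine (fieldStd_nonneg t).lt_of_ne fun h0 => ?_
  have h1 : eLpNorm (harmonizableKernel E ψ t) 2 volume = 0 := by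
    rcases (ENNReal.toReal_eq_zero_iff _).1 h0.symm with h | h
    · exact h
    · exact absurd h hk.2.ne
  rw [eLpNorm_eq_zero_iff hk.1 two_ne_zero] at h1
  have h2 : character t =ᵐ[volume] fun _ => 1 := by
    filter_upwards [h1] with ξ hξ
    rcases eq_or_ne ξ 0 with rfl | hξ0
    · simp [character]
    rw [kernel_eq, Pi.zero_apply, div_eq_zero_iff] at hξ
    rcases hξ with h | h
    · exact sub_eq_zero.1 h
    · exact absurd (by exact_mod_cast h) (Real.rpow_pos_of_pos (hψ.pos ξ hξ0) _).ne'
  have h3 := (Continuous.ae_eq_iff_eq volume (continuous_character_right t)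
    continuous_const).1 h2
  have h4 := congrFun h3 ((Real.pi / ‖t‖ ^ 2) • t)
  have h5 : inner ℝ t ((Real.pi / ‖t‖ ^ 2) • t) = Real.pi := by
    rw [inner_smul_right, real_inner_self_eq_norm_sq]
    field_simp
  rw [character, h5, mul_comm, Complex.exp_pi_mul_I] at h4
  norm_num at h4

lemma isClosed_fieldStd_le (hk : ∀ t, MemLp (harmonizableKernel E ψ t) 2 volume) {a : ℝ}
    (ha : 0 ≤ a) :
    IsClosed {t | fieldStd E ψ t ≤ a} := by
  have hiff : ∀ t, fieldStd E ψ t ≤ a ↔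
      eLpNorm (harmonizableKernel E ψ t) 2 volume ≤ ENNReal.ofReal a := fun t => by
    rw [fieldStd, ENNReal.le_ofReal_iff_toReal_le (hk t).2.ne ha]
  simp_rw [hiff]
  refine IsSeqClosed.isClosed fun u t hu hlim => ?_
  have h1 := Lp.eLpNorm_lim_le_liminf_eLpNorm (p := 2)
    (fun n => (hk (u n)).1) (harmonizableKernel E ψ t) (ae_of_all _ fun ξ => by
      have h2 : Tendsto (fun n => character (u n) ξ) atTop (𝓝 (character t ξ)) :=
        ((continuous_character_left ξ).tendsto t).comp hlim
      simp_rw [kernel_eq]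
      exact (h2.sub_const 1).div_const _)
  refine h1.trans ?_
  refine (liminf_le_liminf (Eventually.of_forall hu)).trans_eq ?_
  simp

/-- `fieldStd` is bounded near the origin, by Baire's theorem. -/
lemma exists_fieldStd_le_near_zero
    (hk : ∀ t, MemLp (harmonizableKernel E ψ t) 2 volume) :
    ∃ δ > 0, ∃ B > 0, ∀ t : EuclideanSpace ℝ (Fin N), ‖t‖ ≤ δ → fieldStd E ψ t ≤ B := by
  obtain ⟨n, x, hx⟩ := nonempty_interior_of_iUnion_of_closed
    (f := fun n : ℕ => {t | fieldStd E ψ t ≤ n})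
    (fun n => isClosed_fieldStd_le hk n.cast_nonneg)
    (Set.eq_univ_of_forall fun t => Set.mem_iUnion.2 (exists_nat_ge (fieldStd E ψ t)))
  obtain ⟨ε, hε, hball⟩ := Metric.isOpen_iff.1 isOpen_interior x hx
  refine ⟨ε / 2, by positivity, n + fieldStd E ψ x + 1, ?_, fun t ht => ?_⟩
  · have := fieldStd_nonneg (E := E) (ψ := ψ) x
    positivity
  have h1 : fieldStd E ψ (t + x) ≤ n := by
    have : t + x ∈ Metric.ball x ε := by
      rw [Metric.mem_ball, dist_eq_norm, add_sub_cancel_right]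
      linarith
    have h : t + x ∈ {t | fieldStd E ψ t ≤ n} := interior_subset (hball this)
    exact h
  have h2 := fieldStd_add_le hk (t + x) (-x)
  rw [add_neg_cancel_right, fieldStd_neg] at h2
  linarith

lemma fieldStd_nsmul_le
    (hk : ∀ t, MemLp (harmonizableKernel E ψ t) 2 volume) (n : ℕ)
    (t : EuclideanSpace ℝ (Fin N)) : fieldStd E ψ ((n : ℝ) • t) ≤ n * fieldStd E ψ t := by
  induction n with
  | zero => simp [fieldStd_zero]
  | succ n ih =>
    have := fieldStd_add_le hk ((n : ℝ) • t) t
    push_cast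
    rw [add_smul, one_smul]
    linarith

/-- `fieldStd` is locally Hölder: since `‖c ^ E t‖ ≤ c ^ K ‖t‖` for `c ≥ 1`, a point `t` can be
dilated by a factor of order `‖t‖ ^ {-1/K}` while staying in a neighbourhood of the origin on which
`fieldStd` is bounded. -/
lemma exists_fieldStd_le_rpow (hψ : IsSymmHomogeneous E.transpose ψ)
    (hk : ∀ t, MemLp (harmonizableKernel E ψ t) 2 volume) :
    ∃ κ : ℝ, 0 < κ ∧ ∀ R : ℝ, ∃ A > 0, ∀ t : EuclideanSpace ℝ (Fin N), ‖t‖ ≤ R →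
      fieldStd E ψ t ≤ A * ‖t‖ ^ κ := by
  obtain ⟨K, hK, hKb⟩ := exists_norm_opPow_le E
  obtain ⟨δ, hδ, B, hB, hb⟩ := exists_fieldStd_le_near_zero hk
  have hK0 : 0 < K := by linarith
  have hsmall : ∀ t : EuclideanSpace ℝ (Fin N), ‖t‖ ≤ δ →
      fieldStd E ψ t ≤ B * (‖t‖ / δ) ^ (1 / K) := by
    intro t ht
    rcases eq_or_ne t 0 with rfl | ht0
    · rw [fieldStd_zero]
      positivity
    have hq : 0 < ‖t‖ / δ := div_pos (norm_pos_iff.2 ht0) hδ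
    set c := (‖t‖ / δ) ^ (1 / K) with hc
    have hc0 : 0 < c := Real.rpow_pos_of_pos hq _
    have hc1 : c ≤ 1 := Real.rpow_le_one hq.le ((div_le_one hδ).2 ht) (by positivity)
    have hcK : c ^ K = ‖t‖ / δ := by
      rw [hc, ← Real.rpow_mul hq.le, one_div_mul_cancel hK0.ne', Real.rpow_one]
    have h1 : ‖opPow E c⁻¹ t‖ ≤ δ := by
      refine (hKb c⁻¹ ((one_le_inv₀ hc0).2 hc1) t).trans_eq ?_
      rw [Real.inv_rpow hc0.le, hcK]
      have := norm_pos_iff.2 ht0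
      field_simp
    have h2 := fieldStd_opPow hψ hc0 (opPow E c⁻¹ t)
    rw [opPow_opPow_inv E hc0] at h2
    rw [h2, mul_comm B]
    exact mul_le_mul_of_nonneg_left (hb _ h1) hc0.le
  refine ⟨1 / K, by positivity, fun R => ?_⟩
  obtain ⟨n, hn⟩ := exists_nat_ge (max (R / δ) 1)
  have hn1 : (1 : ℝ) ≤ n := (le_max_right _ _).trans hn
  have hn0 : (0 : ℝ) < n := by linarith
  have hnR : R ≤ n * δ := (div_le_iff₀ hδ).1 ((le_max_left _ _).trans hn)
  refine ⟨n * (B * (1 / δ) ^ (1 / K)), by positivity, fun t ht => ?_⟩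
  have h1 : ‖((n : ℝ)⁻¹) • t‖ ≤ δ := by
    rw [norm_smul, norm_inv, Real.norm_natCast, inv_mul_le_iff₀ hn0]
    linarith
  have h2 := fieldStd_nsmul_le hk n ((n : ℝ)⁻¹ • t)
  rw [smul_inv_smul₀ hn0.ne'] at h2
  refine h2.trans ?_
  rw [mul_assoc]
  refine mul_le_mul_of_nonneg_left ((hsmall _ h1).trans ?_) hn0.le
  rw [mul_assoc, ← Real.mul_rpow (by positivity) (norm_nonneg _)]
  refine mul_le_mul_of_nonneg_left (Real.rpow_le_rpow (by positivity) ?_ (by positivity)) hB.le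
  rw [norm_smul, norm_inv, Real.norm_natCast, one_div, div_eq_inv_mul]
  refine mul_le_mul_of_nonneg_left ?_ (by positivity)
  exact mul_le_of_le_one_left (norm_nonneg _) (inv_le_one_of_one_le₀ hn1)

lemma continuous_fieldStd (hψ : IsSymmHomogeneous E.transpose ψ)
    (hk : ∀ t, MemLp (harmonizableKernel E ψ t) 2 volume) : Continuous (fieldStd E ψ) := by
  obtain ⟨κ, hκ, h⟩ := exists_fieldStd_le_rpow hψ hk
  obtain ⟨A, hA, hb⟩ := h 1
  rw [continuous_iff_continuousAt]
  intro x
  have hsub : ∀ y, |fieldStd E ψ y - fieldStd E ψ x| ≤ fieldStd E ψ (y - x) := by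
    intro y
    have h1 := fieldStd_add_le hk (y - x) x
    have h2 := fieldStd_add_le hk (-(y - x)) y
    rw [sub_add_cancel] at h1
    rw [fieldStd_neg, neg_sub, sub_add_cancel] at h2
    rw [abs_le]
    constructor <;> linarith
  rw [ContinuousAt, tendsto_iff_norm_sub_tendsto_zero]
  have hlim : Tendsto (fun y => A * ‖y - x‖ ^ κ) (𝓝 x) (𝓝 0) := by
    have h3 : Continuous fun y : EuclideanSpace ℝ (Fin N) => A * ‖y - x‖ ^ κ :=
      continuous_const.mul (Continuous.rpow_const (by fun_prop) fun _ => Or.inr hκ.le)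
    have h4 := h3.tendsto x
    simpa [Real.zero_rpow hκ.ne'] using h4
  refine squeeze_zero' (Eventually.of_forall fun _ => norm_nonneg _) ?_ hlim
  filter_upwards [Metric.ball_mem_nhds x one_pos] with y hy
  rw [Metric.mem_ball, dist_eq_norm] at hy
  exact (hsub y).trans (hb _ hy.le)

/-- By the Riemann–Lebesgue lemma `fieldStd` is bounded away from zero at infinity. -/
lemma exists_le_fieldStd_far (hN : 0 < N) (hψ : IsSymmHomogeneous E.transpose ψ)
    (hk : ∀ t, MemLp (harmonizableKernel E ψ t) 2 volume) :
    ∃ m > 0, ∃ R > 0, ∀ t : EuclideanSpace ℝ (Fin N), R ≤ ‖t‖ → m ≤ fieldStd E ψ t := by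
  have : Nonempty (Fin N) := ⟨⟨0, hN⟩⟩
  set S : Set (EuclideanSpace ℝ (Fin N)) := Metric.closedBall 0 2 \ Metric.ball 0 1 with hS
  have hScomp : IsCompact S := (isCompact_closedBall 0 2).diff Metric.isOpen_ball
  have hSm : MeasurableSet S := hScomp.measurableSet
  have hS0 : ∀ ξ ∈ S, ξ ≠ 0 := by
    rintro ξ hξ rfl
    exact hξ.2 (by simp)
  set w : EuclideanSpace ℝ (Fin N) → ℝ := fun ξ => (ψ ξ ^ (1 + E.trace / 2))⁻¹ ^ 2 with hw
  have hwpos : ∀ ξ ∈ S, 0 < w ξ := fun ξ hξ =>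
    pow_pos (inv_pos.2 (Real.rpow_pos_of_pos (hψ.pos ξ (hS0 ξ hξ)) _)) 2
  have hwc : ContinuousOn w S := by
    refine ((hψ.continuous.continuousOn.rpow_const fun ξ hξ =>
      Or.inl (hψ.pos ξ (hS0 ξ hξ)).ne').inv₀ fun ξ hξ => ?_).pow 2
    exact (Real.rpow_pos_of_pos (hψ.pos ξ (hS0 ξ hξ)) _).ne'
  have hwi : IntegrableOn w S volume := hwc.integrableOn_compact hScomp
  have hSpos : 0 < volume S := by
    have hsub : Metric.ball (EuclideanSpace.single ⟨0, hN⟩ (3 / 2 : ℝ)) (1 / 2) ⊆ S := by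
      intro x hx
      rw [Metric.mem_ball, dist_eq_norm] at hx
      have h1 : ‖(EuclideanSpace.single (⟨0, hN⟩ : Fin N) (3 / 2 : ℝ))‖ = 3 / 2 := by
        simp
      have h2 := norm_sub_norm_le x (EuclideanSpace.single (⟨0, hN⟩ : Fin N) (3 / 2 : ℝ))
      have h3 := norm_sub_norm_le (EuclideanSpace.single (⟨0, hN⟩ : Fin N) (3 / 2 : ℝ)) x
      rw [norm_sub_rev] at h3
      rw [hS, Set.mem_sdiff, mem_closedBall_zero_iff, mem_ball_zero_iff, not_lt]
      constructor <;> linarith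
    exact (Metric.measure_ball_pos volume _ (by norm_num)).trans_le (measure_mono hsub)
  set I := ∫ ξ in S, w ξ with hI
  have hIpos : 0 < I := by
    rw [hI, setIntegral_pos_iff_support_of_nonneg_ae
      ((ae_restrict_iff' hSm).2 (ae_of_all _ fun ξ hξ => (hwpos ξ hξ).le)) hwi]
    refine hSpos.trans_le (measure_mono fun ξ hξ => ⟨(hwpos ξ hξ).ne', hξ⟩)
  -- the Fourier transform of `w 1_S` tends to zero
  have hRL := tendsto_integral_exp_inner_smul_cocompact
    (fun ξ : EuclideanSpace ℝ (Fin N) => ((S.indicator w ξ : ℝ) : ℂ))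
  have hev := (Metric.tendsto_nhds.1 hRL) (I / 4) (by positivity)
  rw [← Metric.cobounded_eq_cocompact] at hev
  obtain ⟨R, -, hR⟩ := (Metric.hasBasis_cobounded_compl_closedBall
    (0 : EuclideanSpace ℝ (Fin N))).eventually_iff.1 hev
  have hlow : ∀ t : EuclideanSpace ℝ (Fin N), 2 * Real.pi * (|R| + 1) ≤ ‖t‖ →
      I ≤ fieldStd E ψ t ^ 2 := by
    intro t ht
    have hmem : (-(2 * Real.pi)⁻¹) • t ∈ (Metric.closedBall (0 : EuclideanSpace ℝ (Fin N)) R)ᶜ := by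
      rw [Set.mem_compl_iff, mem_closedBall_zero_iff, not_le, norm_smul, norm_neg, norm_inv,
        Real.norm_of_nonneg (by positivity : 0 ≤ 2 * Real.pi), lt_inv_mul_iff₀ (by positivity)]
      refine lt_of_lt_of_le ?_ ht
      refine mul_lt_mul_of_pos_left ?_ (by positivity)
      linarith [le_abs_self R]
    have h1 := hR hmem
    rw [dist_zero_right] at h1
    have h2 : ∫ v, Real.fourierChar (-(inner ℝ v ((-(2 * Real.pi)⁻¹) • t))) •
        ((S.indicator w v : ℝ) : ℂ) = ∫ ξ in S, character t ξ * (w ξ : ℂ) := by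
      rw [← integral_indicator hSm]
      refine integral_congr_ae (ae_of_all _ fun ξ => ?_)
      by_cases hξ : ξ ∈ S
      · simp only [hξ, Set.indicator_of_mem]
        rw [Circle.smul_def, Real.fourierChar_apply, character, smul_eq_mul, inner_smul_right,
          real_inner_comm]
        congr 2
        rw [mul_comm Complex.I]
        congr 2
        field_simp
      · simp [hξ]
    rw [h2] at h1
    have hint : IntegrableOn (fun ξ => character t ξ * (w ξ : ℂ)) S volume := by
      refine hwi.ofReal.bdd_mul (c := 1)
        (continuous_character_right t).aestronglyMeasurable
        (ae_of_all _ fun ξ => (norm_character t ξ).le)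
    have h3 : ∫ ξ in S, (character t ξ * (w ξ : ℂ)).re ≤ I / 4 := by
      refine Eq.trans_le (Complex.reCLM.integral_comp_comm hint) ?_
      exact (Complex.re_le_norm _).trans h1.le
    rw [fieldStd_sq (hk t)]
    have h4 : ∫ ξ in S, ‖harmonizableKernel E ψ t ξ‖ ^ 2 ≤
        ∫ ξ, ‖harmonizableKernel E ψ t ξ‖ ^ 2 :=
      setIntegral_le_integral ((memLp_two_iff_integrable_sq_norm (hk t).1).1 (hk t))
        (ae_of_all _ fun _ => by positivity)
    refine le_trans ?_ h4
    have h5 : ∀ ξ, ‖harmonizableKernel E ψ t ξ‖ ^ 2 =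
        2 * w ξ - 2 * (character t ξ * (w ξ : ℂ)).re := by
      intro ξ
      have hz : ‖character t ξ - 1‖ ^ 2 = 2 - 2 * (character t ξ).re := by
        have hn := norm_character t ξ
        have hn2 : (character t ξ).re ^ 2 + (character t ξ).im ^ 2 = 1 := by
          have := Complex.sq_norm (character t ξ)
          rw [hn, Complex.normSq_apply] at this
          nlinarith
        rw [Complex.sq_norm, Complex.normSq_apply]
        simp only [Complex.sub_re, Complex.sub_im, Complex.one_re, Complex.one_im]
        nlinarith
      rw [kernel_eq, norm_div, div_pow, hz, Complex.norm_real, Real.norm_eq_abs, sq_abs,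
        Complex.re_mul_ofReal, hw]
      simp only [inv_pow]
      rw [div_eq_mul_inv]
      ring
    simp_rw [h5]
    have hint' : IntegrableOn (fun ξ => (character t ξ * (w ξ : ℂ)).re) S volume :=
      Complex.reCLM.integrable_comp hint
    rw [integral_sub (hwi.const_mul 2) (hint'.const_mul 2),
      integral_const_mul, integral_const_mul, ← hI]
    linarith
  refine ⟨Real.sqrt I, Real.sqrt_pos.2 hIpos, 2 * Real.pi * (|R| + 1), by positivity,
    fun t ht => ?_⟩
  exact Real.sqrt_le_iff.2 ⟨fieldStd_nonneg t, hlow t ht⟩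

/-- The sublevel sets of `fieldStd` are bounded: by homogeneity a bound at one level suffices. -/
lemma exists_norm_le_of_fieldStd_le (hN : 0 < N) (hψ : IsSymmHomogeneous E.transpose ψ)
    (hk : ∀ t, MemLp (harmonizableKernel E ψ t) 2 volume) (a : ℝ) :
    ∃ R > 0, ∀ t : EuclideanSpace ℝ (Fin N), fieldStd E ψ t ≤ a → ‖t‖ ≤ R := by
  obtain ⟨m, hm, R, hR, h⟩ := exists_le_fieldStd_far hN hψ hk
  set c := m / (2 * (|a| + 1)) with hc
  have hc0 : 0 < c := by positivity
  let L : EuclideanSpace ℝ (Fin N) →L[ℝ] EuclideanSpace ℝ (Fin N) :=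
    LinearMap.toContinuousLinearMap (opPow E c⁻¹)
  refine ⟨(‖L‖ + 1) * R, by positivity, fun t ht => ?_⟩
  have h1 : fieldStd E ψ (opPow E c t) < m := by
    rw [fieldStd_opPow hψ hc0]
    calc c * fieldStd E ψ t ≤ c * (|a| + 1) :=
          mul_le_mul_of_nonneg_left (by linarith [le_abs_self a]) hc0.le
      _ = m / 2 := by rw [hc]; field_simp
      _ < m := by linarith
  have h2 : ‖opPow E c t‖ ≤ R := by
    by_contra! hcon
    exact absurd (h _ hcon.le) (not_le.2 h1)
  have h3 : ‖t‖ ≤ ‖L‖ * ‖opPow E c t‖ := by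
    have := L.le_opNorm (opPow E c t)
    have e : L (opPow E c t) = t := opPow_inv_opPow E hc0 t
    rwa [e] at this
  nlinarith [norm_nonneg L]

end FieldStd

/-! ### The radial part -/

section Radial

variable {N : ℕ} {E : Matrix (Fin N) (Fin N) ℝ} {ν : Seminorm ℝ (EuclideanSpace ℝ (Fin N))}

lemma radial_opPow_of_norm_eq_one (hν : IsPolarNorm E ν) {r : ℝ} (hr : 0 < r)
    {θ : EuclideanSpace ℝ (Fin N)} (hθ : ν θ = 1) : radial E ν (opPow E r θ) = r := by
  have hθ0 : θ ≠ 0 := by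
    rintro rfl
    simp at hθ
  have h : opPow E r θ ≠ 0 ∧ ∃ r' : ℝ, 0 < r' ∧ ∃ θ', ν θ' = 1 ∧ opPow E r θ = opPow E r' θ' :=
    ⟨opPow_ne_zero E hr hθ0, r, hr, θ, hθ, rfl⟩
  rw [radial, dif_pos h]
  obtain ⟨h1, θ', h2, h3⟩ := h.2.choose_spec
  have := hν.isEmbedding.injective (a₁ := (⟨r, hr⟩, ⟨θ, hθ⟩))
    (a₂ := (⟨h.2.choose, h1⟩, ⟨θ', h2⟩)) h3
  simpa using (congrArg (fun q => (q.1 : ℝ)) this).symm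

/-- The polar decomposition of a nonzero vector. -/
lemma exists_polar (hν : IsPolarNorm E ν) {x : EuclideanSpace ℝ (Fin N)} (hx : x ≠ 0) :
    0 < radial E ν x ∧ ∃ θ, ν θ = 1 ∧ x = opPow E (radial E ν x) θ := by
  have : x ∈ Set.range (polarMap E ν) := by
    rw [hν.range_eq]
    exact hx
  obtain ⟨⟨⟨r, hr⟩, ⟨θ, hθ⟩⟩, rfl⟩ := this
  have h : radial E ν (polarMap E ν (⟨r, hr⟩, ⟨θ, hθ⟩)) = r :=
    radial_opPow_of_norm_eq_one hν hr hθ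
  rw [h]
  exact ⟨hr, θ, hθ, rfl⟩

@[simp] lemma radial_zero : radial E ν 0 = 0 := by simp [radial]

lemma radial_pos (hν : IsPolarNorm E ν) {x : EuclideanSpace ℝ (Fin N)} (hx : x ≠ 0) :
    0 < radial E ν x := (exists_polar hν hx).1

lemma radial_opPow (hν : IsPolarNorm E ν) {c : ℝ} (hc : 0 < c) {x : EuclideanSpace ℝ (Fin N)}
    (hx : x ≠ 0) : radial E ν (opPow E c x) = c * radial E ν x := by
  obtain ⟨hr, θ, hθ, h⟩ := exists_polar hν hx
  conv_lhs => rw [h, ← opPow_mul E hc hr]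
  exact radial_opPow_of_norm_eq_one hν (mul_pos hc hr) hθ

lemma continuousOn_radial (hν : IsPolarNorm E ν) : ContinuousOn (radial E ν) {0}ᶜ := by
  rw [continuousOn_iff_continuous_domRestrict]
  let e := hν.isEmbedding.toHomeomorph
  have hmem : ∀ x : ({0}ᶜ : Set (EuclideanSpace ℝ (Fin N))), (x : EuclideanSpace ℝ (Fin N)) ∈
      Set.range (polarMap E ν) := fun x => by
    rw [hν.range_eq]
    exact x.2
  have h : Set.domRestrict {0}ᶜ (radial E ν) =
      fun x : ({0}ᶜ : Set (EuclideanSpace ℝ (Fin N))) => ((e.symm ⟨x, hmem x⟩).1 : ℝ) := by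
    funext x
    obtain ⟨q, hq⟩ := hmem x
    have h1 : (⟨x, hmem x⟩ : Set.range (polarMap E ν)) = e q := Subtype.ext hq.symm
    rw [h1, Homeomorph.symm_apply_apply, Set.domRestrict_apply, ← hq]
    exact radial_opPow_of_norm_eq_one hν q.1.2 q.2.2
  rw [h]
  exact continuous_subtype_val.comp (continuous_fst.comp
    (e.symm.continuous.comp (continuous_subtype_val.subtype_mk hmem)))

lemma isCompact_sphere (hN : 0 < N) (hν : ∀ x, ν x = 0 → x = 0) :
    IsCompact {θ : EuclideanSpace ℝ (Fin N) | ν θ = 1} := by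
  have hcont : Continuous ν := by
    let b := EuclideanSpace.basisFun (Fin N) ℝ
    let C : NNReal := (∑ i, ν (b i)).toNNReal
    refine Seminorm.continuous_of_le (q := C • normSeminorm ℝ _)
      ((continuous_const (y := (C : ℝ))).mul continuous_norm) fun x => ?_
    have h1 : ν x ≤ ∑ i, ‖x i‖ * ν (b i) := by
      conv_lhs => rw [← b.sum_repr x]
      refine (Finset.le_sum_of_subadditive ν (map_zero ν).le (map_add_le_add ν) _ _).trans
        (Finset.sum_le_sum fun i _ => ?_)
      rw [map_smul_eq_mul]
      simp [b]
    refine h1.trans ?_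
    have h2 : (C • normSeminorm ℝ (EuclideanSpace ℝ (Fin N))) x = (∑ i, ν (b i)) * ‖x‖ := by
      have hC : (C : ℝ) = ∑ i, ν (b i) :=
        Real.coe_toNNReal _ (Finset.sum_nonneg fun i _ => apply_nonneg ν _)
      rw [← hC]
      rfl
    rw [h2, Finset.sum_mul]
    refine Finset.sum_le_sum fun i _ => ?_
    rw [mul_comm]
    exact mul_le_mul_of_nonneg_left (PiLp.norm_apply_le x i) (apply_nonneg ν _)
  have hsph : IsCompact (Metric.sphere (0 : EuclideanSpace ℝ (Fin N)) 1) :=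
    _root_.isCompact_sphere _ _
  have hne : (Metric.sphere (0 : EuclideanSpace ℝ (Fin N)) 1).Nonempty :=
    ⟨EuclideanSpace.single (⟨0, hN⟩ : Fin N) (1 : ℝ), by simp⟩
  obtain ⟨a, ha, hmin⟩ := hsph.exists_isMinOn hne hcont.continuousOn
  have ha0 : a ≠ 0 := by
    rintro rfl
    simp at ha
  have hpos : 0 < ν a := (apply_nonneg ν a).lt_of_ne fun h => ha0 (hν a h.symm)
  refine Metric.isCompact_of_isClosed_isBounded (isClosed_eq hcont continuous_const)
    ((Metric.isBounded_closedBall (x := (0 : EuclideanSpace ℝ (Fin N))) (r := (ν a)⁻¹)).subset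
      fun θ hθ => ?_)
  have hθ1 : ν θ = 1 := hθ
  have hθ0 : θ ≠ 0 := by
    rintro rfl
    simp at hθ1
  have hn := norm_pos_iff.2 hθ0
  have h3 : ν a ≤ ν (‖θ‖⁻¹ • θ) := hmin (by
    rw [mem_sphere_zero_iff_norm, norm_smul, norm_inv, norm_norm, inv_mul_cancel₀ hn.ne'])
  rw [map_smul_eq_mul, hθ1, mul_one, norm_inv, norm_norm] at h3
  rw [mem_closedBall_zero_iff]
  exact (le_inv_comm₀ hpos hn).1 h3

/-- `fieldStd` and the radial part are comparable: both are homogeneous, and `fieldStd` is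
continuous and positive on the compact unit sphere of `ν`. -/
lemma exists_fieldStd_comparable (hN : 0 < N) {ψ : EuclideanSpace ℝ (Fin N) → ℝ}
    (hν : IsPolarNorm E ν) (hψ : IsSymmHomogeneous E.transpose ψ)
    (hk : ∀ t, MemLp (harmonizableKernel E ψ t) 2 volume) :
    ∃ c > 0, ∃ C > 0, ∀ t : EuclideanSpace ℝ (Fin N),
      c * radial E ν t ≤ fieldStd E ψ t ∧ fieldStd E ψ t ≤ C * radial E ν t := by
  have hcomp := isCompact_sphere hN hν.eq_zero
  have hcont := continuous_fieldStd hψ hk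
  have hne : {θ : EuclideanSpace ℝ (Fin N) | ν θ = 1}.Nonempty := by
    obtain ⟨-, θ, hθ, -⟩ := exists_polar hν
      (x := EuclideanSpace.single (⟨0, hN⟩ : Fin N) (1 : ℝ)) (by simp)
    exact ⟨θ, hθ⟩
  obtain ⟨a, ha, hamin⟩ := hcomp.exists_isMinOn hne hcont.continuousOn
  obtain ⟨b, hb, hbmax⟩ := hcomp.exists_isMaxOn hne hcont.continuousOn
  have hpos : ∀ θ, ν θ = 1 → 0 < fieldStd E ψ θ := fun θ hθ =>
    fieldStd_pos hψ (hk θ) (by rintro rfl; simp at hθ)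
  refine ⟨fieldStd E ψ a, hpos a ha, fieldStd E ψ b, hpos b hb, fun t => ?_⟩
  rcases eq_or_ne t 0 with rfl | ht
  · simp [fieldStd_zero]
  obtain ⟨hr, θ, hθ, h⟩ := exists_polar hν ht
  have h1 : fieldStd E ψ t = radial E ν t * fieldStd E ψ θ := by
    conv_lhs => rw [h]
    exact fieldStd_opPow hψ hr θ
  rw [h1, mul_comm _ (radial E ν t), mul_comm _ (radial E ν t)]
  exact ⟨mul_le_mul_of_nonneg_left (hamin hθ) hr.le, mul_le_mul_of_nonneg_left (hbmax hθ) hr.le⟩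

end Radial

/-! ### Dyadic grids -/

section Grid

variable {N : ℕ}

/-- The cube `[-R, R]^N`. -/
def cube (N R : ℕ) : Set (EuclideanSpace ℝ (Fin N)) := {x | ∀ i, |x i| ≤ R}

/-- The dyadic point of level `n` obtained by rounding down the coordinates of `x`. -/
noncomputable def dyadicFloor (n : ℕ) (x : EuclideanSpace ℝ (Fin N)) : EuclideanSpace ℝ (Fin N) :=
  WithLp.toLp 2 fun i => (⌊2 ^ n * x i⌋ : ℝ) / 2 ^ n

/-- The dyadic points of level `n` in the cube `[-R, R]^N`. -/
noncomputable def dyadicGrid (N R n : ℕ) : Finset (EuclideanSpace ℝ (Fin N)) := by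
  classical
  exact (Fintype.piFinset fun _ : Fin N => Finset.Icc (-(R * 2 ^ n : ℤ)) (R * 2 ^ n)).image
    fun k => WithLp.toLp 2 fun i => (k i : ℝ) / 2 ^ n

lemma norm_le_of_forall_abs_le {x : EuclideanSpace ℝ (Fin N)} {r : ℝ} (h : ∀ i, |x i| ≤ r) :
    ‖x‖ ≤ N * r := by
  conv_lhs => rw [← (EuclideanSpace.basisFun (Fin N) ℝ).sum_repr x]
  refine (norm_sum_le _ _).trans ((Finset.sum_le_card_nsmul _ _ r fun i _ => ?_).trans_eq ?_)
  · rw [norm_smul]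
    simpa using h i
  · simp

lemma norm_sub_dyadicFloor_le (n : ℕ) (x : EuclideanSpace ℝ (Fin N)) :
    ‖x - dyadicFloor n x‖ ≤ N / 2 ^ n := by
  have h2 : (0 : ℝ) < 2 ^ n := by positivity
  rw [div_eq_mul_one_div (N : ℝ)]
  refine norm_le_of_forall_abs_le fun i => ?_
  have h1 : (x - dyadicFloor n x) i = Int.fract (2 ^ n * x i) / 2 ^ n := by
    rw [Int.fract, sub_div, mul_div_cancel_left₀ _ h2.ne']
    rfl
  rw [h1, abs_of_nonneg (div_nonneg (Int.fract_nonneg _) h2.le)]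
  exact div_le_div_of_nonneg_right (Int.fract_lt_one _).le h2.le

lemma dyadicFloor_mem_dyadicGrid {R : ℕ} (n : ℕ) {x : EuclideanSpace ℝ (Fin N)}
    (hx : x ∈ cube N R) :
    dyadicFloor n x ∈ dyadicGrid N R n := by
  classical
  refine Finset.mem_image.2 ⟨fun i => ⌊2 ^ n * x i⌋, Fintype.mem_piFinset.2 fun i => ?_, rfl⟩
  obtain ⟨h1, h2⟩ := abs_le.1 (hx i)
  have h3 : (0 : ℝ) < 2 ^ n := by positivity
  rw [Finset.mem_Icc]
  constructor
  · rw [Int.le_floor]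
    push_cast
    nlinarith
  · have h4 : (⌊2 ^ n * x i⌋ : ℝ) ≤ R * 2 ^ n := (Int.floor_le _).trans (by nlinarith)
    exact_mod_cast h4

lemma dyadicGrid_subset_cube (R n : ℕ) :
    ∀ x ∈ dyadicGrid N R n, x ∈ cube N R := by
  classical
  intro x hx i
  obtain ⟨k, hk, rfl⟩ := Finset.mem_image.1 hx
  have hki := Finset.mem_Icc.1 (Fintype.mem_piFinset.1 hk i)
  have h3 : (0 : ℝ) < 2 ^ n := by positivity
  have h1 : (-(R * 2 ^ n) : ℝ) ≤ k i := by exact_mod_cast hki.1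
  have h2 : (k i : ℝ) ≤ R * 2 ^ n := by exact_mod_cast hki.2
  simp only
  rw [abs_div, abs_of_pos h3, div_le_iff₀ h3, abs_le]
  exact ⟨h1, h2⟩

lemma dyadicGrid_mono (R n : ℕ) : dyadicGrid N R n ⊆ dyadicGrid N R (n + 1) := by
  classical
  intro x hx
  obtain ⟨k, hk, rfl⟩ := Finset.mem_image.1 hx
  refine Finset.mem_image.2 ⟨fun i => k i * 2, Fintype.mem_piFinset.2 fun i => ?_, ?_⟩
  · have hki := Finset.mem_Icc.1 (Fintype.mem_piFinset.1 hk i)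
    rw [Finset.mem_Icc, pow_succ]
    constructor <;> nlinarith [hki.1, hki.2]
  · congr 1
    funext i
    push_cast
    rw [pow_succ]
    field_simp

lemma card_dyadicGrid_le (R n : ℕ) : (dyadicGrid N R n).card ≤ ((2 * R + 1) * 2 ^ n) ^ N := by
  classical
  refine Finset.card_image_le.trans ?_
  rw [Fintype.card_piFinset_const, Int.card_Icc]
  refine Nat.pow_le_pow_left ?_ _
  have h : (1 : ℤ) ≤ 2 ^ n := one_le_pow₀ (by norm_num)
  have : ((R * 2 ^ n : ℤ) + 1 - -(R * 2 ^ n)) ≤ (((2 * R + 1) * 2 ^ n : ℕ) : ℤ) := by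
    push_cast
    linarith
  omega

end Grid

/-! ### Chaining -/

section Chaining

variable {N : ℕ}

/-- The deterministic part of the chaining argument: if the increments of `y` over the pairs of
neighbours of each level `n` are at most `u q ^ n`, then `y` is Hölder continuous. -/
lemma chaining_of_neighbours {y : EuclideanSpace ℝ (Fin N) → ℝ}
    {F : ℕ → Finset (EuclideanSpace ℝ (Fin N))} (hF : ∀ n, F n ⊆ F (n + 1))
    {π : ℕ → EuclideanSpace ℝ (Fin N) → EuclideanSpace ℝ (Fin N)}
    {Δ : Set (EuclideanSpace ℝ (Fin N))} {D₀ D₁ : ℝ} {u q : ℝ} (hu : 0 ≤ u) (hq0 : 0 < q)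
    (hq1 : q < 1) (hD₁ : 0 ≤ D₁)
    (hπF : ∀ x ∈ Δ, ∀ n, π n x ∈ F n) (hπ : ∀ x ∈ Δ, ∀ n, ‖x - π n x‖ ≤ D₀ / 2 ^ n)
    (hπev : ∀ x ∈ Δ, ∃ n₀, ∀ n, n₀ ≤ n → π n x = x)
    (hinc : ∀ n, ∀ a ∈ F n, ∀ b ∈ F n, ‖a - b‖ ≤ (D₁ + 3 * D₀) / 2 ^ n →
      |y a - y b| ≤ u * q ^ n)
    {s t : EuclideanSpace ℝ (Fin N)} (hs : s ∈ Δ) (ht : t ∈ Δ) {n : ℕ}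
    (hst : ‖s - t‖ ≤ D₁ / 2 ^ n) :
    |y s - y t| ≤ u * q ^ n * (1 + 2 / (1 - q)) := by
  have h1q : 0 < 1 - q := by linarith
  have hD₀ : 0 ≤ D₀ := by simpa using (norm_nonneg _).trans (hπ s hs 0)
  have hstep : ∀ x ∈ Δ, ∀ m, |y (π (m + 1) x) - y (π m x)| ≤ u * q ^ (m + 1) := by
    intro x hx m
    refine hinc (m + 1) _ (hπF x hx _) _ (hF _ (hπF x hx _)) ?_
    have h1 := hπ x hx (m + 1)
    have h2 := hπ x hx m
    rw [norm_sub_rev] at h1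
    calc ‖π (m + 1) x - π m x‖ = ‖(π (m + 1) x - x) + (x - π m x)‖ := by congr 1; abel
      _ ≤ D₀ / 2 ^ (m + 1) + D₀ / 2 ^ m := (norm_add_le _ _).trans (add_le_add h1 h2)
      _ = 3 * D₀ / 2 ^ (m + 1) := by rw [pow_succ]; field_simp; norm_num
      _ ≤ _ := div_le_div_of_nonneg_right (by linarith) (by positivity)
  have hchain : ∀ x ∈ Δ, ∀ m, n ≤ m →
      |y (π m x) - y (π n x)| ≤ u / (1 - q) * (q ^ n - q ^ m) := by
    intro x hx m hm
    induction m, hm using Nat.le_induction with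
    | base => simp
    | succ m hm ih =>
      have h1 := hstep x hx m
      have h2 : |y (π (m + 1) x) - y (π n x)| ≤
          |y (π (m + 1) x) - y (π m x)| + |y (π m x) - y (π n x)| := abs_sub_le _ _ _
      have h3 : u / (1 - q) * (q ^ n - q ^ (m + 1)) =
          u / (1 - q) * (q ^ n - q ^ m) + u * q ^ m := by
        rw [pow_succ]
        field_simp
        ring
      have h4 : u * q ^ (m + 1) ≤ u * q ^ m :=
        mul_le_mul_of_nonneg_left (pow_le_pow_of_le_one hq0.le hq1.le (Nat.le_succ m)) hu
      linarith
  have hlim : ∀ x ∈ Δ, |y x - y (π n x)| ≤ u / (1 - q) * q ^ n := by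
    intro x hx
    obtain ⟨n₀, hn₀⟩ := hπev x hx
    have h := hchain x hx (max n n₀) (le_max_left _ _)
    rw [hn₀ _ (le_max_right _ _)] at h
    refine h.trans (mul_le_mul_of_nonneg_left ?_ (by positivity))
    have := pow_pos hq0 (max n n₀)
    linarith
  have hmid : |y (π n s) - y (π n t)| ≤ u * q ^ n := by
    refine hinc n _ (hπF s hs n) _ (hπF t ht n) ?_
    have h1 := hπ s hs n
    have h2 := hπ t ht n
    rw [norm_sub_rev] at h1
    calc ‖π n s - π n t‖ = ‖(π n s - s) + (s - t) + (t - π n t)‖ := by congr 1; abel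
      _ ≤ D₀ / 2 ^ n + D₁ / 2 ^ n + D₀ / 2 ^ n :=
        (norm_add_le _ _).trans (add_le_add ((norm_add_le _ _).trans (add_le_add h1 hst)) h2)
      _ = (D₁ + 2 * D₀) / 2 ^ n := by ring
      _ ≤ _ := div_le_div_of_nonneg_right (by linarith) (by positivity)
  have h1 := hlim s hs
  have h2 := hlim t ht
  rw [abs_sub_comm] at h2
  calc |y s - y t| = |(y s - y (π n s)) + (y (π n s) - y (π n t)) + (y (π n t) - y t)| := by
        congr 1; ring
    _ ≤ u / (1 - q) * q ^ n + u * q ^ n + u / (1 - q) * q ^ n :=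
        (abs_add_le _ _).trans (add_le_add ((abs_add_le _ _).trans (add_le_add h1 hmid)) h2)
    _ = _ := by ring

/-- Geometric growth is beaten by doubly exponential decay. -/
lemma summable_geometric_mul_exp_neg {ρ β p : ℝ} (hρ : 0 < ρ) (hβ : 0 < β) (hp : 1 < p) :
    Summable fun n : ℕ => ρ ^ n * Real.exp (-(β * p ^ n)) := by
  obtain ⟨m, hm⟩ := pow_unbounded_of_one_lt (2 * ρ) hp
  refine Summable.of_nonneg_of_le (fun n => by positivity) (fun n => ?_)
    ((summable_geometric_of_lt_one (r := (1 / 2 : ℝ)) (by norm_num) (by norm_num)).mul_left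
      (m.factorial / β ^ m))
  have hx : 0 < β * p ^ n := by positivity
  have h1 := Real.pow_div_factorial_le_exp (β * p ^ n) hx.le m
  have h2 : Real.exp (-(β * p ^ n)) ≤ m.factorial / (β * p ^ n) ^ m := by
    rw [Real.exp_neg, ← one_div, div_le_div_iff₀ (Real.exp_pos _) (by positivity), one_mul]
    rw [div_le_iff₀ (by positivity)] at h1
    linarith
  calc ρ ^ n * Real.exp (-(β * p ^ n)) ≤ ρ ^ n * (m.factorial / (β * p ^ n) ^ m) :=
        mul_le_mul_of_nonneg_left h2 (by positivity)
    _ = m.factorial / β ^ m * (ρ ^ n / (p ^ m) ^ n) := by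
        rw [mul_pow, ← pow_mul, ← pow_mul, mul_comm n m]
        field_simp
    _ ≤ m.factorial / β ^ m * (1 / 2) ^ n := by
        refine mul_le_mul_of_nonneg_left ?_ (by positivity)
        rw [← div_pow]
        refine pow_le_pow_left₀ (by positivity) ?_ n
        rw [div_le_div_iff₀ (by positivity) (by norm_num)]
        linarith

/-- **Chaining.** A process on a cube whose increments are sub-Gaussian at a Hölder scale is Hölder
continuous on every sequence of points, with a constant that has Gaussian tails. -/
theorem exists_chaining_tail {Ω : Type*} [MeasurableSpace Ω] (P : Measure Ω) {κ A : ℝ}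
    (hκ : 0 < κ) (hA : 0 < A) (N R : ℕ) :
    ∃ C > 0, ∃ α > 0, ∀ Y : EuclideanSpace ℝ (Fin N) → Ω → ℝ,
      (∀ a ∈ cube N R, ∀ b ∈ cube N R, ∀ v > 0, A * ‖a - b‖ ^ κ ≤ v → ∀ x ≥ 0,
        P {ω | x ≤ |Y a ω - Y b ω|} ≤ ENNReal.ofReal (2 * Real.exp (-(x ^ 2 / (2 * v ^ 2))))) →
      ∀ d : ℕ → EuclideanSpace ℝ (Fin N), (∀ k, d k ∈ cube N R) → ∀ u : ℝ, 1 ≤ u →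
        P {ω | ¬ ∀ j k, |Y (d j) ω - Y (d k) ω| ≤ C * u * ‖d j - d k‖ ^ (κ / 2)} ≤
          ENNReal.ofReal (C * Real.exp (-(α * u ^ 2))) := by
  classical
  -- `D₁` bounds the diameter of the cube, and `D / 2 ^ n` the distance of neighbours of level `n`
  set D₁ : ℝ := 2 * (N * R) + 1 with hD₁
  have hD₁pos : 0 < D₁ := by positivity
  set D : ℝ := D₁ + 3 * N with hD
  have hDpos : 0 < D := by positivity
  set q : ℝ := (1 / 2 : ℝ) ^ (κ / 2) with hq
  have hq0 : 0 < q := Real.rpow_pos_of_pos (by norm_num) _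
  have hq1 : q < 1 := Real.rpow_lt_one (by norm_num) (by norm_num) (by positivity)
  set p : ℝ := (2 : ℝ) ^ κ with hp
  have hp1 : 1 < p := Real.one_lt_rpow (by norm_num) hκ
  set β : ℝ := 1 / (2 * (A * D ^ κ) ^ 2) with hβ
  have hβpos : 0 < β := by positivity
  set c₀ : ℝ := (2 * R + 1) ^ N + 1 with hc₀
  have hc₀pos : 0 < c₀ := by positivity
  set ρ : ℝ := (2 ^ (N + 1)) ^ 2 with hρ
  set S : ℝ := ∑' n : ℕ, ρ ^ n * Real.exp (-(β / 2 * p ^ n)) with hS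
  have hsum := summable_geometric_mul_exp_neg (ρ := ρ) (β := β / 2) (p := p)
    (by positivity) (by positivity) hp1
  have hSpos : 0 ≤ S := tsum_nonneg fun n => by positivity
  set K : ℝ := (1 + 2 / (1 - q)) * (2 / D₁) ^ (κ / 2) with hK
  have h1q : 0 < 1 - q := by linarith
  have hKpos : 0 < K := by positivity
  refine ⟨max K (2 * c₀ ^ 2 * S), lt_max_of_lt_left hKpos, β / 2, by positivity,
    fun Y hY d hd u hu => ?_⟩
  have hu0 : 0 < u := by linarith
  -- the points of level `n`: the dyadic grid, together with the first `n` points of the sequence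
  set F : ℕ → Finset (EuclideanSpace ℝ (Fin N)) := fun n =>
    dyadicGrid N R n ∪ (Finset.range n).image d with hF
  have hFcube : ∀ n, ∀ a ∈ F n, a ∈ cube N R := by
    intro n a ha
    rcases Finset.mem_union.1 ha with h | h
    · exact dyadicGrid_subset_cube R n a h
    · obtain ⟨k, -, rfl⟩ := Finset.mem_image.1 h
      exact hd k
  have hFmono : ∀ n, F n ⊆ F (n + 1) := fun n =>
    Finset.union_subset_union (dyadicGrid_mono R n)
      (Finset.image_subset_image (Finset.range_subset_range.2 (Nat.le_succ n)))
  have hFcard : ∀ n, ((F n).card : ℝ) ≤ c₀ * (2 ^ (N + 1)) ^ n := by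
    intro n
    have h1 : (F n).card ≤ ((2 * R + 1) * 2 ^ n) ^ N + n := by
      refine (Finset.card_union_le _ _).trans (add_le_add (card_dyadicGrid_le R n) ?_)
      exact Finset.card_image_le.trans (Finset.card_range n).le
    have h2 : ((F n).card : ℝ) ≤ ((2 * R + 1) * 2 ^ n) ^ N + n := by exact_mod_cast h1
    have h3 : (n : ℝ) ≤ 2 ^ n := by exact_mod_cast Nat.lt_two_pow_self.le
    have h4 : ((2 : ℝ) ^ n) ^ N ≤ (2 ^ (N + 1)) ^ n := by
      rw [← pow_mul, ← pow_mul]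
      exact pow_le_pow_right₀ (by norm_num) (by nlinarith)
    have h5 : (2 : ℝ) ^ n ≤ (2 ^ (N + 1)) ^ n :=
      pow_le_pow_left₀ (by norm_num) (by
        rw [pow_succ]
        have : (1 : ℝ) ≤ 2 ^ N := one_le_pow₀ (by norm_num)
        linarith) n
    rw [mul_pow] at h2
    have h6 : (0 : ℝ) ≤ (2 * R + 1) ^ N := by positivity
    nlinarith
  set bad : ℕ → EuclideanSpace ℝ (Fin N) → EuclideanSpace ℝ (Fin N) → Set Ω := fun n a b =>
    {ω | ‖a - b‖ ≤ D / 2 ^ n ∧ u * q ^ n ≤ |Y a ω - Y b ω|} with hbad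
  have hbadP : ∀ n, ∀ a ∈ F n, ∀ b ∈ F n, P (bad n a b) ≤
      ENNReal.ofReal (2 * Real.exp (-(u ^ 2 * β * p ^ n))) := by
    intro n a ha b hb
    by_cases hab : ‖a - b‖ ≤ D / 2 ^ n
    · refine (measure_mono fun ω hω => hω.2).trans ((hY a (hFcube n a ha) b (hFcube n b hb)
        (A * (D / 2 ^ n) ^ κ) (by positivity) ?_ (u * q ^ n) (by positivity)).trans_eq ?_)
      · exact mul_le_mul_of_nonneg_left (Real.rpow_le_rpow (norm_nonneg _) hab hκ.le) hA.le
      · congr 4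
        have e1 : (q ^ n) ^ 2 = (p ^ n)⁻¹ := by
          rw [← pow_mul, mul_comm, pow_mul, ← inv_pow]
          congr 1
          rw [hq, hp, ← Real.rpow_natCast, ← Real.rpow_mul (by norm_num), one_div,
            Real.inv_rpow (by norm_num)]
          norm_num
        have e2 : (D / 2 ^ n) ^ κ = D ^ κ / p ^ n := by
          rw [Real.div_rpow hDpos.le (by positivity), hp, ← Real.rpow_natCast,
            ← Real.rpow_natCast, ← Real.rpow_mul (by norm_num), ← Real.rpow_mul (by norm_num),
            mul_comm κ]
        have hpn : 0 < p ^ n := by positivity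
        have hDk : 0 < D ^ κ := by positivity
        rw [mul_pow, e1, e2, hβ]
        field_simp
    · have : bad n a b = ∅ := by
        ext ω
        simp [hbad, hab]
      rw [this, measure_empty]
      exact zero_le
  have hsub : {ω | ¬ ∀ j k, |Y (d j) ω - Y (d k) ω| ≤
      max K (2 * c₀ ^ 2 * S) * u * ‖d j - d k‖ ^ (κ / 2)} ⊆
      ⋃ n, ⋃ a ∈ F n, ⋃ b ∈ F n, bad n a b := by
    intro ω hω
    by_contra hcon
    refine hω fun j k => ?_
    have hinc : ∀ n, ∀ a ∈ F n, ∀ b ∈ F n, ‖a - b‖ ≤ (D₁ + 3 * N) / 2 ^ n →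
        |Y a ω - Y b ω| ≤ u * q ^ n := by
      intro n a ha b hb hab
      by_contra! hlt
      refine hcon (Set.mem_iUnion.2 ⟨n, Set.mem_iUnion₂.2 ⟨a, ha, Set.mem_iUnion₂.2 ⟨b, hb, ?_⟩⟩⟩)
      exact ⟨hab, hlt.le⟩
    -- rounding to level `n` fixes the points of the sequence that already belong to `F n`, so it is
    -- eventually the identity at each of them
    let π : ℕ → EuclideanSpace ℝ (Fin N) → EuclideanSpace ℝ (Fin N) := fun n x =>
      if ∃ k < n, d k = x then x else dyadicFloor n x
    have hπ1 : ∀ x ∈ Set.range d, ∀ n, π n x ∈ F n := by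
      rintro x ⟨i, rfl⟩ n
      simp only [π]
      split_ifs with h
      · obtain ⟨k, hk, hki⟩ := h
        exact Finset.mem_union_right _ (Finset.mem_image.2 ⟨k, Finset.mem_range.2 hk, hki⟩)
      · exact Finset.mem_union_left _ (dyadicFloor_mem_dyadicGrid n (hd i))
    have hπ2 : ∀ x ∈ Set.range d, ∀ n, ‖x - π n x‖ ≤ N / 2 ^ n := by
      intro x _ n
      simp only [π]
      split_ifs with h
      · rw [sub_self, norm_zero]
        positivity
      · exact norm_sub_dyadicFloor_le n x
    have hπ3 : ∀ x ∈ Set.range d, ∃ n₀, ∀ n, n₀ ≤ n → π n x = x := by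
      rintro x ⟨i, rfl⟩
      exact ⟨i + 1, fun n hn => if_pos ⟨i, by omega, rfl⟩⟩
    rcases eq_or_ne (d j) (d k) with hjk | hjk
    · rw [hjk, sub_self, abs_zero]
      positivity
    have hpos : 0 < ‖d j - d k‖ := norm_pos_iff.2 (sub_ne_zero.2 hjk)
    have hle : ‖d j - d k‖ ≤ D₁ := by
      have h1 := norm_le_of_forall_abs_le (hd j)
      have h2 := norm_le_of_forall_abs_le (hd k)
      have h3 := norm_sub_le (d j) (d k)
      linarith
    obtain ⟨n, hn1, hn2⟩ := exists_nat_pow_near_of_lt_one (div_pos hpos hD₁pos)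
      ((div_le_one hD₁pos).2 hle) (by norm_num : (0 : ℝ) < 1 / 2) (by norm_num)
    have hst : ‖d j - d k‖ ≤ D₁ / 2 ^ n := by
      rw [div_le_iff₀ hD₁pos] at hn2
      rw [div_eq_mul_inv, mul_comm, ← inv_pow, ← one_div]
      exact hn2
    have h := chaining_of_neighbours (y := fun x => Y x ω) hFmono hu0.le hq0 hq1 hD₁pos.le
      hπ1 hπ2 hπ3 hinc ⟨j, rfl⟩ ⟨k, rfl⟩ hst
    have hqn : q ^ n ≤ (2 / D₁) ^ (κ / 2) * ‖d j - d k‖ ^ (κ / 2) := by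
      rw [← Real.mul_rpow (by positivity) hpos.le, hq, ← Real.rpow_natCast,
        ← Real.rpow_mul (by norm_num), mul_comm (κ / 2), Real.rpow_mul (by norm_num),
        Real.rpow_natCast]
      refine Real.rpow_le_rpow (by positivity) ?_ (by positivity)
      rw [pow_succ] at hn1
      have : 2 / D₁ * ‖d j - d k‖ = 2 * (‖d j - d k‖ / D₁) := by ring
      rw [this]
      linarith
    refine h.trans ?_
    have h2 : K ≤ max K (2 * c₀ ^ 2 * S) := le_max_left _ _
    have hpw : 0 ≤ ‖d j - d k‖ ^ (κ / 2) := by positivity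
    calc u * q ^ n * (1 + 2 / (1 - q))
        ≤ u * ((2 / D₁) ^ (κ / 2) * ‖d j - d k‖ ^ (κ / 2)) * (1 + 2 / (1 - q)) := by
          gcongr
      _ = K * u * ‖d j - d k‖ ^ (κ / 2) := by rw [hK]; ring
      _ ≤ _ := by gcongr
  have hn : ∀ n, P (⋃ a ∈ F n, ⋃ b ∈ F n, bad n a b) ≤
      ENNReal.ofReal (2 * c₀ ^ 2 * Real.exp (-(β / 2 * u ^ 2)) *
        (ρ ^ n * Real.exp (-(β / 2 * p ^ n)))) := by
    intro n
    calc P (⋃ a ∈ F n, ⋃ b ∈ F n, bad n a b)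
        ≤ ∑ a ∈ F n, ∑ b ∈ F n, P (bad n a b) :=
          (measure_biUnion_finset_le _ _).trans
            (Finset.sum_le_sum fun a _ => measure_biUnion_finset_le _ _)
      _ ≤ ∑ a ∈ F n, ∑ b ∈ F n, ENNReal.ofReal (2 * Real.exp (-(u ^ 2 * β * p ^ n))) :=
          Finset.sum_le_sum fun a ha => Finset.sum_le_sum fun b hb => hbadP n a ha b hb
      _ = ENNReal.ofReal ((F n).card * ((F n).card * (2 * Real.exp (-(u ^ 2 * β * p ^ n))))) := by
          rw [Finset.sum_const, Finset.sum_const, nsmul_eq_mul, nsmul_eq_mul,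
            ENNReal.ofReal_mul (p := ((F n).card : ℝ)) (by positivity),
            ENNReal.ofReal_mul (p := ((F n).card : ℝ)) (by positivity),
            ENNReal.ofReal_natCast]
      _ ≤ _ := by
          refine ENNReal.ofReal_le_ofReal ?_
          have hpn : 1 ≤ p ^ n := one_le_pow₀ hp1.le
          have hu2 : 1 ≤ u ^ 2 := one_le_pow₀ hu
          have h1 : Real.exp (-(u ^ 2 * β * p ^ n)) ≤
              Real.exp (-(β / 2 * u ^ 2)) * Real.exp (-(β / 2 * p ^ n)) := by
            rw [← Real.exp_add, Real.exp_le_exp]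
            have h2 : u ^ 2 + p ^ n ≤ 2 * (u ^ 2 * p ^ n) := by nlinarith
            nlinarith
          calc ((F n).card : ℝ) * ((F n).card * (2 * Real.exp (-(u ^ 2 * β * p ^ n))))
              ≤ (c₀ * (2 ^ (N + 1)) ^ n) * ((c₀ * (2 ^ (N + 1)) ^ n) *
                (2 * (Real.exp (-(β / 2 * u ^ 2)) * Real.exp (-(β / 2 * p ^ n))))) := by
                gcongr <;> exact hFcard n
            _ = _ := by rw [hρ, ← pow_mul (2 ^ (N + 1) : ℝ) 2 n, mul_comm 2 n, pow_mul]; ring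
  calc P _ ≤ P (⋃ n, ⋃ a ∈ F n, ⋃ b ∈ F n, bad n a b) := measure_mono hsub
    _ ≤ ∑' n, P (⋃ a ∈ F n, ⋃ b ∈ F n, bad n a b) := measure_iUnion_le _
    _ ≤ ∑' n, ENNReal.ofReal (2 * c₀ ^ 2 * Real.exp (-(β / 2 * u ^ 2)) *
        (ρ ^ n * Real.exp (-(β / 2 * p ^ n)))) := ENNReal.tsum_le_tsum hn
    _ = ENNReal.ofReal (2 * c₀ ^ 2 * S * Real.exp (-(β / 2 * u ^ 2))) := by
        rw [← ENNReal.ofReal_tsum_of_nonneg (fun n => by positivity) (hsum.mul_left _),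
          tsum_mul_left, ← hS]
        congr 1
        ring
    _ ≤ _ := by
        refine ENNReal.ofReal_le_ofReal ?_
        gcongr
        exact le_max_right _ _

end Chaining

/-! ### Gaussian tails -/

section GaussianTails

variable {Ω : Type*} [MeasurableSpace Ω] {P : Measure Ω} {Y : Ω → ℝ}

lemma variance_eq_of_centered (hY : HasGaussianLaw Y P) (h0 : ∫ ω, Y ω ∂P = 0) :
    Var[Y; P] = ∫ ω, Y ω ^ 2 ∂P :=
  variance_of_integral_eq_zero hY.aemeasurable h0

lemma hasSubgaussianMGF_of_centered (hY : HasGaussianLaw Y P) (h0 : ∫ ω, Y ω ∂P = 0) {v : ℝ}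
    (h2 : ∫ ω, Y ω ^ 2 ∂P ≤ v ^ 2) : HasSubgaussianMGF Y (v ^ 2).toNNReal P := by
  have hmap := hY.map_eq_gaussianReal
  rw [h0] at hmap
  refine ⟨fun t => ?_, fun t => ?_⟩
  · have h := integrable_exp_mul_gaussianReal (μ := 0) (v := Var[Y; P].toNNReal) t
    rw [← hmap] at h
    exact (integrable_map_measure (by fun_prop) hY.aemeasurable).1 h
  · rw [mgf_gaussianReal hmap, zero_mul, zero_add, Real.exp_le_exp,
      variance_eq_of_centered hY h0, Real.coe_toNNReal _ (integral_nonneg fun _ => sq_nonneg _),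
      Real.coe_toNNReal _ (sq_nonneg v)]
    have := mul_le_mul_of_nonneg_right h2 (sq_nonneg t)
    linarith

/-- The Gaussian tail bound. -/
lemma measure_le_abs_le (hY : HasGaussianLaw Y P) (h0 : ∫ ω, Y ω ∂P = 0) {v : ℝ}
    (h2 : ∫ ω, Y ω ^ 2 ∂P ≤ v ^ 2) {x : ℝ} (hx : 0 ≤ x) :
    P {ω | x ≤ |Y ω|} ≤ ENNReal.ofReal (2 * Real.exp (-(x ^ 2 / (2 * v ^ 2)))) := by
  have := hY.isProbabilityMeasure
  have h := hasSubgaussianMGF_of_centered hY h0 h2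
  have hb : ∀ Z : Ω → ℝ, HasSubgaussianMGF Z (v ^ 2).toNNReal P →
      P {ω | x ≤ Z ω} ≤ ENNReal.ofReal (Real.exp (-(x ^ 2 / (2 * v ^ 2)))) := by
    intro Z hZ
    have h1 := hZ.measure_ge_le hx
    rw [Real.coe_toNNReal _ (sq_nonneg v), neg_div] at h1
    rw [← ENNReal.ofReal_toReal (measure_ne_top P {ω | x ≤ Z ω})]
    exact ENNReal.ofReal_le_ofReal h1
  have hsub : {ω | x ≤ |Y ω|} ⊆ {ω | x ≤ Y ω} ∪ {ω | x ≤ (-Y) ω} := fun ω (hω : x ≤ |Y ω|) =>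
    (le_abs.1 hω : x ≤ Y ω ∨ x ≤ -Y ω)
  refine (measure_mono hsub).trans ((measure_union_le _ _).trans
    ((add_le_add (hb Y h) (hb (-Y) h.neg)).trans_eq ?_))
  rw [← ENNReal.ofReal_add (Real.exp_pos _).le (Real.exp_pos _).le, ← two_mul]

/-- A lower bound for the Gaussian tail, from the minimum of the density on `[x, x + 1]`. -/
lemma le_measure_le (hY : HasGaussianLaw Y P) (h0 : ∫ ω, Y ω ∂P = 0) {v : ℝ} (hv : 0 < v)
    (h2 : ∫ ω, Y ω ^ 2 ∂P = v ^ 2) {x : ℝ} (hx : 0 ≤ x) :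
    ENNReal.ofReal ((√(2 * Real.pi))⁻¹ * Real.exp (-((x + 1) ^ 2 / 2))) ≤ P {ω | v * x ≤ Y ω} := by
  have hmap := hY.map_eq_gaussianReal
  rw [h0, variance_eq_of_centered hY h0, h2] at hmap
  have h1 : gaussianReal 0 (v ^ 2).toNNReal = (gaussianReal 0 1).map (v * ·) := by
    rw [gaussianReal_map_const_mul, mul_zero, mul_one]
    congr 1
    exact Real.toNNReal_of_nonneg (sq_nonneg v)
  have h3 : P {ω | v * x ≤ Y ω} = gaussianReal 0 1 (Set.Ici x) := by
    have : {ω | v * x ≤ Y ω} = Y ⁻¹' Set.Ici (v * x) := rfl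
    rw [this, ← Measure.map_apply_of_aemeasurable hY.aemeasurable measurableSet_Ici, hmap, h1,
      Measure.map_apply (measurable_const_mul v) measurableSet_Ici]
    congr 1
    ext y
    simp [mul_le_mul_iff_right₀ hv]
  rw [h3]
  refine le_trans ?_ (measure_mono (Set.Icc_subset_Ici_self : Set.Icc x (x + 1) ⊆ Set.Ici x))
  rw [gaussianReal_apply _ one_ne_zero]
  calc ENNReal.ofReal ((√(2 * Real.pi))⁻¹ * Real.exp (-((x + 1) ^ 2 / 2)))
      = ∫⁻ _ in Set.Icc x (x + 1),
          ENNReal.ofReal ((√(2 * Real.pi))⁻¹ * Real.exp (-((x + 1) ^ 2 / 2))) := by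
        simp
    _ ≤ _ := by
        refine setLIntegral_mono' measurableSet_Icc fun y hy => ?_
        rw [gaussianPDF, gaussianPDFReal]
        refine ENNReal.ofReal_le_ofReal ?_
        simp only [NNReal.coe_one, mul_one, sub_zero, neg_div]
        gcongr
        · exact hx.trans hy.1
        · exact hy.2

end GaussianTails

/-! ### Continuity of Gaussian fields -/

section Field

variable {N : ℕ} {Ω : Type*} [MeasurableSpace Ω] {P : Measure Ω}

/-- `X` is a centered Gaussian field whose increments satisfy `E (X s - X t)² = σ (s - t)²`. -/
structure IsGaussianFieldWithStd (P : Measure Ω) (X : EuclideanSpace ℝ (Fin N) → Ω → ℝ)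
    (σ : EuclideanSpace ℝ (Fin N) → ℝ) : Prop where
  isGaussianProcess : IsGaussianProcess X P
  centered : ∀ t, ∫ ω, X t ω ∂P = 0
  increments : ∀ s t, ∫ ω, (X s ω - X t ω) ^ 2 ∂P = σ (s - t) ^ 2

variable {X : EuclideanSpace ℝ (Fin N) → Ω → ℝ} {σ : EuclideanSpace ℝ (Fin N) → ℝ}

lemma IsGaussianFieldWithStd.integral_sub (hX : IsGaussianFieldWithStd P X σ)
    (s t : EuclideanSpace ℝ (Fin N)) : ∫ ω, (X s ω - X t ω) ∂P = 0 := by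
  rw [MeasureTheory.integral_sub (hX.isGaussianProcess.hasGaussianLaw_eval s).integrable
    (hX.isGaussianProcess.hasGaussianLaw_eval t).integrable, hX.centered, hX.centered, sub_zero]

lemma IsGaussianFieldWithStd.measure_increment_le (hX : IsGaussianFieldWithStd P X σ)
    (hσ : ∀ t, 0 ≤ σ t) (s t : EuclideanSpace ℝ (Fin N)) {v : ℝ} (hv : σ (s - t) ≤ v) {x : ℝ}
    (hx : 0 ≤ x) :
    P {ω | x ≤ |X s ω - X t ω|} ≤ ENNReal.ofReal (2 * Real.exp (-(x ^ 2 / (2 * v ^ 2)))) :=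
  measure_le_abs_le hX.isGaussianProcess.hasGaussianLaw_fun_sub (hX.integral_sub s t)
    ((hX.increments s t).trans_le (pow_le_pow_left₀ (hσ _) hv 2)) hx

/-- A bound that holds along the values approximating a cluster value passes to the limit. -/
lemma abs_sub_le_of_mapClusterPt {α : Type*} {l : Filter α} {f g : α → ℝ} {y z c : ℝ}
    (hf : MapClusterPt y l f) (hg : Tendsto g l (𝓝 z)) (h : ∀ᶠ a in l, |f a - c| ≤ g a) :
    |y - c| ≤ z := by
  obtain ⟨U, hU, hlim⟩ := mapClusterPt_iff_ultrafilter.1 hf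
  exact le_of_tendsto_of_tendsto (hlim.sub_const c).abs (hg.mono_left hU) (hU h)

lemma ball_subset_cube (R : ℕ) :
    Metric.ball (0 : EuclideanSpace ℝ (Fin N)) R ⊆ cube N R := fun x hx i =>
  (Real.norm_eq_abs (x i) ▸ PiLp.norm_apply_le x i).trans (mem_ball_zero_iff.1 hx).le

/-- A Hölder bound on a separating set extends to all points of a ball. -/
lemma holder_of_mapClusterPt {f : EuclideanSpace ℝ (Fin N) → ℝ}
    {S : Set (EuclideanSpace ℝ (Fin N))} {R : ℕ} {K γ : ℝ} (hγ : 0 < γ)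
    (hf : ∀ t, MapClusterPt (f t) (𝓝[S] t) f)
    (h : ∀ a ∈ S ∩ cube N R, ∀ b ∈ S ∩ cube N R, |f a - f b| ≤ K * ‖a - b‖ ^ γ) :
    ∀ s ∈ Metric.ball (0 : EuclideanSpace ℝ (Fin N)) R,
      ∀ t ∈ Metric.ball (0 : EuclideanSpace ℝ (Fin N)) R, |f s - f t| ≤ K * ‖s - t‖ ^ γ := by
  have hmem : ∀ s ∈ Metric.ball (0 : EuclideanSpace ℝ (Fin N)) R,
      ∀ᶠ a in 𝓝[S] s, a ∈ S ∩ cube N R := by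
    intro s hs
    filter_upwards [self_mem_nhdsWithin,
      mem_nhdsWithin_of_mem_nhds (Metric.isOpen_ball.mem_nhds hs)] with a ha hb
    exact ⟨ha, ball_subset_cube R hb⟩
  have hlim : ∀ s b : EuclideanSpace ℝ (Fin N),
      Tendsto (fun a => K * ‖a - b‖ ^ γ) (𝓝[S] s) (𝓝 (K * ‖s - b‖ ^ γ)) := by
    intro s b
    have : Continuous fun a : EuclideanSpace ℝ (Fin N) => K * ‖a - b‖ ^ γ :=
      continuous_const.mul ((continuous_id.sub continuous_const).norm.rpow_const
        fun _ => Or.inr hγ.le)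
    exact (this.tendsto s).mono_left nhdsWithin_le_nhds
  have h1 : ∀ s ∈ Metric.ball (0 : EuclideanSpace ℝ (Fin N)) R, ∀ b ∈ S ∩ cube N R,
      |f s - f b| ≤ K * ‖s - b‖ ^ γ := fun s hs b hb =>
    abs_sub_le_of_mapClusterPt (hf s) (hlim s b) ((hmem s hs).mono fun a ha => h a ha b hb)
  intro s hs t ht
  rw [abs_sub_comm, norm_sub_rev]
  refine abs_sub_le_of_mapClusterPt (hf t) (hlim t s) ((hmem t ht).mono fun a ha => ?_)
  rw [abs_sub_comm, norm_sub_rev]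
  exact h1 s hs a ha

lemma norm_sub_le_of_mem_cube {R : ℕ} {a b : EuclideanSpace ℝ (Fin N)} (ha : a ∈ cube N R)
    (hb : b ∈ cube N R) : ‖a - b‖ ≤ 2 * (N * R) := by
  have h1 := norm_le_of_forall_abs_le ha
  have h2 := norm_le_of_forall_abs_le hb
  linarith [norm_sub_le a b]

/-- The chaining bound for all fields whose increments have a given Hölder continuous standard
deviation. -/
lemma exists_chaining_tail_of_std (P : Measure Ω) {κ : ℝ} (hκ : 0 < κ) (hσ : ∀ t, 0 ≤ σ t)
    (hH : ∀ R : ℝ, ∃ A > 0, ∀ t, ‖t‖ ≤ R → σ t ≤ A * ‖t‖ ^ κ) (R : ℕ) :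
    ∃ C > 0, ∃ α > 0, ∀ Y : EuclideanSpace ℝ (Fin N) → Ω → ℝ, IsGaussianFieldWithStd P Y σ →
      ∀ d : ℕ → EuclideanSpace ℝ (Fin N), (∀ k, d k ∈ cube N R) → ∀ u : ℝ, 1 ≤ u →
        P {ω | ¬ ∀ j k, |Y (d j) ω - Y (d k) ω| ≤ C * u * ‖d j - d k‖ ^ (κ / 2)} ≤
          ENNReal.ofReal (C * Real.exp (-(α * u ^ 2))) := by
  obtain ⟨A, hA, hb⟩ := hH (2 * (N * R))
  obtain ⟨C, hC, α, hα, h⟩ := exists_chaining_tail P hκ hA N R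
  refine ⟨C, hC, α, hα, fun Y hY => h Y fun a ha b hb' v _ hv x hx => ?_⟩
  exact hY.measure_increment_le hσ a b ((hb _ (norm_sub_le_of_mem_cube ha hb')).trans hv) hx

/-- A separable Gaussian field with Hölder continuous standard deviation has almost surely
continuous paths. -/
theorem IsGaussianFieldWithStd.ae_continuous (hX : IsGaussianFieldWithStd P X σ)
    (hsep : IsSeparableField P X) {κ : ℝ} (hκ : 0 < κ) (hσ : ∀ t, 0 ≤ σ t)
    (hH : ∀ R : ℝ, ∃ A > 0, ∀ t, ‖t‖ ≤ R → σ t ≤ A * ‖t‖ ^ κ) :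
    ∀ᵐ ω ∂P, Continuous fun t => X t ω := by
  obtain ⟨S, hS, hcl⟩ := hsep
  have hR : ∀ R : ℕ, ∀ᵐ ω ∂P, ∃ K : ℝ, ∀ a ∈ S ∩ cube N R, ∀ b ∈ S ∩ cube N R,
      |X a ω - X b ω| ≤ K * ‖a - b‖ ^ (κ / 2) := by
    intro R
    rcases (S ∩ cube N R).eq_empty_or_nonempty with he | hne
    · exact ae_of_all _ fun ω => ⟨0, by simp [he]⟩
    obtain ⟨d, hd⟩ := (hS.mono Set.inter_subset_left : (S ∩ cube N R).Countable).exists_eq_range hne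
    obtain ⟨C, hC, α, hα, hb⟩ := exists_chaining_tail_of_std P hκ hσ hH R
    have hbu := hb X hX d fun k => (hd ▸ Set.mem_range_self k : d k ∈ S ∩ cube N R).2
    have hz : P {ω | ∀ n : ℕ, ¬ ∀ j k,
        |X (d j) ω - X (d k) ω| ≤ C * (n + 1 : ℕ) * ‖d j - d k‖ ^ (κ / 2)} = 0 := by
      have hlim : Tendsto
          (fun n : ℕ => ENNReal.ofReal (C * Real.exp (-(α * ((n + 1 : ℕ) : ℝ) ^ 2))))
          atTop (𝓝 0) := by
        rw [← ENNReal.ofReal_zero, ← mul_zero C]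
        refine ENNReal.tendsto_ofReal (Tendsto.const_mul _ ?_)
        refine Real.tendsto_exp_neg_atTop_nhds_zero.comp (Tendsto.const_mul_atTop hα ?_)
        exact (tendsto_pow_atTop two_ne_zero).comp
          (tendsto_natCast_atTop_atTop.comp (tendsto_add_atTop_nat 1))
      refine le_antisymm (ge_of_tendsto' hlim fun n => ?_) zero_le
      have hu : (1 : ℝ) ≤ (n + 1 : ℕ) := by exact_mod_cast Nat.succ_le_succ (Nat.zero_le n)
      refine le_trans (measure_mono ?_) (hbu _ hu)
      exact fun ω hω => hω n
    filter_upwards [measure_eq_zero_iff_ae_notMem.1 hz] with ω hω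
    obtain ⟨n, hn⟩ := not_forall.1 hω
    rw [not_not] at hn
    refine ⟨C * (n + 1 : ℕ), fun a ha b hb => ?_⟩
    rw [hd] at ha hb
    obtain ⟨j, rfl⟩ := ha
    obtain ⟨k, rfl⟩ := hb
    exact hn j k
  filter_upwards [hcl, ae_all_iff.2 hR] with ω hω hHol
  rw [continuous_iff_continuousAt]
  intro s
  obtain ⟨R, hRs⟩ := exists_nat_gt ‖s‖
  obtain ⟨K, hK⟩ := hHol R
  have hb := holder_of_mapClusterPt (by positivity : 0 < κ / 2) hω hK
  have hs : s ∈ Metric.ball (0 : EuclideanSpace ℝ (Fin N)) R := mem_ball_zero_iff.2 hRs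
  rw [ContinuousAt, tendsto_iff_norm_sub_tendsto_zero]
  have hlim : Tendsto (fun t : EuclideanSpace ℝ (Fin N) => K * ‖t - s‖ ^ (κ / 2)) (𝓝 s) (𝓝 0) := by
    have : Continuous fun a : EuclideanSpace ℝ (Fin N) => K * ‖a - s‖ ^ (κ / 2) :=
      continuous_const.mul ((continuous_id.sub continuous_const).norm.rpow_const
        fun _ => Or.inr (by positivity))
    have h0 := this.tendsto s
    rwa [sub_self, norm_zero, Real.zero_rpow (by positivity), mul_zero] at h0
  refine squeeze_zero' (Eventually.of_forall fun _ => norm_nonneg _) ?_ hlim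
  filter_upwards [Metric.isOpen_ball.mem_nhds hs] with t ht
  exact hb t ht s hs

end Field

/-! ### The field as an isonormal process -/

section Representation

variable {N : ℕ} {Ω : Type*} [MeasurableSpace Ω] {P : Measure Ω}
  {E : Matrix (Fin N) (Fin N) ℝ} {ψ : EuclideanSpace ℝ (Fin N) → ℝ}
  {X : EuclideanSpace ℝ (Fin N) → Ω → ℝ}

lemma isHermitianL2_kernel (hψ : ∀ x, ψ (-x) = ψ x) {t : EuclideanSpace ℝ (Fin N)}
    (hk : MemLp (harmonizableKernel E ψ t) 2 volume) :
    IsHermitianL2 (harmonizableKernel E ψ t) :=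
  ⟨hk, kernel_neg_right hψ t⟩

/-- A harmonizable field is the image of its kernels under an isonormal process; in particular
the kernels are square-integrable. -/
lemma IsHarmonizableField.exists_isIsonormal (hX : IsHarmonizableField P E ψ X) :
    (∀ t, MemLp (harmonizableKernel E ψ t) 2 volume) ∧
      ∃ W : (EuclideanSpace ℝ (Fin N) → ℂ) → Ω → ℝ, IsIsonormal P W ∧
        ∀ t, X t =ᵐ[P] W (harmonizableKernel E ψ t) := by
  obtain ⟨M, hM, h⟩ := hX
  choose Y hY hXY using h
  obtain ⟨W, hW, hWY⟩ := OSGauss.exists_isIsonormal hM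
  exact ⟨fun t => (hY t).memLp, W, hW, fun t => EventuallyEq.trans (hXY t) (hWY _ _ (hY t)).symm⟩

variable {W : (EuclideanSpace ℝ (Fin N) → ℂ) → Ω → ℝ}

lemma IsIsonormal.memLp (hW : IsIsonormal P W) (f : EuclideanSpace ℝ (Fin N) → ℂ) :
    MemLp (W f) 2 P :=
  (hW.isGaussianProcess.hasGaussianLaw_eval f).memLp_two

lemma IsIsonormal.integrable (hW : IsIsonormal P W) (f : EuclideanSpace ℝ (Fin N) → ℂ) :
    Integrable (W f) P :=
  (hW.isGaussianProcess.hasGaussianLaw_eval f).integrable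

lemma IsIsonormal.integral_sq (hW : IsIsonormal P W) {f : EuclideanSpace ℝ (Fin N) → ℂ}
    (hf : IsHermitianL2 f) : ∫ ω, W f ω ^ 2 ∂P = (eLpNorm f 2 volume).toReal ^ 2 := by
  rw [eLpNorm_two_toReal_sq hf.memLp]
  simp_rw [pow_two (W f _)]
  rw [hW.covariance f f hf hf]
  refine integral_congr_ae (ae_of_all _ fun ξ => ?_)
  simp only [Complex.mul_conj, Complex.ofReal_re, Complex.normSq_eq_norm_sq]

lemma integral_sub_two_mul_add {α : Type*} [MeasurableSpace α] {μ : Measure α} {a b c : α → ℝ}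
    (ha : Integrable a μ) (hb : Integrable b μ) (hc : Integrable c μ) :
    ∫ x, (a x - 2 * b x + c x) ∂μ = ∫ x, a x ∂μ - 2 * ∫ x, b x ∂μ + ∫ x, c x ∂μ := by
  have h2 : Integrable (fun x => a x - 2 * b x) μ := ha.sub (hb.const_mul 2)
  rw [integral_add h2 hc, integral_sub ha (hb.const_mul 2), integral_const_mul]

lemma IsIsonormal.integral_sub_sq (hW : IsIsonormal P W) {f g : EuclideanSpace ℝ (Fin N) → ℂ}
    (hf : IsHermitianL2 f) (hg : IsHermitianL2 g) :
    ∫ ω, (W f ω - W g ω) ^ 2 ∂P = (eLpNorm (f - g) 2 volume).toReal ^ 2 := by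
  have hi : ∀ {a b : EuclideanSpace ℝ (Fin N) → ℂ}, IsHermitianL2 a → IsHermitianL2 b →
      Integrable (fun ξ => (a ξ * (starRingEnd ℂ) (b ξ)).re) volume := fun ha hb =>
    (ha.memLp.integrable_mul hb.memLp.star).re
  have hj : ∀ a b, Integrable (fun ω => W a ω * W b ω) P := fun a b =>
    (hW.memLp a).integrable_mul (hW.memLp b)
  have h1 : ∀ ω, (W f ω - W g ω) ^ 2 = W f ω * W f ω - 2 * (W f ω * W g ω) + W g ω * W g ω :=
    fun ω => by ring
  simp_rw [h1]
  rw [integral_sub_two_mul_add (hj f f) (hj f g) (hj g g), hW.covariance f f hf hf,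
    hW.covariance f g hf hg, hW.covariance g g hg hg, eLpNorm_two_toReal_sq (hf.memLp.sub hg.memLp),
    ← integral_sub_two_mul_add (hi hf hf) (hi hf hg) (hi hg hg)]
  refine integral_congr_ae (ae_of_all _ fun ξ => ?_)
  simp only [Pi.sub_apply, ← Complex.normSq_eq_norm_sq, Complex.normSq_apply, Complex.sub_re,
    Complex.sub_im, Complex.mul_re, Complex.conj_re, Complex.conj_im]
  ring

/-- A harmonizable field is Gaussian with stationary increments. -/
lemma IsHarmonizableField.isGaussianFieldWithStd (hX : IsHarmonizableField P E ψ X)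
    (hψ : ∀ x, ψ (-x) = ψ x) : IsGaussianFieldWithStd P X (fieldStd E ψ) := by
  obtain ⟨hk, W, hW, hXW⟩ := hX.exists_isIsonormal
  refine ⟨(hW.isGaussianProcess.comp_right (harmonizableKernel E ψ)).congr fun t => (hXW t).symm,
    fun t => by rw [integral_congr_ae (hXW t), hW.centered], fun s t => ?_⟩
  have h1 : ∫ ω, (X s ω - X t ω) ^ 2 ∂P =
      ∫ ω, (W (harmonizableKernel E ψ s) ω - W (harmonizableKernel E ψ t) ω) ^ 2 ∂P := by
    refine integral_congr_ae ?_
    filter_upwards [hXW s, hXW t] with ω hs ht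
    rw [hs, ht]
  rw [h1, hW.integral_sub_sq (isHermitianL2_kernel hψ (hk s)) (isHermitianL2_kernel hψ (hk t)),
    fieldStd, ← eLpNorm_character_mul_kernel (s - t) t]
  congr 3
  exact funext fun ξ => kernel_sub_kernel s t ξ

end Representation

/-! ### The iterated logarithm -/

section LogLog

lemma one_le_loglog (x : ℝ) : 1 ≤ loglog x := by
  rw [loglog, Real.le_log_iff_exp_le (lt_max_of_lt_right (Real.exp_pos _))]
  exact le_max_right _ _

lemma loglog_mono {x y : ℝ} (hx : 0 < x) (hxy : x ≤ y) : loglog x ≤ loglog y :=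
  Real.log_le_log (lt_max_of_lt_right (Real.exp_pos _))
    (max_le_max (Real.log_le_log hx hxy) le_rfl)

lemma log_le_loglog_two_pow (n : ℕ) {x : ℝ} (hx : 2 ^ n ≤ x) :
    Real.log (n + 1) ≤ 3 * loglog x := by
  have h1 := one_le_loglog x
  have h2 : (0 : ℝ) < max (Real.log x) (Real.exp 1) := lt_max_of_lt_right (Real.exp_pos _)
  have h3 : n * Real.log 2 ≤ Real.log x := by
    rw [← Real.log_pow]
    exact Real.log_le_log (by positivity) hx
  have h4 : (n + 1 : ℝ) ≤ 4 * max (Real.log x) (Real.exp 1) := by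
    have := Real.log_two_gt_d9
    have h5 := le_max_left (Real.log x) (Real.exp 1)
    have h6 := le_max_right (Real.log x) (Real.exp 1)
    have h7 := Real.add_one_le_exp (1 : ℝ)
    have h8 : (0 : ℝ) ≤ n := n.cast_nonneg
    nlinarith
  calc Real.log (n + 1) ≤ Real.log (4 * max (Real.log x) (Real.exp 1)) :=
        Real.log_le_log (by positivity) h4
    _ = Real.log 4 + loglog x := Real.log_mul (by norm_num) h2.ne'
    _ ≤ 3 * loglog x := by
        have : Real.log 4 = 2 * Real.log 2 := by
          rw [show (4 : ℝ) = 2 ^ 2 by norm_num, Real.log_pow]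
          norm_num
        have := Real.log_two_lt_d9
        linarith

end LogLog

/-! ### The upper bound at the origin -/

section UpperBound

variable {N : ℕ} {Ω : Type*} [MeasurableSpace Ω] {P : Measure Ω}
  {E : Matrix (Fin N) (Fin N) ℝ} {ψ : EuclideanSpace ℝ (Fin N) → ℝ}
  {X : EuclideanSpace ℝ (Fin N) → Ω → ℝ} {ν : Seminorm ℝ (EuclideanSpace ℝ (Fin N))}

/-- Operator self-similarity of the increments: `c⁻¹ X (c ^ E t)` has the same standard deviation
function as `X`. -/
lemma IsGaussianFieldWithStd.rescale (hX : IsGaussianFieldWithStd P X (fieldStd E ψ))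
    (hψ : IsSymmHomogeneous E.transpose ψ) {c : ℝ} (hc : 0 < c) :
    IsGaussianFieldWithStd P (fun t ω => c⁻¹ * X (opPow E c t) ω) (fieldStd E ψ) := by
  refine ⟨(hX.isGaussianProcess.comp_right (opPow E c)).smul fun _ => c⁻¹, fun t => ?_,
    fun s t => ?_⟩
  · rw [integral_const_mul, hX.centered, mul_zero]
  · have h1 : ∀ ω, (c⁻¹ * X (opPow E c s) ω - c⁻¹ * X (opPow E c t) ω) ^ 2 =
        (c⁻¹) ^ 2 * (X (opPow E c s) ω - X (opPow E c t) ω) ^ 2 := fun ω => by ring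
    simp_rw [h1]
    rw [integral_const_mul, hX.increments, ← map_sub, fieldStd_opPow hψ hc, mul_pow, ← mul_assoc,
      ← mul_pow, inv_mul_cancel₀ hc.ne', one_pow, one_mul]

/-- A continuous function is separated by every dense set. -/
lemma mapClusterPt_of_dense {f : EuclideanSpace ℝ (Fin N) → ℝ} (hf : Continuous f)
    {S : Set (EuclideanSpace ℝ (Fin N))} (hS : Dense S) (t : EuclideanSpace ℝ (Fin N)) :
    MapClusterPt (f t) (𝓝[S] t) f := by
  have : NeBot (𝓝[S] t) := mem_closure_iff_nhdsWithin_neBot.1 (hS t)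
  exact ((hf.tendsto t).mono_left nhdsWithin_le_nhds).mapClusterPt

/-- The almost sure upper bound for the local modulus of continuity at the origin: the chaining
bound is applied to the rescaled fields `2 ^ n X ((2 ^ {-n}) ^ E t)` on a fixed cube, with
thresholds of order `√(log n)`. -/
theorem exists_localModulus_le (hN : 0 < N) (hν : IsPolarNorm E ν)
    (hψ : IsSymmHomogeneous E.transpose ψ)
    (hk : ∀ t, MemLp (harmonizableKernel E ψ t) 2 volume)
    (hX : IsGaussianFieldWithStd P X (fieldStd E ψ))
    (hcont : ∀ᵐ ω ∂P, Continuous fun t => X t ω) :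
    ∃ C : ℝ, ∀ᵐ ω ∂P, ∃ r > 0,
      localModulus (radial E ν) (fun t => X t ω) 0 r ≤ ENNReal.ofReal C := by
  obtain ⟨κ, hκ, hH⟩ := exists_fieldStd_le_rpow hψ hk
  obtain ⟨c₁, hc₁, C₁, hC₁, hcomp⟩ := exists_fieldStd_comparable hN hν hψ hk
  -- a cube that contains the unit ball of the radial part
  obtain ⟨R₀, hR₀, hR₀b⟩ := exists_norm_le_of_fieldStd_le hN hψ hk C₁
  obtain ⟨R, hR⟩ := exists_nat_gt R₀
  have hRpos : (0 : ℝ) < R := hR₀.trans hR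
  have hball : ∀ s, radial E ν s ≤ 1 → s ∈ Metric.ball (0 : EuclideanSpace ℝ (Fin N)) R := by
    intro s hs
    refine mem_ball_zero_iff.2 ((hR₀b s ((hcomp s).2.trans ?_)).trans_lt hR)
    exact mul_le_of_le_one_right hC₁.le hs
  obtain ⟨C, hC, α, hα, hb⟩ := exists_chaining_tail_of_std P hκ fieldStd_nonneg hH R
  let S : Set (EuclideanSpace ℝ (Fin N)) :=
    insert 0 (Set.range (TopologicalSpace.denseSeq (EuclideanSpace ℝ (Fin N))))
  have hSd : Dense S := (TopologicalSpace.denseRange_denseSeq _).mono (Set.subset_insert _ _)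
  have hSc : S.Countable := (Set.countable_range _).insert 0
  have hne : (S ∩ cube N R).Nonempty := ⟨0, Set.mem_insert _ _, fun i => by simp⟩
  obtain ⟨d, hd⟩ := (hSc.mono Set.inter_subset_left : (S ∩ cube N R).Countable).exists_eq_range hne
  -- with this threshold the exceptional probabilities are `O(n ^ {-2})`
  set u : ℕ → ℝ := fun n => √(1 + 2 / α * Real.log (n + 1)) with hu
  have hlog : ∀ n : ℕ, 0 ≤ Real.log (n + 1) := fun n => Real.log_nonneg (by
    have : (0 : ℝ) ≤ n := n.cast_nonneg
    linarith)
  have hu1 : ∀ n, 1 ≤ u n := fun n => by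
    rw [hu, Real.one_le_sqrt]
    have := hlog n
    have : 0 ≤ 2 / α * Real.log (n + 1) := by positivity
    linarith
  have husq : ∀ n, u n ^ 2 = 1 + 2 / α * Real.log (n + 1) := fun n =>
    Real.sq_sqrt (by have := hlog n; positivity)
  let c : ℕ → ℝ := fun n => (1 / 2 : ℝ) ^ n
  have hc : ∀ n, 0 < c n := fun n => by positivity
  let Y : ℕ → EuclideanSpace ℝ (Fin N) → Ω → ℝ := fun n t ω => (c n)⁻¹ * X (opPow E (c n) t) ω
  have hbad : P {ω | ∃ᶠ n in atTop, ¬ ∀ j k,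
      |Y n (d j) ω - Y n (d k) ω| ≤ C * u n * ‖d j - d k‖ ^ (κ / 2)} = 0 := by
    refine measure_setOfPred_frequently_eq_zero (ne_top_of_le_ne_top ?_
      (ENNReal.tsum_le_tsum fun n => hb (Y n) (hX.rescale hψ (hc n)) d
        (fun k => (hd ▸ Set.mem_range_self k : d k ∈ S ∩ cube N R).2) (u n) (hu1 n)))
    have hsum : Summable fun n : ℕ => C * Real.exp (-(α * u n ^ 2)) := by
      have h1 : ∀ n : ℕ,
          Real.exp (-(α * u n ^ 2)) = Real.exp (-α) * (1 / ((n + 1 : ℕ) : ℝ) ^ 2) := by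
        intro n
        have h0 : (0 : ℝ) < (n + 1 : ℕ) := by positivity
        rw [husq, show -(α * (1 + 2 / α * Real.log (n + 1))) =
          -α + -(2 * Real.log ((n + 1 : ℕ) : ℝ)) by push_cast; field_simp; ring, Real.exp_add,
          Real.exp_neg (2 * _), two_mul, Real.exp_add, Real.exp_log h0, pow_two, one_div]
      simp_rw [h1]
      exact ((summable_nat_add_iff 1).2
        (Real.summable_one_div_nat_pow.2 one_lt_two)).mul_left _ |>.mul_left C
    rw [← ENNReal.ofReal_tsum_of_nonneg (fun n => by positivity) hsum]
    exact ENNReal.ofReal_ne_top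
  refine ⟨2 * C * √(1 + 6 / α) * (R : ℝ) ^ (κ / 2), ?_⟩
  filter_upwards [measure_eq_zero_iff_ae_notMem.1 hbad, hcont] with ω hω hcω
  have hev : ∀ᶠ n in atTop, ∀ j k,
      |Y n (d j) ω - Y n (d k) ω| ≤ C * u n * ‖d j - d k‖ ^ (κ / 2) := by
    have h1 := not_frequently.1 hω
    filter_upwards [h1] with n hn
    exact not_not.1 hn
  obtain ⟨n₀, hn₀⟩ := eventually_atTop.1 hev
  refine ⟨c n₀, hc n₀, iSup₂_le fun s hs => ENNReal.ofReal_le_ofReal ?_⟩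
  obtain ⟨hs0, hsr⟩ : s ≠ 0 ∧ radial E ν (s - 0) ≤ c n₀ := hs
  rw [sub_zero] at hsr ⊢
  have hτ := radial_pos hν hs0
  set r := radial E ν s with hr
  have hr1 : r ≤ 1 := hsr.trans (pow_le_one₀ (by norm_num) (by norm_num))
  obtain ⟨n, hn1, hn2⟩ := exists_nat_pow_near_of_lt_one hτ hr1 (by norm_num : (0 : ℝ) < 1 / 2)
    (by norm_num)
  have hnn : n₀ ≤ n := by
    by_contra! hlt
    have : (1 / 2 : ℝ) ^ n₀ ≤ (1 / 2) ^ (n + 1) :=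
      pow_le_pow_of_le_one (by norm_num) (by norm_num) hlt
    exact absurd (hsr.trans this) (not_le.2 hn1)
  -- `s = (c n) ^ E x` with `1 / 2 < radial x ≤ 1`
  have hcY : Continuous fun t => Y n t ω :=
    continuous_const.mul (hcω.comp (continuous_opPow E (c n)))
  have hHol := holder_of_mapClusterPt (f := fun t => Y n t ω) (by positivity : 0 < κ / 2)
    (mapClusterPt_of_dense hcY hSd) (S := S) (R := R) (K := C * u n) (by
      intro a ha b hb
      rw [hd] at ha hb
      obtain ⟨j, rfl⟩ := ha
      obtain ⟨k, rfl⟩ := hb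
      exact hn₀ n hnn j k)
  set x := opPow E (c n)⁻¹ s with hx
  have hxs : opPow E (c n) x = s := opPow_opPow_inv E (hc n) s
  have hxr : radial E ν x ≤ 1 := by
    rw [hx, radial_opPow hν (inv_pos.2 (hc n)) hs0, inv_mul_le_iff₀ (hc n), mul_one]
    exact hn2
  have h0 : (0 : EuclideanSpace ℝ (Fin N)) ∈ Metric.ball (0 : EuclideanSpace ℝ (Fin N)) R :=
    Metric.mem_ball_self hRpos
  have h1 := hHol x (hball x hxr) 0 h0
  simp only [Y, hxs, map_zero, sub_zero] at h1
  rw [← mul_sub, abs_mul, abs_of_pos (inv_pos.2 (hc n)), inv_mul_le_iff₀ (hc n)] at h1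
  have hxn : ‖x‖ ^ (κ / 2) ≤ (R : ℝ) ^ (κ / 2) :=
    Real.rpow_le_rpow (norm_nonneg _) (mem_ball_zero_iff.1 (hball x hxr)).le (by positivity)
  have hll := one_le_loglog (1 + r⁻¹)
  have hun : u n ≤ √(1 + 6 / α) * √(loglog (1 + r⁻¹)) := by
    rw [← Real.sqrt_mul (by positivity)]
    refine Real.sqrt_le_sqrt ?_
    have h2 : Real.log (n + 1) ≤ 3 * loglog (1 + r⁻¹) := by
      refine log_le_loglog_two_pow n ?_
      have h3 : (2 : ℝ) ^ n = ((1 / 2 : ℝ) ^ n)⁻¹ := by rw [one_div, inv_pow, inv_inv]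
      have h4 : ((1 / 2 : ℝ) ^ n)⁻¹ ≤ r⁻¹ := inv_anti₀ hτ hn2
      linarith
    have h5 : 2 / α * Real.log (n + 1) ≤ 2 / α * (3 * loglog (1 + r⁻¹)) :=
      mul_le_mul_of_nonneg_left h2 (by positivity)
    have h6 : 2 / α * (3 * loglog (1 + r⁻¹)) = 6 / α * loglog (1 + r⁻¹) := by ring
    linarith
  rw [div_le_iff₀ (by positivity)]
  have hcn : c n ≤ 2 * r := by
    have : c n = 2 * (1 / 2) ^ (n + 1) := by simp only [c]; ring
    linarith
  have hun0 : 0 ≤ u n := zero_le_one.trans (hu1 n)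
  calc |X s ω - X 0 ω| ≤ c n * (C * u n * ‖x‖ ^ (κ / 2)) := h1
    _ ≤ 2 * r * (C * (√(1 + 6 / α) * √(loglog (1 + r⁻¹))) * (R : ℝ) ^ (κ / 2)) := by gcongr
    _ = _ := by ring

end UpperBound

/-! ### Laws of Gaussian families and the zero-one law -/

section ZeroOne

variable {Ω D : Type*}

/-- The finite linear combination `∑ v s * z s` of a family of random variables. -/
noncomputable def linComb (z : D → Ω → ℝ) (v : D →₀ ℝ) (ω : Ω) : ℝ :=
  Finsupp.linearCombination ℝ (fun s => z s ω) v

lemma linComb_eq_sum (z : D → Ω → ℝ) (v : D →₀ ℝ) (ω : Ω) :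
    linComb z v ω = ∑ s ∈ v.support, v s * z s ω := by
  rw [linComb, Finsupp.linearCombination_apply, Finsupp.sum]
  rfl

lemma linComb_single (z : D → Ω → ℝ) (s : D) (ω : Ω) :
    linComb z (Finsupp.single s 1) ω = z s ω := by
  simp [linComb]

variable [MeasurableSpace Ω] {P : Measure Ω}

lemma measurable_linComb {z : D → Ω → ℝ} (hz : ∀ s, Measurable (z s)) (v : D →₀ ℝ) :
    Measurable (linComb z v) := by
  rw [show linComb z v = fun ω => ∑ s ∈ v.support, v s * z s ω from
    funext fun ω => linComb_eq_sum z v ω]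
  exact Finset.measurable_sum _ fun s _ => (hz s).const_mul _

lemma isGaussianProcess_linComb {z : D → Ω → ℝ} (hz : IsGaussianProcess z P) :
    IsGaussianProcess (linComb z) P := by
  refine hz.of_isGaussianProcess fun v =>
    ⟨v.support, ∑ s : v.support, v s • ContinuousLinearMap.proj s, fun ω => ?_⟩
  rw [linComb_eq_sum, ← Finset.sum_coe_sort]
  simp

lemma memLp_linComb {z : D → Ω → ℝ} (hz : IsGaussianProcess z P) (v : D →₀ ℝ) :
    MemLp (linComb z v) 2 P :=
  ((isGaussianProcess_linComb hz).hasGaussianLaw_eval v).memLp_two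

lemma integral_linComb {z : D → Ω → ℝ} (hz : IsGaussianProcess z P)
    (h0 : ∀ s, ∫ ω, z s ω ∂P = 0) (v : D →₀ ℝ) : ∫ ω, linComb z v ω ∂P = 0 := by
  simp_rw [linComb_eq_sum]
  rw [integral_finsetSum _ fun s _ => (hz.hasGaussianLaw_eval s).integrable.const_mul _]
  refine Finset.sum_eq_zero fun s _ => ?_
  rw [integral_const_mul, h0, mul_zero]

lemma integral_linComb_sq {z : D → Ω → ℝ} (hz : IsGaussianProcess z P) (v : D →₀ ℝ) :
    ∫ ω, linComb z v ω ^ 2 ∂P =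
      ∑ s ∈ v.support, ∑ t ∈ v.support, v s * v t * ∫ ω, z s ω * z t ω ∂P := by
  have hi : ∀ s t, Integrable (fun ω => z s ω * z t ω) P := fun s t =>
    (hz.hasGaussianLaw_eval s).memLp_two.integrable_mul (hz.hasGaussianLaw_eval t).memLp_two
  have h1 : ∀ ω, linComb z v ω ^ 2 =
      ∑ s ∈ v.support, ∑ t ∈ v.support, v s * v t * (z s ω * z t ω) := fun ω => by
    rw [linComb_eq_sum, pow_two, Finset.sum_mul_sum]
    exact Finset.sum_congr rfl fun s _ => Finset.sum_congr rfl fun t _ => by ring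
  simp_rw [h1]
  rw [integral_finsetSum _ fun s _ => integrable_finsetSum _ fun t _ => (hi s t).const_mul _]
  refine Finset.sum_congr rfl fun s _ => ?_
  rw [integral_finsetSum _ fun t _ => (hi s t).const_mul _]
  exact Finset.sum_congr rfl fun t _ => integral_const_mul _ _

/-- The law of a family of random variables is determined by the laws of its finite linear
combinations. -/
lemma map_eq_of_linComb {μ μ' : Measure Ω} [IsFiniteMeasure μ] [IsFiniteMeasure μ']
    {z z' : D → Ω → ℝ} (hz : ∀ s, Measurable (z s)) (hz' : ∀ s, Measurable (z' s))
    (h : ∀ v, μ.map (linComb z v) = μ'.map (linComb z' v)) :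
    μ.map (fun ω s => z s ω) = μ'.map (fun ω s => z' s ω) := by
  have hZ : Measurable fun ω s => z s ω := measurable_pi_lambda _ hz
  have hZ' : Measurable fun ω s => z' s ω := measurable_pi_lambda _ hz'
  have hfin : ∀ I : Finset D, (μ.map (fun ω s => z s ω)).map I.restrict =
      (μ'.map (fun ω s => z' s ω)).map I.restrict := by
    classical
    intro I
    refine Measure.ext_of_charFunDual (funext fun L => ?_)
    rw [charFunDual_eq_charFun_map_one, charFunDual_eq_charFun_map_one,
      Measure.map_map (Finset.measurable_restrict I) hZ,
      Measure.map_map (Finset.measurable_restrict I) hZ',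
      Measure.map_map L.continuous.measurable ((Finset.measurable_restrict I).comp hZ),
      Measure.map_map L.continuous.measurable ((Finset.measurable_restrict I).comp hZ')]
    have hL : ∀ y : D → Ω → ℝ, L ∘ I.restrict ∘ (fun ω s => y s ω) =
        linComb y (∑ i : I, Finsupp.single i.1 (L (Pi.single i 1))) := by
      intro y
      funext ω
      rw [linComb, map_sum]
      simp only [Finsupp.linearCombination_single, Function.comp_apply]
      have h1 : I.restrict (fun s => y s ω) = ∑ i : I, y i ω • Pi.single i (1 : ℝ) := by
        funext j
        simp [Finset.sum_apply, Pi.single_apply]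
      rw [h1, map_sum]
      refine Finset.sum_congr rfl fun i _ => ?_
      rw [map_smul, smul_eq_mul, smul_eq_mul, mul_comm]
    rw [hL z, hL z', h]
  exact IsProjectiveLimit.unique (P := fun I => (μ'.map (fun ω s => z' s ω)).map I.restrict)
    hfin fun I => rfl

/-- Centered Gaussian families with the same covariance have the same law. -/
theorem map_eq_of_covariance [IsFiniteMeasure P] {z z' : D → Ω → ℝ} (hz : ∀ s, Measurable (z s))
    (hz' : ∀ s, Measurable (z' s)) (hG : IsGaussianProcess z P) (hG' : IsGaussianProcess z' P)
    (h0 : ∀ s, ∫ ω, z s ω ∂P = 0) (h0' : ∀ s, ∫ ω, z' s ω ∂P = 0)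
    (hcov : ∀ s t, ∫ ω, z s ω * z t ω ∂P = ∫ ω, z' s ω * z' t ω ∂P) :
    P.map (fun ω s => z s ω) = P.map (fun ω s => z' s ω) := by
  refine map_eq_of_linComb hz hz' fun v => ?_
  have h := (isGaussianProcess_linComb hG).hasGaussianLaw_eval v
  have h' := (isGaussianProcess_linComb hG').hasGaussianLaw_eval v
  have e := integral_linComb hG h0 v
  have e' := integral_linComb hG' h0' v
  rw [h.map_eq_gaussianReal, h'.map_eq_gaussianReal, variance_eq_of_centered h e,
    variance_eq_of_centered h' e', e, e', integral_linComb_sq hG, integral_linComb_sq hG']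
  simp_rw [hcov]

lemma abs_integral_mul_le {Y Z : Ω → ℝ} (hY : MemLp Y 2 P) (hZ : MemLp Z 2 P) :
    |∫ ω, Y ω * Z ω ∂P| ≤ √(∫ ω, Y ω ^ 2 ∂P) * √(∫ ω, Z ω ^ 2 ∂P) := by
  have h := integral_mul_norm_le_Lp_mul_Lq (μ := P) (f := Y) (g := Z) (p := 2) (q := 2)
    Real.HolderConjugate.two_two (by simpa using hY) (by simpa using hZ)
  refine (abs_integral_le_integral_abs).trans ?_
  simp only [abs_mul, Real.sqrt_eq_rpow]
  simpa using h

/-- An event of a Gaussian family which is invariant under the translations dominated by the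
standard deviations is independent of each finite linear combination `ξ`: subtracting from the
family its regression on `ξ` does not change the event. -/
lemma map_restrict_linComb {z : D → Ω → ℝ} (hz : ∀ s, Measurable (z s))
    (hG : IsGaussianProcess z P) (h0 : ∀ s, ∫ ω, z s ω ∂P = 0) {B : Set (D → ℝ)}
    (hB : MeasurableSet B)
    (hinv : ∀ y h : D → ℝ, (∃ C, ∀ s, |h s| ≤ C * √(∫ ω, z s ω ^ 2 ∂P)) → (y + h ∈ B ↔ y ∈ B))
    (v : D →₀ ℝ) :
    (P.restrict {ω | (fun s => z s ω) ∈ B}).map (linComb z v) =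
      (P {ω | (fun s => z s ω) ∈ B} • P).map (linComb z v) := by
  have := hG.isProbabilityMeasure
  set ξ := linComb z v with hξ
  have hξm : Measurable ξ := measurable_linComb hz v
  have hξ2 : MemLp ξ 2 P := memLp_linComb hG v
  set q := ∫ ω, ξ ω ^ 2 ∂P with hq
  have hq0 : 0 ≤ q := integral_nonneg fun _ => sq_nonneg _
  -- the regression coefficients; if `ξ` vanishes almost surely they are `0` by division by zero
  let c : D → ℝ := fun s => (∫ ω, z s ω * ξ ω ∂P) / q
  have hz2 : ∀ s, MemLp (z s) 2 P := fun s => (hG.hasGaussianLaw_eval s).memLp_two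
  have hcs : ∀ s, |∫ ω, z s ω * ξ ω ∂P| ≤ √(∫ ω, z s ω ^ 2 ∂P) * √q := fun s =>
    abs_integral_mul_le (hz2 s) hξ2
  let η : D → Ω → ℝ := fun s => linComb z (Finsupp.single s 1 - c s • v)
  have hη : ∀ s ω, η s ω = z s ω - c s * ξ ω := by
    intro s ω
    simp only [η]
    rw [linComb, map_sub, map_smul, smul_eq_mul]
    exact congrArg (· - c s * ξ ω) (linComb_single z s ω)
  have hηm : ∀ s, Measurable (η s) := fun s => measurable_linComb hz _
  have hind : IndepFun (fun ω s => η s ω) (fun ω (_ : Unit) => ξ ω) P := by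
    refine IsGaussianProcess.indepFun_of_covariance_eq_zero (X := η) (Y := fun _ : Unit => ξ) ?_
      (fun s => (hηm s).aemeasurable) (fun _ => hξm.aemeasurable) fun s _ => ?_
    · have h := (isGaussianProcess_linComb hG).comp_right
        (Sum.elim (fun s => Finsupp.single s 1 - c s • v) fun _ : Unit => v)
      have e : Sum.elim η (fun _ : Unit => ξ) =
          linComb z ∘ Sum.elim (fun s => Finsupp.single s 1 - c s • v) fun _ : Unit => v := by
        funext i
        cases i <;> rfl
      rw [e]
      exact h
    · rw [covariance_eq_sub (memLp_linComb hG _) hξ2, integral_linComb hG h0 v, mul_zero, sub_zero]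
      have h1 : ∫ ω, (η s * ξ) ω ∂P = ∫ ω, z s ω * ξ ω ∂P - c s * q := by
        have hi : Integrable (fun ω => z s ω * ξ ω) P := (hz2 s).integrable_mul hξ2
        rw [hq, ← integral_const_mul, ← integral_sub hi (hξ2.integrable_sq.const_mul _)]
        refine integral_congr_ae (ae_of_all _ fun ω => ?_)
        simp only [Pi.mul_apply, hη]
        ring
      rw [h1]
      rcases hq0.eq_or_lt with h | h
      · have h2 := hcs s
        rw [← h, Real.sqrt_zero, mul_zero] at h2
        rw [abs_eq_zero.1 (le_antisymm h2 (abs_nonneg _)), ← h, mul_zero, sub_zero]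
      · simp only [c]
        rw [div_mul_cancel₀ _ h.ne', sub_self]
  have hA : {ω | (fun s => z s ω) ∈ B} = (fun ω s => η s ω) ⁻¹' B := by
    ext ω
    have h1 : (fun s => z s ω) = (fun s => η s ω) + fun s => c s * ξ ω := by
      funext s
      simp [hη]
    change (fun s => z s ω) ∈ B ↔ (fun s => η s ω) ∈ B
    rw [h1]
    refine hinv _ _ ⟨|ξ ω| / √q, fun s => ?_⟩
    rw [abs_mul, div_mul_eq_mul_div, mul_comm |ξ ω|, mul_div_right_comm]
    refine mul_le_mul_of_nonneg_right ?_ (abs_nonneg _)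
    simp only [c]
    rw [abs_div, abs_of_nonneg hq0]
    rcases hq0.eq_or_lt with h | h
    · simp [← h]
    · rw [div_le_div_iff₀ h (Real.sqrt_pos.2 h)]
      calc |∫ ω, z s ω * ξ ω ∂P| * √q ≤ √(∫ ω, z s ω ^ 2 ∂P) * √q * √q :=
            mul_le_mul_of_nonneg_right (hcs s) (Real.sqrt_nonneg _)
        _ = _ := by rw [mul_assoc, Real.mul_self_sqrt hq0]
  ext t ht
  rw [Measure.map_apply hξm ht, Measure.map_apply hξm ht, Measure.restrict_apply (hξm ht),
    Measure.smul_apply, smul_eq_mul, hA, Set.inter_comm]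
  exact hind.measure_inter_preimage_eq_mul B ((fun y : Unit → ℝ => y ()) ⁻¹' t) hB
    (measurable_pi_apply () ht)

/-- **Zero-one law** for Gaussian families: an event which is invariant under the translations
dominated by the standard deviations has probability `0` or `1`. -/
theorem measure_eq_zero_or_one_of_invariant {z : D → Ω → ℝ} (hz : ∀ s, Measurable (z s))
    (hG : IsGaussianProcess z P) (h0 : ∀ s, ∫ ω, z s ω ∂P = 0) {B : Set (D → ℝ)}
    (hB : MeasurableSet B)
    (hinv : ∀ y h : D → ℝ, (∃ C, ∀ s, |h s| ≤ C * √(∫ ω, z s ω ^ 2 ∂P)) → (y + h ∈ B ↔ y ∈ B)) :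
    (∀ᵐ ω ∂P, (fun s => z s ω) ∈ B) ∨ ∀ᵐ ω ∂P, (fun s => z s ω) ∉ B := by
  have := hG.isProbabilityMeasure
  set A := {ω | (fun s => z s ω) ∈ B} with hA
  have hZ : Measurable fun ω s => z s ω := measurable_pi_lambda _ hz
  have hAm : MeasurableSet A := hZ hB
  have : IsFiniteMeasure (P A • P) := Measure.smul_finite P (measure_ne_top P A)
  -- the event is independent of the whole family, hence of itself
  have h := map_eq_of_linComb (μ := P.restrict A) (μ' := P A • P) hz hz
    (map_restrict_linComb hz hG h0 hB hinv)
  have h1 : (P.restrict A).map (fun ω s => z s ω) B = (P A • P).map (fun ω s => z s ω) B := by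
    rw [h]
  have hpre : (fun ω s => z s ω) ⁻¹' B = A := rfl
  rw [Measure.map_apply hZ hB, Measure.map_apply hZ hB, hpre, Measure.restrict_apply hAm,
    Set.inter_self, Measure.smul_apply, smul_eq_mul] at h1
  rcases eq_or_ne (P A) 0 with h2 | h2
  · exact Or.inr (measure_eq_zero_iff_ae_notMem.1 h2)
  · refine Or.inl ((mem_ae_iff_prob_eq_one hAm).2 ?_)
    exact ((ENNReal.mul_eq_left h2 (measure_ne_top P A)).1 h1.symm)

end ZeroOne

/-! ### Borel–Cantelli lemmas for Gaussian sequences -/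

section BorelCantelli

variable {Ω : Type*} [MeasurableSpace Ω] {P : Measure Ω}

/-- Centered Gaussian variables with standard deviations at most `v n` are eventually smaller than
`2 v n √(log n)`. -/
lemma ae_eventually_abs_lt {R : ℕ → Ω → ℝ} (hR : ∀ n, HasGaussianLaw (R n) P)
    (h0 : ∀ n, ∫ ω, R n ω ∂P = 0) {v : ℕ → ℝ} (hv : ∀ n, 0 < v n)
    (h2 : ∀ n, ∫ ω, R n ω ^ 2 ∂P ≤ v n ^ 2) :
    ∀ᵐ ω ∂P, ∀ᶠ n : ℕ in atTop, |R n ω| < 2 * v n * √(Real.log (n + 1)) := by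
  have hP : P {ω | ∃ᶠ n : ℕ in atTop, 2 * v n * √(Real.log (n + 1)) ≤ |R n ω|} = 0 := by
    refine measure_setOfPred_frequently_eq_zero (ne_top_of_le_ne_top ?_ (ENNReal.tsum_le_tsum
      fun n => measure_le_abs_le (hR n) (h0 n) (h2 n)
        (mul_nonneg (mul_nonneg zero_le_two (hv n).le) (Real.sqrt_nonneg _))))
    have h1 : ∀ n : ℕ, 2 * Real.exp (-((2 * v n * √(Real.log (n + 1))) ^ 2 / (2 * v n ^ 2))) =
        2 * (1 / ((n + 1 : ℕ) : ℝ) ^ 2) := by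
      intro n
      have hn : (0 : ℝ) < (n + 1 : ℕ) := by positivity
      have hl : 0 ≤ Real.log (n + 1) := Real.log_nonneg (by
        have : (0 : ℝ) ≤ n := n.cast_nonneg
        linarith)
      have hvn := (hv n).ne'
      rw [mul_pow, Real.sq_sqrt hl, show -((2 * v n) ^ 2 * Real.log (n + 1) / (2 * v n ^ 2)) =
        -(Real.log ((n + 1 : ℕ) : ℝ) + Real.log ((n + 1 : ℕ) : ℝ)) by push_cast; field_simp; ring,
        Real.exp_neg, Real.exp_add, Real.exp_log hn, pow_two, one_div]
    simp_rw [h1]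
    rw [← ENNReal.ofReal_tsum_of_nonneg (fun n => by positivity) (((summable_nat_add_iff 1).2
        (Real.summable_one_div_nat_pow.2 one_lt_two)).mul_left 2)]
    exact ENNReal.ofReal_ne_top
  filter_upwards [measure_eq_zero_iff_ae_notMem.1 hP] with ω hω
  filter_upwards [not_frequently.1 hω] with n hn
  exact not_le.1 hn

lemma ae_frequently_le_of_measurable {H : ℕ → Ω → ℝ} (hm : ∀ n, Measurable (H n))
    (hG : IsGaussianProcess H P) (h0 : ∀ n, ∫ ω, H n ω ∂P = 0)
    (hcov : ∀ n m, n ≠ m → ∫ ω, H n ω * H m ω ∂P = 0) {v : ℕ → ℝ} (hv : ∀ n, 0 < v n)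
    (h2 : ∀ n, ∫ ω, H n ω ^ 2 ∂P = v n ^ 2) :
    ∀ᵐ ω ∂P, ∃ᶠ n : ℕ in atTop, v n * √(Real.log (n + 1)) ≤ H n ω := by
  have := hG.isProbabilityMeasure
  have hind : iIndepFun (fun n ω (_ : Unit) => H n ω) P := by
    refine IsGaussianProcess.iIndepFun_of_covariance_eq_zero (S := fun _ : ℕ => Unit)
      (X := fun n _ => H n) (hG.comp_right fun p : (_ : ℕ) × Unit => p.1)
      (fun n _ => (hm n).aemeasurable) fun n m hnm _ _ => ?_
    rw [covariance_eq_sub (hG.hasGaussianLaw_eval n).memLp_two (hG.hasGaussianLaw_eval m).memLp_two,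
      h0, zero_mul, sub_zero]
    exact hcov n m hnm
  set s : ℕ → Set Ω := fun n => {ω | v n * √(Real.log (n + 1)) ≤ H n ω} with hs
  have hsm : ∀ n, MeasurableSet (s n) := fun n => measurableSet_le measurable_const (hm n)
  have hsi : iIndepSet s P := by
    rw [iIndepSet_iff_meas_biInter hsm]
    intro I
    exact hind.measure_inter_preimage_eq_mul I
      (sets := fun n => {f : Unit → ℝ | v n * √(Real.log (n + 1)) ≤ f ()})
      fun n _ => measurableSet_le measurable_const (measurable_pi_apply ())
  have hsum : ∑' n, P (s n) = ∞ := by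
    by_contra hne
    set c : ℝ := (√(2 * Real.pi))⁻¹ * Real.exp (-1) with hc
    have hcpos : 0 < c := by positivity
    have hle : ∀ n : ℕ, c * (1 / ((n + 1 : ℕ) : ℝ)) ≤ (P (s n)).toReal := by
      intro n
      have hn : (0 : ℝ) < (n + 1 : ℕ) := by positivity
      have hl : 0 ≤ Real.log (n + 1) := Real.log_nonneg (by
        have : (0 : ℝ) ≤ n := n.cast_nonneg
        linarith)
      have h1 := le_measure_le (hG.hasGaussianLaw_eval n) (h0 n) (hv n) (h2 n)
        (Real.sqrt_nonneg (Real.log (n + 1)))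
      rw [ENNReal.ofReal_le_iff_le_toReal (measure_ne_top _ _)] at h1
      refine le_trans ?_ h1
      rw [hc, mul_assoc]
      refine mul_le_mul_of_nonneg_left ?_ (by positivity)
      have h3 : 1 / ((n + 1 : ℕ) : ℝ) = Real.exp (-Real.log (n + 1)) := by
        rw [Real.exp_neg, one_div]
        push_cast at hn ⊢
        rw [Real.exp_log hn]
      rw [h3, ← Real.exp_add, Real.exp_le_exp]
      have h4 := Real.sq_sqrt hl
      nlinarith [sq_nonneg (√(Real.log (n + 1)) - 1)]
    have hS : Summable fun n : ℕ => c * (1 / ((n + 1 : ℕ) : ℝ)) :=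
      Summable.of_nonneg_of_le (fun n => by positivity) hle (ENNReal.summable_toReal hne)
    rw [summable_mul_left_iff hcpos.ne',
      summable_nat_add_iff (f := fun n : ℕ => 1 / (n : ℝ)) 1] at hS
    exact Real.not_summable_one_div_natCast hS
  have h1 := measure_limsup_eq_one hsm hsi hsum
  have h3 := (mem_ae_iff_prob_eq_one (MeasurableSet.measurableSet_limsup hsm)).2 h1
  filter_upwards [h3] with ω hω
  exact mem_limsup_iff_frequently_mem.1 hω

/-- Uncorrelated jointly Gaussian variables with standard deviations `v n` exceed
`v n √(log n)` infinitely often. -/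
lemma ae_frequently_le {H : ℕ → Ω → ℝ}
    (hG : IsGaussianProcess H P) (h0 : ∀ n, ∫ ω, H n ω ∂P = 0)
    (hcov : ∀ n m, n ≠ m → ∫ ω, H n ω * H m ω ∂P = 0) {v : ℕ → ℝ} (hv : ∀ n, 0 < v n)
    (h2 : ∀ n, ∫ ω, H n ω ^ 2 ∂P = v n ^ 2) :
    ∀ᵐ ω ∂P, ∃ᶠ n : ℕ in atTop, v n * √(Real.log (n + 1)) ≤ H n ω := by
  let H' : ℕ → Ω → ℝ := fun n => (hG.aemeasurable n).mk (H n)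
  have e : ∀ n, H n =ᵐ[P] H' n := fun n => (hG.aemeasurable n).ae_eq_mk
  have h := ae_frequently_le_of_measurable (H := H') (fun n => (hG.aemeasurable n).measurable_mk)
    (hG.congr e) (fun n => by rw [← integral_congr_ae (e n), h0]) (fun n m hnm => by
      rw [← hcov n m hnm]
      exact integral_congr_ae ((e n).mul (e m)).symm) hv (fun n => by
      rw [← h2 n]
      exact integral_congr_ae ((e n).pow_const 2).symm)
  filter_upwards [h, ae_all_iff.2 e] with ω hω he
  exact hω.mono fun n hn => by rwa [he n]

end BorelCantelli

/-! ### The lower bound at the origin -/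

section LowerBound

variable {N : ℕ} {Ω : Type*} [MeasurableSpace Ω] {P : Measure Ω}
  {E : Matrix (Fin N) (Fin N) ℝ} {ψ : EuclideanSpace ℝ (Fin N) → ℝ}
  {X : EuclideanSpace ℝ (Fin N) → Ω → ℝ} {ν : Seminorm ℝ (EuclideanSpace ℝ (Fin N))}

/-- The frequencies `ξ` with `1 / b ≤ ψ ξ < b`. -/
def frequencyRing (ψ : EuclideanSpace ℝ (Fin N) → ℝ) (b : ℝ) : Set (EuclideanSpace ℝ (Fin N)) :=
  {ξ | b⁻¹ ≤ ψ ξ ∧ ψ ξ < b}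

lemma measurableSet_frequencyRing (hψ : Continuous ψ) (b : ℝ) :
    MeasurableSet (frequencyRing ψ b) :=
  (measurableSet_le measurable_const hψ.measurable).inter
    (measurableSet_lt hψ.measurable measurable_const)

lemma isHermitianL2_indicator {f : EuclideanSpace ℝ (Fin N) → ℂ} (hf : IsHermitianL2 f)
    {A : Set (EuclideanSpace ℝ (Fin N))} (hA : MeasurableSet A) (hneg : ∀ ξ, -ξ ∈ A ↔ ξ ∈ A) :
    IsHermitianL2 (A.indicator f) := by
  refine ⟨hf.memLp.indicator hA, fun ξ => ?_⟩
  by_cases h : ξ ∈ A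
  · rw [Set.indicator_of_mem h, Set.indicator_of_mem ((hneg ξ).2 h), hf.neg]
  · rw [Set.indicator_of_notMem h, Set.indicator_of_notMem (fun h' => h ((hneg ξ).1 h')), map_zero]

/-- Most of the variance of `X θ` comes from a ring of frequencies. -/
lemma exists_frequencyRing (hψ : IsSymmHomogeneous E.transpose ψ)
    {θ : EuclideanSpace ℝ (Fin N)} (hk : MemLp (harmonizableKernel E ψ θ) 2 volume)
    {ε : ℝ} (hε : 0 < ε) :
    ∃ b : ℝ, 1 < b ∧
      (eLpNorm ((frequencyRing ψ b).indicator (harmonizableKernel E ψ θ)) 2 volume).toReal ^ 2 +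
        (eLpNorm (harmonizableKernel E ψ θ - (frequencyRing ψ b).indicator
          (harmonizableKernel E ψ θ)) 2 volume).toReal ^ 2 = fieldStd E ψ θ ^ 2 ∧
      (eLpNorm (harmonizableKernel E ψ θ - (frequencyRing ψ b).indicator
          (harmonizableKernel E ψ θ)) 2 volume).toReal ^ 2 ≤ ε := by
  set k := harmonizableKernel E ψ θ with hkdef
  have hint : Integrable (fun ξ => ‖k ξ‖ ^ 2) volume := hk.integrable_norm_pow two_ne_zero
  have hms : ∀ b, MeasurableSet (frequencyRing ψ b) := measurableSet_frequencyRing hψ.continuous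
  have hin : ∀ b, (eLpNorm ((frequencyRing ψ b).indicator k) 2 volume).toReal ^ 2 =
      ∫ ξ in frequencyRing ψ b, ‖k ξ‖ ^ 2 := by
    intro b
    rw [eLpNorm_two_toReal_sq (hk.indicator (hms b)), ← integral_indicator (hms b)]
    refine integral_congr_ae (ae_of_all _ fun ξ => ?_)
    by_cases h : ξ ∈ frequencyRing ψ b <;> simp [h]
  have hout : ∀ b, (eLpNorm (k - (frequencyRing ψ b).indicator k) 2 volume).toReal ^ 2 =
      ∫ ξ in (frequencyRing ψ b)ᶜ, ‖k ξ‖ ^ 2 := by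
    intro b
    rw [eLpNorm_two_toReal_sq (hk.sub (hk.indicator (hms b))), ← integral_indicator (hms b).compl]
    refine integral_congr_ae (ae_of_all _ fun ξ => ?_)
    by_cases h : ξ ∈ frequencyRing ψ b <;> simp [h]
  let s : ℕ → Set (EuclideanSpace ℝ (Fin N)) := fun n => (frequencyRing ψ (n + 2))ᶜ
  have hanti : Antitone s := by
    intro m n hmn
    refine Set.compl_subset_compl.2 fun ξ hξ => ?_
    have h1 : (m : ℝ) + 2 ≤ n + 2 := by
      have : (m : ℝ) ≤ n := by exact_mod_cast hmn
      linarith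
    have h2 : (0 : ℝ) < m + 2 := by positivity
    exact ⟨(inv_anti₀ h2 h1).trans hξ.1, hξ.2.trans_le h1⟩
  have hlim := tendsto_setIntegral_of_antitone (f := fun ξ => ‖k ξ‖ ^ 2) (μ := volume)
    (fun n => (hms _).compl) hanti ⟨0, hint.integrableOn⟩
  have hzero : ∫ ξ in ⋂ n, s n, ‖k ξ‖ ^ 2 = 0 := by
    have hsub : ∀ ξ ∈ ⋂ n, s n, ξ = 0 := by
      intro ξ hξ
      by_contra h0
      have hp := hψ.pos ξ h0
      obtain ⟨n, hn⟩ := exists_nat_gt (max (ψ ξ) (ψ ξ)⁻¹)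
      refine Set.mem_iInter.1 hξ n ⟨?_, ?_⟩
      · have h1 : (ψ ξ)⁻¹ < n + 2 := (le_max_right _ _).trans_lt (hn.trans (by linarith))
        exact (inv_le_comm₀ hp (by positivity)).1 h1.le
      · exact (le_max_left _ _).trans_lt (hn.trans (by linarith))
    refine setIntegral_eq_zero_of_forall_eq_zero fun ξ hξ => ?_
    rw [hsub ξ hξ, hkdef, kernel_eq, character]
    simp
  rw [hzero] at hlim
  obtain ⟨n, hn⟩ := (hlim.eventually (ge_mem_nhds hε)).exists
  refine ⟨n + 2, by have : (0 : ℝ) ≤ n := n.cast_nonneg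
                    linarith, ?_, ?_⟩
  · rw [hin, hout, fieldStd_sq hk]
    exact integral_add_compl (hms _) hint
  · rw [hout]
    exact hn

lemma eventually_loglog_le {ρ : ℝ} (hρ : 0 < ρ) (hρ1 : ρ ≤ 1) :
    ∀ᶠ n : ℕ in atTop, loglog (1 + (ρ ^ n)⁻¹) ≤ 4 * Real.log (n + 1) := by
  obtain ⟨m, hm⟩ := exists_nat_ge (Real.log ρ⁻¹)
  filter_upwards [eventually_ge_atTop (max m 1)] with n hn
  have hn1 : (1 : ℝ) ≤ n := by exact_mod_cast (le_max_right _ _).trans hn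
  have hnm : (m : ℝ) ≤ n := by exact_mod_cast (le_max_left _ _).trans hn
  have hpow : 1 ≤ (ρ ^ n)⁻¹ := (one_le_inv₀ (by positivity)).2 (pow_le_one₀ hρ.le hρ1)
  have hlog : Real.log (1 + (ρ ^ n)⁻¹) ≤ (n + 1) ^ 2 := by
    calc Real.log (1 + (ρ ^ n)⁻¹) ≤ Real.log (2 * (ρ⁻¹) ^ n) :=
          Real.log_le_log (by positivity) (by rw [inv_pow]; linarith)
      _ = Real.log 2 + n * Real.log ρ⁻¹ := by
          rw [Real.log_mul (by norm_num) (by positivity), Real.log_pow]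
      _ ≤ _ := by
          have := Real.log_two_lt_d9
          nlinarith
  have hexp : Real.exp 1 ≤ ((n : ℝ) + 1) ^ 2 := by
    have := Real.exp_one_lt_d9
    nlinarith
  have hl : 0 ≤ Real.log ((n : ℝ) + 1) := Real.log_nonneg (by linarith)
  calc loglog (1 + (ρ ^ n)⁻¹) ≤ Real.log (((n : ℝ) + 1) ^ 2) :=
        Real.log_le_log (lt_max_of_lt_right (Real.exp_pos _)) (max_le hlog hexp)
    _ = 2 * Real.log (n + 1) := by rw [Real.log_pow]; norm_num
    _ ≤ _ := by linarith

/-- The almost sure lower bound for the local modulus of continuity at the origin. Along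
`s n = (ρ ^ n) ^ E θ` the frequency rings that carry most of the variance are disjoint, so that
the field is a sequence of independent variables up to an error of small variance. -/
theorem exists_le_localModulus (hN : 0 < N) (hν : IsPolarNorm E ν)
    (hψ : IsSymmHomogeneous E.transpose ψ)
    (hk : ∀ t, MemLp (harmonizableKernel E ψ t) 2 volume)
    {W : (EuclideanSpace ℝ (Fin N) → ℂ) → Ω → ℝ} (hW : IsIsonormal P W)
    (hXW : ∀ t, X t =ᵐ[P] W (harmonizableKernel E ψ t)) :
    ∃ c > 0, ∀ᵐ ω ∂P, ∀ r > 0,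
      ENNReal.ofReal c ≤ localModulus (radial E ν) (fun t => X t ω) 0 r := by
  obtain ⟨-, θ, hθ, -⟩ := exists_polar hν
    (x := EuclideanSpace.single (⟨0, hN⟩ : Fin N) (1 : ℝ)) (by simp)
  have hθ0 : θ ≠ 0 := by
    rintro rfl
    simp at hθ
  set σ := fieldStd E ψ θ with hσ
  have hσpos : 0 < σ := fieldStd_pos hψ (hk θ) hθ0
  obtain ⟨b, hb1, hsplit, hsmall⟩ := exists_frequencyRing hψ (hk θ)
    (by positivity : 0 < (σ / 4) ^ 2)
  have hb0 : 0 < b := by linarith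
  set A := frequencyRing ψ b with hA
  have hAm : MeasurableSet A := measurableSet_frequencyRing hψ.continuous b
  set k := harmonizableKernel E ψ θ with hkθ
  set h := (eLpNorm (A.indicator k) 2 volume).toReal with hh
  have hh0 : 0 ≤ h := ENNReal.toReal_nonneg
  have hhσ : 3 / 4 * σ ≤ h := by
    refine abs_le_of_sq_le_sq' ?_ hh0 |>.2
    nlinarith
  have hhpos : 0 < h := by linarith [mul_pos (by norm_num : (0 : ℝ) < 3 / 4) hσpos]
  -- this ratio makes the rings `1 / b ≤ ρ ^ n ψ < b` disjoint
  set ρ : ℝ := (b ^ 2)⁻¹ with hρ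
  have hρ0 : 0 < ρ := by positivity
  have hρ1 : ρ < 1 := inv_lt_one_of_one_lt₀ (one_lt_pow₀ hb1 two_ne_zero)
  have hρn : ∀ n : ℕ, 0 < ρ ^ n := fun n => pow_pos hρ0 n
  let s : ℕ → EuclideanSpace ℝ (Fin N) := fun n => opPow E (ρ ^ n) θ
  let B : ℕ → Set (EuclideanSpace ℝ (Fin N)) := fun n => opPow E.transpose (ρ ^ n) ⁻¹' A
  let f : ℕ → EuclideanSpace ℝ (Fin N) → ℂ := fun n =>
    (B n).indicator (harmonizableKernel E ψ (s n))
  have hBm : ∀ n, MeasurableSet (B n) := fun n => (continuous_opPow _ _).measurable hAm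
  have hBneg : ∀ n ξ, -ξ ∈ B n ↔ ξ ∈ B n := by
    intro n ξ
    change opPow E.transpose (ρ ^ n) (-ξ) ∈ A ↔ opPow E.transpose (ρ ^ n) ξ ∈ A
    rw [map_neg]
    change b⁻¹ ≤ ψ _ ∧ ψ _ < b ↔ b⁻¹ ≤ ψ _ ∧ ψ _ < b
    rw [hψ.symm]
  have hfH : ∀ n, IsHermitianL2 (f n) := fun n =>
    isHermitianL2_indicator (isHermitianL2_kernel hψ.symm (hk _)) (hBm n) (hBneg n)
  have hkH : ∀ t, IsHermitianL2 (harmonizableKernel E ψ t) := fun t =>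
    isHermitianL2_kernel hψ.symm (hk t)
  have hf : ∀ n, f n = fun ξ => (((ρ ^ n) ^ (1 + E.trace / 2) : ℝ) : ℂ) *
      A.indicator k (opPow E.transpose (ρ ^ n) ξ) := by
    intro n
    funext ξ
    by_cases hξ : ξ ∈ B n
    · rw [Set.indicator_of_mem (show opPow E.transpose (ρ ^ n) ξ ∈ A from hξ)]
      exact (Set.indicator_of_mem hξ _).trans (kernel_opPow hψ (hρn n) θ ξ)
    · rw [Set.indicator_of_notMem (show opPow E.transpose (ρ ^ n) ξ ∉ A from hξ), mul_zero]
      exact Set.indicator_of_notMem hξ _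
  have hkf : ∀ n, harmonizableKernel E ψ (s n) - f n =
      fun ξ => (((ρ ^ n) ^ (1 + E.trace / 2) : ℝ) : ℂ) *
        (k - A.indicator k) (opPow E.transpose (ρ ^ n) ξ) := by
    intro n
    funext ξ
    rw [Pi.sub_apply, hf, Pi.sub_apply, mul_sub]
    exact congrArg (· - _) (kernel_opPow hψ (hρn n) θ ξ)
  have hdisj : ∀ n m, n < m → ∀ ξ, f n ξ = 0 ∨ f m ξ = 0 := by
    intro n m hnm ξ
    by_contra! hne
    have hn : ξ ∈ B n := Set.mem_of_indicator_ne_zero hne.1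
    have hm : ξ ∈ B m := Set.mem_of_indicator_ne_zero hne.2
    have hξ : ξ ≠ 0 := by
      rintro rfl
      refine hne.1 ((Set.indicator_of_mem hn _).trans ?_)
      rw [kernel_eq, character]
      simp
    have h1 : ψ (opPow E.transpose (ρ ^ n) ξ) < b := hn.2
    have h2 : b⁻¹ ≤ ψ (opPow E.transpose (ρ ^ m) ξ) := hm.1
    rw [hψ.homogeneous _ (hρn _) ξ hξ] at h1 h2
    have hp := hψ.pos ξ hξ
    have h3 : ρ ^ m ≤ ρ ^ n * ρ := by
      rw [← pow_succ]
      exact pow_le_pow_of_le_one hρ0.le hρ1.le hnm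
    have h4 : ρ ^ m * ψ ξ < b⁻¹ := calc
      ρ ^ m * ψ ξ ≤ (ρ ^ n * ρ) * ψ ξ := mul_le_mul_of_nonneg_right h3 hp.le
      _ = (ρ ^ n * ψ ξ) * ρ := by ring
      _ < b * ρ := mul_lt_mul_of_pos_right h1 hρ0
      _ = b⁻¹ := by rw [hρ]; field_simp
    exact absurd h2 (not_le.2 h4)
  have hcov : ∀ n m, n ≠ m → ∫ ω, W (f n) ω * W (f m) ω ∂P = 0 := by
    intro n m hnm
    rw [hW.covariance _ _ (hfH n) (hfH m)]
    refine integral_eq_zero_of_ae (ae_of_all _ fun ξ => ?_)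
    have h0 : f n ξ = 0 ∨ f m ξ = 0 := by
      rcases hnm.lt_or_gt with hlt | hlt
      · exact hdisj n m hlt ξ
      · exact (hdisj m n hlt ξ).symm
    rcases h0 with h0 | h0 <;> simp [h0]
  have hfreq := ae_frequently_le (hW.isGaussianProcess.comp_right f) (fun n => hW.centered (f n))
    hcov (v := fun n => ρ ^ n * h) (fun n => mul_pos (hρn n) hhpos) (fun n => by
      change ∫ ω, W (f n) ω ^ 2 ∂P = _
      rw [hW.integral_sq (hfH n), hf,
        eLpNorm_const_mul_comp_opPow ((hk θ).1.indicator hAm) (hρn n)])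
  have hev := ae_eventually_abs_lt
    (R := fun n ω => W (harmonizableKernel E ψ (s n)) ω - W (f n) ω)
    (fun n => hW.isGaussianProcess.hasGaussianLaw_fun_sub)
    (fun n => by
      rw [integral_sub (hW.integrable _) (hW.integrable _), hW.centered, hW.centered, sub_zero])
    (v := fun n => ρ ^ n * (σ / 4)) (fun n => mul_pos (hρn n) (by positivity)) (fun n => by
      rw [hW.integral_sub_sq (hkH _) (hfH n), hkf,
        eLpNorm_const_mul_comp_opPow ((hk θ).1.sub ((hk θ).1.indicator hAm)) (hρn n), mul_pow,
        mul_pow]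
      exact mul_le_mul_of_nonneg_left hsmall (by positivity))
  have hX0 : ∀ᵐ ω ∂P, X 0 ω = 0 := by
    have h1 : ∫ ω, W (harmonizableKernel E ψ 0) ω ^ 2 ∂P = 0 := by
      rw [hW.integral_sq (hkH 0)]
      exact pow_eq_zero_iff two_ne_zero |>.2 fieldStd_zero
    rw [integral_eq_zero_iff_of_nonneg (fun _ => sq_nonneg _) (hW.memLp _).integrable_sq] at h1
    filter_upwards [h1, hXW 0] with ω h2 h3
    rw [h3]
    exact pow_eq_zero_iff two_ne_zero |>.1 h2
  -- infinitely often `X (s n) ≥ (3 / 4 - 1 / 2) σ ρ ^ n √(log n)`, while the normalization is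
  -- eventually at most `2 ρ ^ n √(log n)`
  refine ⟨σ / 8, by positivity, ?_⟩
  filter_upwards [hfreq, hev, hX0, ae_all_iff.2 fun n => hXW (s n)] with ω h1 h2 h3 h4 r hr
  have hsmallr : ∀ᶠ n in atTop, ρ ^ n < r :=
    (tendsto_pow_atTop_nhds_zero_of_lt_one hρ0.le hρ1).eventually (gt_mem_nhds hr)
  obtain ⟨n, hn1, hn2, hnr, hnl, hn0⟩ := (h1.and_eventually (h2.and (hsmallr.and
    ((eventually_loglog_le hρ0 hρ1.le).and (eventually_ge_atTop 1))))).exists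
  have hs0 : s n ≠ 0 := opPow_ne_zero E (hρn n) hθ0
  have hτ : radial E ν (s n) = ρ ^ n := radial_opPow_of_norm_eq_one hν (hρn n) hθ
  refine le_trans (ENNReal.ofReal_le_ofReal ?_) (le_iSup₂ (f := fun t
    (_ : t ∈ {t : EuclideanSpace ℝ (Fin N) | t ≠ 0 ∧ radial E ν (t - 0) ≤ r}) =>
      ENNReal.ofReal (|X t ω - X 0 ω| / (radial E ν (t - 0) *
        √(loglog (1 + (radial E ν (t - 0))⁻¹))))) (s n) ?_)
  swap
  · refine ⟨hs0, ?_⟩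
    rw [sub_zero, hτ]
    exact hnr.le
  rw [sub_zero, hτ, h3, sub_zero, h4]
  have hll := one_le_loglog (1 + (ρ ^ n)⁻¹)
  rw [le_div_iff₀ (mul_pos (hρn n) (Real.sqrt_pos.2 (by linarith)))]
  set L := √(Real.log ((n : ℝ) + 1)) with hL
  have hL0 : 0 ≤ L := Real.sqrt_nonneg _
  have hsq : √(loglog (1 + (ρ ^ n)⁻¹)) ≤ 2 * L := by
    refine (Real.sqrt_le_sqrt hnl).trans_eq ?_
    rw [Real.sqrt_mul (by norm_num), show (4 : ℝ) = 2 ^ 2 by norm_num,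
      Real.sqrt_sq (by norm_num)]
  have hlow : ρ ^ n * h * L - 2 * (ρ ^ n * (σ / 4)) * L ≤ W (harmonizableKernel E ψ (s n)) ω := by
    have := (abs_lt.1 hn2).1
    have : ρ ^ n * h * L ≤ W (f n) ω := hn1
    linarith
  have hpos : 0 ≤ ρ ^ n * L := mul_nonneg (hρn n).le hL0
  calc σ / 8 * (ρ ^ n * √(loglog (1 + (ρ ^ n)⁻¹))) ≤ σ / 8 * (ρ ^ n * (2 * L)) := by
        gcongr
    _ = (3 / 4 * σ) * (ρ ^ n * L) - 2 * (ρ ^ n * (σ / 4)) * L := by ring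
    _ ≤ h * (ρ ^ n * L) - 2 * (ρ ^ n * (σ / 4)) * L := by
        have := mul_le_mul_of_nonneg_right hhσ hpos
        linarith
    _ = ρ ^ n * h * L - 2 * (ρ ^ n * (σ / 4)) * L := by ring
    _ ≤ _ := hlow.trans (le_abs_self _)

end LowerBound

/-! ### The local modulus along a dense sequence -/

section Modulus

variable {N : ℕ} {E : Matrix (Fin N) (Fin N) ℝ} {ν : Seminorm ℝ (EuclideanSpace ℝ (Fin N))}

lemma tendsto_loglog_natCast_add_two : Tendsto (fun n : ℕ => loglog (n + 2)) atTop atTop := by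
  have h1 : Tendsto (fun n : ℕ => Real.log (Real.log (n + 2))) atTop atTop :=
    Real.tendsto_log_atTop.comp (Real.tendsto_log_atTop.comp
      (tendsto_atTop_add_const_right _ _ tendsto_natCast_atTop_atTop))
  have h2 : ∀ᶠ n : ℕ in atTop, 0 < Real.log ((n : ℝ) + 2) := Eventually.of_forall fun n =>
    Real.log_pos (by
      have : (0 : ℝ) ≤ n := n.cast_nonneg
      linarith)
  exact tendsto_atTop_mono' _ (h2.mono fun n hn => Real.log_le_log hn (le_max_left _ _)) h1

/-- The normalization `τ √(log log (1 + τ⁻¹))` of the local modulus of continuity. -/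
noncomputable def modulusGauge (τ : ℝ) : ℝ := τ * √(loglog (1 + τ⁻¹))

lemma modulusGauge_pos {τ : ℝ} (hτ : 0 < τ) : 0 < modulusGauge τ :=
  mul_pos hτ (Real.sqrt_pos.2 (zero_lt_one.trans_le (one_le_loglog _)))

lemma continuousOn_modulusGauge : ContinuousOn modulusGauge (Set.Ioi 0) := by
  have h1 : ContinuousOn (fun τ : ℝ => 1 + τ⁻¹) (Set.Ioi 0) :=
    continuousOn_const.add (continuousOn_inv₀.mono fun τ hτ => (ne_of_gt hτ : τ ≠ 0))
  have h2 : ContinuousOn (fun τ : ℝ => Real.log (1 + τ⁻¹)) (Set.Ioi 0) :=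
    h1.log fun τ hτ => (add_pos one_pos (inv_pos.2 hτ)).ne'
  have h3 : ContinuousOn (fun τ : ℝ => loglog (1 + τ⁻¹)) (Set.Ioi 0) :=
    (h2.sup continuousOn_const).log fun τ _ => (lt_max_of_lt_right (Real.exp_pos 1)).ne'
  exact continuousOn_id.mul h3.sqrt

/-- The supremum of `|z k| / (τ √(log log (1 + τ⁻¹)))`, `τ = τ (d k)`, over the points `d k ≠ 0`
of a sequence with `τ (d k) < 1 / (n + 1)`. -/
noncomputable def seqModulus (τ : EuclideanSpace ℝ (Fin N) → ℝ) (d : ℕ → EuclideanSpace ℝ (Fin N))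
    (n : ℕ) (z : ℕ → ℝ) : ℝ≥0∞ :=
  ⨆ (k : ℕ) (_ : d k ≠ 0 ∧ τ (d k) < 1 / (n + 1)), ENNReal.ofReal (|z k| / modulusGauge (τ (d k)))

/-- The limit as `n → ∞` of `seqModulus τ d n`. -/
noncomputable def limSeqModulus (τ : EuclideanSpace ℝ (Fin N) → ℝ)
    (d : ℕ → EuclideanSpace ℝ (Fin N)) (z : ℕ → ℝ) : ℝ≥0∞ :=
  ⨅ n, seqModulus τ d n z

lemma antitone_seqModulus (τ : EuclideanSpace ℝ (Fin N) → ℝ) (d : ℕ → EuclideanSpace ℝ (Fin N))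
    (z : ℕ → ℝ) : Antitone fun n => seqModulus τ d n z := fun m n hmn =>
  iSup_mono fun _ => iSup_mono' fun h => ⟨⟨h.1, h.2.trans_le (by
    have : (m : ℝ) ≤ n := by exact_mod_cast hmn
    gcongr)⟩, le_rfl⟩

lemma measurable_limSeqModulus (τ : EuclideanSpace ℝ (Fin N) → ℝ)
    (d : ℕ → EuclideanSpace ℝ (Fin N)) : Measurable (limSeqModulus τ d) := by
  refine Measurable.iInf fun n => Measurable.iSup fun k => Measurable.iSup fun _ => ?_
  have h1 : Measurable fun z : ℕ → ℝ => |z k| :=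
    continuous_abs.measurable.comp (measurable_pi_apply k)
  exact ENNReal.measurable_ofReal.comp (h1.div_const _)

/-- Perturbations of size `O(τ)` do not change the limit modulus, since
`√(log log (1 + τ⁻¹)) → ∞`. -/
lemma limSeqModulus_add_le {τ : EuclideanSpace ℝ (Fin N) → ℝ} (hτ : ∀ x, x ≠ 0 → 0 < τ x)
    (d : ℕ → EuclideanSpace ℝ (Fin N)) {z h : ℕ → ℝ} {C : ℝ} (hh : ∀ k, |h k| ≤ C * τ (d k)) :
    limSeqModulus τ d (z + h) ≤ limSeqModulus τ d z := by
  have hle : ∀ n : ℕ, seqModulus τ d n (z + h) ≤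
      seqModulus τ d n z + ENNReal.ofReal (|C| / √(loglog (n + 2))) := by
    intro n
    refine iSup₂_le fun k hk => ?_
    have hτk := hτ _ hk.1
    have hg := modulusGauge_pos hτk
    have h1 : |h k| / modulusGauge (τ (d k)) ≤ |C| / √(loglog (n + 2)) := by
      have hn : (n : ℝ) + 2 ≤ 1 + (τ (d k))⁻¹ := by
        have h2 : (n : ℝ) + 1 < (τ (d k))⁻¹ := by
          rw [lt_inv_comm₀ (by positivity) hτk, ← one_div]
          exact hk.2
        linarith
      have h3 : √(loglog (n + 2)) ≤ √(loglog (1 + (τ (d k))⁻¹)) :=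
        Real.sqrt_le_sqrt (loglog_mono (by positivity) hn)
      have h4 : 0 < √(loglog ((n : ℝ) + 2)) :=
        Real.sqrt_pos.2 (zero_lt_one.trans_le (one_le_loglog _))
      rw [div_le_div_iff₀ hg h4, modulusGauge]
      calc |h k| * √(loglog (n + 2)) ≤ (|C| * τ (d k)) * √(loglog (1 + (τ (d k))⁻¹)) := by
            refine mul_le_mul ((hh k).trans ?_) h3 h4.le (by positivity)
            exact mul_le_mul_of_nonneg_right (le_abs_self C) hτk.le
        _ = _ := by ring
    calc ENNReal.ofReal (|(z + h) k| / modulusGauge (τ (d k)))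
        ≤ ENNReal.ofReal (|z k| / modulusGauge (τ (d k)) + |h k| / modulusGauge (τ (d k))) := by
          refine ENNReal.ofReal_le_ofReal ?_
          rw [← add_div]
          exact div_le_div_of_nonneg_right (abs_add_le _ _) hg.le
      _ ≤ ENNReal.ofReal (|z k| / modulusGauge (τ (d k))) +
          ENNReal.ofReal (|h k| / modulusGauge (τ (d k))) := ENNReal.ofReal_add_le
      _ ≤ _ := add_le_add (le_iSup₂ (f := fun k (_ : d k ≠ 0 ∧ τ (d k) < 1 / ((n : ℝ) + 1)) =>
            ENNReal.ofReal (|z k| / modulusGauge (τ (d k)))) k hk) (ENNReal.ofReal_le_ofReal h1)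
  have hlim : Tendsto (fun n : ℕ => seqModulus τ d n z +
      ENNReal.ofReal (|C| / √(loglog (n + 2)))) atTop (𝓝 (limSeqModulus τ d z + 0)) := by
    refine (tendsto_atTop_iInf (antitone_seqModulus τ d z)).add ?_
    rw [← ENNReal.ofReal_zero]
    refine ENNReal.tendsto_ofReal (Tendsto.const_div_atTop ?_ _)
    exact Real.tendsto_sqrt_atTop.comp tendsto_loglog_natCast_add_two
  rw [add_zero] at hlim
  exact ge_of_tendsto' hlim fun n => (iInf_le _ n).trans (hle n)

lemma limSeqModulus_add {τ : EuclideanSpace ℝ (Fin N) → ℝ} (hτ : ∀ x, x ≠ 0 → 0 < τ x)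
    (d : ℕ → EuclideanSpace ℝ (Fin N)) {z h : ℕ → ℝ} {C : ℝ} (hh : ∀ k, |h k| ≤ C * τ (d k)) :
    limSeqModulus τ d (z + h) = limSeqModulus τ d z := by
  refine le_antisymm (limSeqModulus_add_le hτ d hh) ?_
  have h1 := limSeqModulus_add_le hτ d (z := z + h) (h := -h) (C := C) fun k => by
    rw [Pi.neg_apply, abs_neg]
    exact hh k
  rwa [add_neg_cancel_right] at h1

lemma localModulus_mono (τ x) (t₀ : EuclideanSpace ℝ (Fin N)) : Monotone (localModulus τ x t₀) :=
  fun _ _ hrs => iSup_mono fun _ => iSup_mono' fun h => ⟨⟨h.1, h.2.trans hrs⟩, le_rfl⟩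

/-- For a continuous function, the local modulus of continuity converges to its version along a
dense sequence of increments. -/
lemma tendsto_localModulus (hν : IsPolarNorm E ν) {d : ℕ → EuclideanSpace ℝ (Fin N)}
    (hd : DenseRange d) {x : EuclideanSpace ℝ (Fin N) → ℝ} (hx : Continuous x)
    (t₀ : EuclideanSpace ℝ (Fin N)) :
    Tendsto (localModulus (radial E ν) x t₀) (𝓝[>] (0 : ℝ))
      (𝓝 (limSeqModulus (radial E ν) d fun k => x (t₀ + d k) - x t₀)) := by
  set z : ℕ → ℝ := fun k => x (t₀ + d k) - x t₀ with hz
  have hτ0 : ContinuousOn (radial E ν) {0}ᶜ := continuousOn_radial hν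
  let g : EuclideanSpace ℝ (Fin N) → ℝ≥0∞ := fun y =>
    ENNReal.ofReal (|x (t₀ + y) - x t₀| / modulusGauge (radial E ν y))
  have hg : ContinuousOn g {0}ᶜ := by
    refine ENNReal.continuous_ofReal.comp_continuousOn (ContinuousOn.div ?_ ?_ fun y hy =>
      (modulusGauge_pos (radial_pos hν hy)).ne')
    · exact (((hx.comp (continuous_const.add continuous_id)).sub continuous_const).abs).continuousOn
    · exact continuousOn_modulusGauge.comp hτ0 fun y hy => radial_pos hν hy
  have hupper : ∀ n : ℕ, ∀ r : ℝ, r < 1 / (n + 1) →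
      localModulus (radial E ν) x t₀ r ≤ seqModulus (radial E ν) d n z := by
    intro n r hr
    refine iSup₂_le fun s hs => ?_
    obtain ⟨hs0, hsr⟩ : s ≠ t₀ ∧ radial E ν (s - t₀) ≤ r := hs
    have hy0 : s - t₀ ∈ ({0}ᶜ : Set (EuclideanSpace ℝ (Fin N))) := sub_ne_zero.2 hs0
    have hnhds : ({0}ᶜ : Set (EuclideanSpace ℝ (Fin N))) ∈ 𝓝 (s - t₀) :=
      isOpen_compl_singleton.mem_nhds hy0
    have : NeBot (𝓝[Set.range d] (s - t₀)) := mem_closure_iff_nhdsWithin_neBot.1 (hd _)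
    have hlim : Tendsto g (𝓝[Set.range d] (s - t₀)) (𝓝 (g (s - t₀))) :=
      (hg.continuousAt hnhds).tendsto.mono_left nhdsWithin_le_nhds
    have hev : ∀ᶠ y in 𝓝[Set.range d] (s - t₀), g y ≤ seqModulus (radial E ν) d n z := by
      have hτlt : ∀ᶠ y in 𝓝 (s - t₀), radial E ν y < 1 / (n + 1) :=
        (hτ0.continuousAt hnhds).eventually (gt_mem_nhds (hsr.trans_lt hr))
      filter_upwards [self_mem_nhdsWithin, mem_nhdsWithin_of_mem_nhds hnhds,
        mem_nhdsWithin_of_mem_nhds hτlt] with y hy h1 h2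
      obtain ⟨k, rfl⟩ := hy
      exact le_iSup₂ (f := fun k (_ : d k ≠ 0 ∧ radial E ν (d k) < 1 / ((n : ℝ) + 1)) =>
        ENNReal.ofReal (|z k| / modulusGauge (radial E ν (d k)))) k ⟨h1, h2⟩
    have h := le_of_tendsto hlim hev
    simp only [g, add_sub_cancel] at h
    exact h
  have hlower : ∀ n : ℕ, seqModulus (radial E ν) d n z ≤
      localModulus (radial E ν) x t₀ (1 / (n + 1)) := by
    intro n
    refine iSup₂_le fun k hk => ?_
    refine le_trans (le_of_eq ?_) (le_iSup₂ (f := fun s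
      (_ : s ∈ {s : EuclideanSpace ℝ (Fin N) | s ≠ t₀ ∧ radial E ν (s - t₀) ≤ 1 / ((n : ℝ) + 1)}) =>
        ENNReal.ofReal (|x s - x t₀| / (radial E ν (s - t₀) *
          √(loglog (1 + (radial E ν (s - t₀))⁻¹))))) (t₀ + d k) ⟨?_, ?_⟩)
    · rw [add_sub_cancel_left]
      rfl
    · simpa using hk.1
    · rw [add_sub_cancel_left]
      exact hk.2.le
  refine tendsto_order.2 ⟨fun a ha => ?_, fun a ha => ?_⟩
  · filter_upwards [self_mem_nhdsWithin] with r hr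
    obtain ⟨n, hn⟩ := exists_nat_one_div_lt (show (0 : ℝ) < r from hr)
    exact ha.trans_le ((iInf_le _ n).trans ((hlower n).trans (localModulus_mono _ _ _ hn.le)))
  · obtain ⟨n, hn⟩ := iInf_lt_iff.1 ha
    have hpos : (0 : ℝ) < 1 / (n + 1) := by positivity
    filter_upwards [mem_nhdsWithin_of_mem_nhds (gt_mem_nhds hpos)] with r hr
    exact (hupper n r hr).trans_lt hn

end Modulus

/-! ### Independence of the base point -/

section LocalLaw

variable {N : ℕ} {Ω : Type*} [MeasurableSpace Ω] {P : Measure Ω}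
  {X : EuclideanSpace ℝ (Fin N) → Ω → ℝ} {σ : EuclideanSpace ℝ (Fin N) → ℝ}

lemma IsGaussianFieldWithStd.congr {X' : EuclideanSpace ℝ (Fin N) → Ω → ℝ}
    (hX : IsGaussianFieldWithStd P X σ) (e : ∀ t, X t =ᵐ[P] X' t) :
    IsGaussianFieldWithStd P X' σ := by
  refine ⟨hX.isGaussianProcess.congr e, fun t => ?_, fun s t => ?_⟩
  · rw [← integral_congr_ae (e t), hX.centered]
  · rw [← hX.increments s t]
    exact integral_congr_ae (((e s).sub (e t)).pow_const 2).symm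

/-- The covariance of the increments from a base point does not depend on the base point. -/
lemma IsGaussianFieldWithStd.integral_increment_mul (hX : IsGaussianFieldWithStd P X σ)
    (t₀ s t : EuclideanSpace ℝ (Fin N)) :
    ∫ ω, (X (t₀ + s) ω - X t₀ ω) * (X (t₀ + t) ω - X t₀ ω) ∂P =
      (σ s ^ 2 + σ t ^ 2 - σ (s - t) ^ 2) / 2 := by
  have hm : ∀ a b, Integrable (fun ω => (X a ω - X b ω) ^ 2) P := fun a b =>
    (hX.isGaussianProcess.hasGaussianLaw_fun_sub (s := a) (t := b)).memLp_two.integrable_sq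
  have h1 : ∀ ω, (X (t₀ + s) ω - X t₀ ω) * (X (t₀ + t) ω - X t₀ ω) =
      ((X (t₀ + s) ω - X t₀ ω) ^ 2 + (X (t₀ + t) ω - X t₀ ω) ^ 2 -
        (X (t₀ + s) ω - X (t₀ + t) ω) ^ 2) / 2 := fun ω => by ring
  simp_rw [h1]
  have h2 : Integrable (fun ω => (X (t₀ + s) ω - X t₀ ω) ^ 2 + (X (t₀ + t) ω - X t₀ ω) ^ 2) P :=
    (hm _ _).add (hm _ _)
  rw [integral_div, MeasureTheory.integral_sub h2 (hm _ _), integral_add (hm _ _) (hm _ _),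
    hX.increments, hX.increments, hX.increments, add_sub_cancel_left, add_sub_cancel_left,
    add_sub_add_left_eq_sub]

/-- The limit modulus along a sequence is almost surely equal to a constant which does not depend
on the base point. -/
theorem exists_limSeqModulus_eq (hX : IsGaussianFieldWithStd P X σ)
    (hm : ∀ t, Measurable (X t)) {τ : EuclideanSpace ℝ (Fin N) → ℝ} (hτ : ∀ x, x ≠ 0 → 0 < τ x)
    (hσ : ∀ t, 0 ≤ σ t) {C : ℝ} (hC : ∀ t, σ t ≤ C * τ t) (d : ℕ → EuclideanSpace ℝ (Fin N)) :
    ∃ c : ℝ≥0∞, ∀ t₀, ∀ᵐ ω ∂P,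
      limSeqModulus τ d (fun k => X (t₀ + d k) ω - X t₀ ω) = c := by
  have := hX.isGaussianProcess.isProbabilityMeasure
  let z : EuclideanSpace ℝ (Fin N) → ℕ → Ω → ℝ := fun t₀ k ω => X (t₀ + d k) ω - X t₀ ω
  have hzm : ∀ t₀ k, Measurable (z t₀ k) := fun t₀ k => (hm _).sub (hm _)
  have hzG : ∀ t₀, IsGaussianProcess (z t₀) P := fun t₀ =>
    (hX.isGaussianProcess.shift t₀).comp_right d
  have hz0 : ∀ t₀ k, ∫ ω, z t₀ k ω ∂P = 0 := fun t₀ k => hX.integral_sub _ _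
  have hvar : ∀ k, √(∫ ω, z 0 k ω ^ 2 ∂P) = σ (d k) := by
    intro k
    rw [hX.increments, add_sub_cancel_left, Real.sqrt_sq (hσ _)]
  have hΛ := measurable_limSeqModulus τ d
  obtain ⟨c, hc⟩ := exists_eventuallyEq_const_of_forall_separating (l := ae P)
    (f := fun ω => limSeqModulus τ d fun k => z 0 k ω) MeasurableSet fun U hU =>
      measure_eq_zero_or_one_of_invariant (hzm 0) (hzG 0) (hz0 0) (hΛ hU) fun y g ⟨K, hK⟩ => by
        have hb : ∀ k, |g k| ≤ |K| * C * τ (d k) := fun k => by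
          have h1 := hK k
          rw [hvar] at h1
          calc |g k| ≤ |K| * σ (d k) :=
                h1.trans (mul_le_mul_of_nonneg_right (le_abs_self K) (hσ _))
            _ ≤ |K| * (C * τ (d k)) := mul_le_mul_of_nonneg_left (hC _) (abs_nonneg K)
            _ = _ := by ring
        rw [Set.mem_preimage, Set.mem_preimage, limSeqModulus_add hτ d hb]
  refine ⟨c, fun t₀ => ?_⟩
  have hlaw : P.map (fun ω k => z t₀ k ω) = P.map (fun ω k => z 0 k ω) :=
    map_eq_of_covariance (hzm t₀) (hzm 0) (hzG t₀) (hzG 0) (hz0 t₀) (hz0 0) fun k l =>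
      (hX.integral_increment_mul t₀ (d k) (d l)).trans
        (hX.integral_increment_mul 0 (d k) (d l)).symm
  have hset : MeasurableSet {y : ℕ → ℝ | limSeqModulus τ d y = c} := hΛ (measurableSet_singleton c)
  have h1 : ∀ᵐ y ∂(P.map fun ω k => z 0 k ω), limSeqModulus τ d y = c :=
    (ae_map_iff (measurable_pi_lambda _ (hzm 0)).aemeasurable hset).2 hc
  rw [← hlaw] at h1
  exact (ae_map_iff (measurable_pi_lambda _ (hzm t₀)).aemeasurable hset).1 h1

end LocalLaw

end OSGauss

theorem theorem5p1 {N : ℕ} (hN : 0 < N)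
    (E : Matrix (Fin N) (Fin N) ℝ) (hE : OSGauss.IsAdmissibleJordanForm E)
    (ν : Seminorm ℝ (EuclideanSpace ℝ (Fin N))) (hν : OSGauss.IsPolarNorm E ν)
    (ψ : EuclideanSpace ℝ (Fin N) → ℝ) (hψ : OSGauss.IsSymmHomogeneous E.transpose ψ)
    {Ω : Type*} [MeasurableSpace Ω] (P : Measure Ω) [IsProbabilityMeasure P]
    (X : EuclideanSpace ℝ (Fin N) → Ω → ℝ)
    (hX : OSGauss.IsHarmonizableField P E ψ X) (hsep : OSGauss.IsSeparableField P X) :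
    ∃ C : ℝ, 0 < C ∧ ∀ t₀ : EuclideanSpace ℝ (Fin N), ∀ᵐ ω ∂P,
      Tendsto (fun r : ℝ =>
          OSGauss.localModulus (OSGauss.radial E ν) (fun t => X t ω) t₀ r)
        (𝓝[>] (0 : ℝ)) (𝓝 (ENNReal.ofReal C)) := by
  open OSGauss in
  obtain ⟨hk, W, hW, hXW⟩ := hX.exists_isIsonormal
  have hfield := hX.isGaussianFieldWithStd hψ.symm
  obtain ⟨κ, hκ, hH⟩ := exists_fieldStd_le_rpow hψ hk
  have hcont := hfield.ae_continuous hsep hκ fieldStd_nonneg hH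
  obtain ⟨c₁, -, C₁, -, hcomp⟩ := exists_fieldStd_comparable hN hν hψ hk
  let X' : EuclideanSpace ℝ (Fin N) → Ω → ℝ := fun t =>
    (hfield.isGaussianProcess.aemeasurable t).mk (X t)
  have e : ∀ t, X t =ᵐ[P] X' t := fun t => (hfield.isGaussianProcess.aemeasurable t).ae_eq_mk
  let d := TopologicalSpace.denseSeq (EuclideanSpace ℝ (Fin N))
  obtain ⟨c, hc⟩ := exists_limSeqModulus_eq (hfield.congr e)
    (fun t => (hfield.isGaussianProcess.aemeasurable t).measurable_mk)
    (fun x hx => radial_pos hν hx) fieldStd_nonneg (fun t => (hcomp t).2) d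
  have hlim : ∀ t₀, ∀ᵐ ω ∂P, Tendsto (fun r : ℝ =>
      localModulus (radial E ν) (fun t => X t ω) t₀ r) (𝓝[>] (0 : ℝ)) (𝓝 c) := by
    intro t₀
    filter_upwards [hcont, hc t₀, e t₀, ae_all_iff.2 fun k => e (t₀ + d k)] with ω h1 h2 h3 h4
    have h5 := tendsto_localModulus hν (TopologicalSpace.denseRange_denseSeq _) h1 t₀ (d := d)
    have h6 : (fun k => X (t₀ + d k) ω - X t₀ ω) = fun k => X' (t₀ + d k) ω - X' t₀ ω :=
      funext fun k => by rw [h3, h4]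
    rwa [h6, h2] at h5
  obtain ⟨C, hC⟩ := exists_localModulus_le hN hν hψ hk hfield hcont
  obtain ⟨a, ha, hlow⟩ := exists_le_localModulus hN hν hψ hk hW hXW
  obtain ⟨ω, h1, ⟨r, hr, h2⟩, h3⟩ := ((hlim 0).and (hC.and hlow)).exists
  have hle : c ≤ ENNReal.ofReal C := by
    refine le_of_tendsto h1 ?_
    filter_upwards [mem_nhdsWithin_of_mem_nhds (gt_mem_nhds hr)] with r' hr'
    exact (localModulus_mono _ _ _ hr'.le).trans h2
  have hge : ENNReal.ofReal a ≤ c := by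
    refine ge_of_tendsto h1 ?_
    filter_upwards [self_mem_nhdsWithin] with r' hr'
    exact h3 r' hr'
  have htop : c ≠ ∞ := ne_top_of_le_ne_top ENNReal.ofReal_ne_top hle
  have hpos : c ≠ 0 := ((ENNReal.ofReal_pos.2 ha).trans_le hge).ne'
  refine ⟨c.toReal, ENNReal.toReal_pos hpos htop, ?_⟩
  rw [ENNReal.ofReal_toReal htop]
  exact hlim
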